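/- Let $1<p,s<\infty$. There is a positive constant $C$, depending only on $p,s,n$ if $s<p$ and only on $p,s$ if $p\le s$, such that the following holds. Let $n\ge 2$, let $\Omega\subseteq\mathbb{R}^n$ be a domain (nonempty, connected, open), and let $a=(a_1,\dots,a_n)$ where $a_1,\dots,a_n$ are positive Lebesgue measurable functions in $\Omega$ which on every domain $\omega\Subset\Omega$ are bounded above and below by positive constants. Put $$|\xi|_{s,a}=\Big(\sum_{i=1}^n a_i(x)|\xi_i|^s\Big)^{1/s},\qquad \mathcal{A}(x,\xi)=\nabla_\xi\Big(\tfrac1p|\xi|_{s,a}^p\Big)\qquad(x\in\Omega,\ \xi\in\mathbb{R}^n).$$ Let $V\in M^q_{\rm loc}(p;\Omega)$, i.e. for every domain $\omega\Subset\Omega$: - if $p<n$: $q>n/p$, $V\in L^1_{\rm loc}(\omega)$ and $\sup_{y\in\omega,\,0<r<\operatorname{diam}\omega} r^{-n(q-1)/q}\int_{\omega\cap B_r(y)}|V|\,dx<\infty$; - if $p=n$: $q>n$, $V\in L^1_{\rm loc}(\omega)$ and $\sup_{y\in\omega,\,0<r<\operatorname{diam}\omega}\big(\log(\operatorname{diam}\omega/r)\big)^{q(n-1)/n}\int_{\omega\cap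 B_r(y)}|V|\,dx<\infty$; - if $p>n$: $q=1$ and $V\in L^1(\omega)$. For $\phi\in W^{1,p}(\Omega)\cap C_c(\Omega)$ let $$Q[\phi]=\int_\Omega\big(|\nabla\phi|_{s,a}^p+V|\phi|^p\big)\,dx .$$ A function $g\in L^1_{\rm loc}(\Omega)$ is a Hardy-weight of $Q$ if for some constant $c>0$, $Q[\phi]\ge c\int_\Omega|g||\phi|^p\,dx$ for all $\phi\in C_c^\infty(\Omega)$; let $\mathcal{H}(\Omega)$ be the set of Hardy-weights (functions equal a.e. in $\Omega$ being identified). Let $u\in W^{1,p}_{\rm loc}(\Omega)\cap C(\Omega)$ be a positive weak solution of $-\operatorname{div}\mathcal{A}(x,\nabla v)+V|v|^{p-2}v=0$ in $\Omega$. For compact $K\subseteq\Omega$ let $$\operatorname{cap}(K,u)=\inf\{Q[\phi] : \phi\in W^{1,p}(\Omega)\cap C_c(\Omega),\ \phi\ge u\text{ on }K\},$$ and for $g\in L^1_{\rm loc}(\Omega)$ let $$\|g\|_u=\inf\Big\{L\in[0,\infty) : \int_K|g|u^p\,dx\le L\operatorname{cap}(K,u)\text{ for all compact }K\subseteq\Omega\Big\}\in[0,\infty]$$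 and $\|g\|_{\mathcal{H}}=1/S_g\in[0,\infty]$, where $$S_g=\inf\Big\{\frac{Q[\phi]}{\int_\Omega|g||\phi|^p\,dx} : \phi\in W^{1,p}(\Omega)\cap C_c(\Omega),\ \int_\Omega|g||\phi|^p\,dx>0\Big\}$$ (with $\inf\emptyset=\infty$, $1/0=\infty$, $1/\infty=0$). Then: 1. for every $g\in L^1_{\rm loc}(\Omega)$, $g\in\mathcal{H}(\Omega)$ if and only if $\|g\|_u<\infty$; 2. for every $g\in\mathcal{H}(\Omega)$, $\|g\|_u\le\|g\|_{\mathcal{H}}\le C\|g\|_u$; 3. $\mathcal{H}(\Omega)$ is a real vector space, $\|\cdot\|_u$ is a norm on it, and $(\mathcal{H}(\Omega),\|\cdot\|_u)$ is a Banach space. -/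

import Mathlib

open MeasureTheory Set
open scoped ENNReal NNReal

noncomputable section

namespace HardyMazya

/-- `ℝⁿ` with the Euclidean norm. -/
abbrev Eu (n : ℕ) : Type := EuclideanSpace ℝ (Fin n)

variable {n : ℕ}

/-- A domain in `ℝⁿ`: a nonempty, connected, open set (`IsConnected` includes nonemptiness). -/
def IsDom (Ω : Set (Eu n)) : Prop := IsOpen Ω ∧ IsConnected Ω

/-- `ω ⋐ Ω` with `ω` a domain: the closure of `ω` is a compact subset of `Ω`. -/
def IsSubdom (ω Ω : Set (Eu n)) : Prop := IsDom ω ∧ IsCompact (closure ω) ∧ closure ω ⊆ Ω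

/-! ### Test functions and Sobolev spaces -/

/-- `C_c(Ω)`, each function being extended by zero to `ℝⁿ`. -/
def IsCc (Ω : Set (Eu n)) (φ : Eu n → ℝ) : Prop :=
  Continuous φ ∧ HasCompactSupport φ ∧ tsupport φ ⊆ Ω

/-- `C_c^∞(Ω)`, each function being extended by zero to `ℝⁿ`. -/
def IsTest (Ω : Set (Eu n)) (φ : Eu n → ℝ) : Prop :=
  ContDiff ℝ ((⊤ : ℕ∞) : WithTop ℕ∞) φ ∧ HasCompactSupport φ ∧ tsupport φ ⊆ Ω

/-- `G` is a weak (distributional) gradient of `f` in `Ω`. -/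
def HasWeakGrad (Ω : Set (Eu n)) (f : Eu n → ℝ) (G : Eu n → Eu n) : Prop :=
  LocallyIntegrableOn f Ω ∧ LocallyIntegrableOn G Ω ∧
    ∀ η : Eu n → ℝ, IsTest Ω η → ∀ i : Fin n,
      ∫ x in Ω, f x * fderiv ℝ η x (EuclideanSpace.single i 1) = - ∫ x in Ω, G x i * η x

open Classical in
/-- The weak gradient `∇f` in `Ω` (unique up to a null subset of `Ω`), and `0` if there is none. -/
def weakGrad (Ω : Set (Eu n)) (f : Eu n → ℝ) : Eu n → Eu n :=
  if h : ∃ G, HasWeakGrad Ω f G then h.choose else 0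

/-- `W^{1,p}(Ω)`. -/
def MemW1p (p : ℝ) (Ω : Set (Eu n)) (f : Eu n → ℝ) : Prop :=
  MemLp f (ENNReal.ofReal p) (volume.restrict Ω) ∧
    ∃ G, HasWeakGrad Ω f G ∧ MemLp G (ENNReal.ofReal p) (volume.restrict Ω)

/-- `W^{1,p}_loc(Ω)`. -/
def MemW1pLoc (p : ℝ) (Ω : Set (Eu n)) (f : Eu n → ℝ) : Prop :=
  ∃ G, HasWeakGrad Ω f G ∧ ∀ K : Set (Eu n), IsCompact K → K ⊆ Ω →
    MemLp f (ENNReal.ofReal p) (volume.restrict K) ∧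
    MemLp G (ENNReal.ofReal p) (volume.restrict K)

/-! ### The local Morrey space -/

/-- `sup_{y ∈ ω, 0 < r < diam ω} w(r) ∫_{ω ∩ B_r(y)} |f| dx`. -/
def morreySup (w : ℝ → ℝ) (ω : Set (Eu n)) (f : Eu n → ℝ) : ℝ≥0∞ :=
  ⨆ (y : Eu n) (_ : y ∈ ω) (r : ℝ) (_ : 0 < r) (_ : r < Metric.diam ω),
    ENNReal.ofReal (w r) * ∫⁻ x in ω ∩ Metric.ball y r, ‖f x‖ₑ

/-- `f ∈ M^q(p; ω)`, with the admissible exponents `q`: `q > n/p` if `p < n`, `q > n` if `p = n`,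
and `q = 1` if `p > n`. Here `n/q' = n / (q/(q-1))` and `q/n' = q / (n/(n-1))`. -/
def MemMorrey (p q : ℝ) (ω : Set (Eu n)) (f : Eu n → ℝ) : Prop :=
  (p < n ∧ n / p < q ∧ LocallyIntegrableOn f ω ∧
      morreySup (fun r => 1 / r ^ ((n : ℝ) / (q / (q - 1)))) ω f < ∞) ∨
  (p = n ∧ n < q ∧ LocallyIntegrableOn f ω ∧
      morreySup (fun r => Real.log (Metric.diam ω / r) ^ (q / ((n : ℝ) / (n - 1)))) ω f < ∞) ∨
  (n < p ∧ q = 1 ∧ IntegrableOn f ω)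

/-- `f ∈ M^q_loc(p; Ω)`. -/
def MemMorreyLoc (p q : ℝ) (Ω : Set (Eu n)) (f : Eu n → ℝ) : Prop :=
  ∀ ω : Set (Eu n), IsSubdom ω Ω → MemMorrey p q ω f

/-! ### The norm family, the energy functional and the equation -/

/-- The coefficients `a = (a₁, …, aₙ)`: positive Lebesgue measurable functions in `Ω` that are
locally bounded above and below by positive constants. -/
def IsCoeff (Ω : Set (Eu n)) (a : Eu n → Fin n → ℝ) : Prop :=
  (∀ i, AEMeasurable (fun x => a x i) (volume.restrict Ω)) ∧
  (∀ x ∈ Ω, ∀ i, 0 < a x i) ∧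
  ∀ ω : Set (Eu n), IsSubdom ω Ω → ∃ c C : ℝ, 0 < c ∧
    ∀ᵐ x ∂(volume.restrict ω), ∀ i, c ≤ a x i ∧ a x i ≤ C

/-- `H(x, ξ) = |ξ|_{s,a} = (∑ᵢ aᵢ(x) |ξᵢ|^s)^{1/s}`. -/
def saNorm (s : ℝ) (a : Eu n → Fin n → ℝ) (x ξ : Eu n) : ℝ :=
  (∑ i, a x i * |ξ i| ^ s) ^ (1 / s)

/-- `𝒜(x, ξ) = ∇_ξ F(x, ξ)` with `F(x, ξ) = H(x, ξ)^p / p`. -/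
def opA (p s : ℝ) (a : Eu n → Fin n → ℝ) (x ξ : Eu n) : Eu n :=
  gradient (fun ζ : Eu n => 1 / p * saNorm s a x ζ ^ p) ξ

/-- The energy `Q[φ] = ∫_Ω (H(x, ∇φ)^p + V |φ|^p) dx`. -/
def energy (p s : ℝ) (Ω : Set (Eu n)) (a : Eu n → Fin n → ℝ) (V φ : Eu n → ℝ) : ℝ :=
  ∫ x in Ω, (saNorm s a x (weakGrad Ω φ x) ^ p + V x * |φ x| ^ p)

/-- `v` is a weak solution of `Q'[v] = -div 𝒜(x, ∇v) + V |v|^{p-2} v = 0` in `Ω`. -/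
def IsWeakSol (p s : ℝ) (Ω : Set (Eu n)) (a : Eu n → Fin n → ℝ) (V v : Eu n → ℝ) : Prop :=
  MemW1pLoc p Ω v ∧ ∀ φ : Eu n → ℝ, IsTest Ω φ →
    (∫ x in Ω, inner ℝ (opA p s a x (weakGrad Ω v x)) (gradient φ x)) +
      ∫ x in Ω, V x * (|v x| ^ (p - 2) * v x) * φ x = 0

/-! ### Hardy-weights, capacity and the two norms -/

/-- `g ∈ L¹_loc(Ω)` is a Hardy-weight: `Q[φ] ≥ C ∫_Ω |g| |φ|^p` for some `C > 0` and all
`φ ∈ C_c^∞(Ω)`. -/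
def IsHardyWeight (p s : ℝ) (Ω : Set (Eu n)) (a : Eu n → Fin n → ℝ) (V g : Eu n → ℝ) : Prop :=
  LocallyIntegrableOn g Ω ∧ ∃ C : ℝ, 0 < C ∧ ∀ φ : Eu n → ℝ, IsTest Ω φ →
    C * ∫ x in Ω, |g x| * |φ x| ^ p ≤ energy p s Ω a V φ

/-- `cap(K, u) = inf {Q[φ] | φ ∈ W^{1,p}(Ω) ∩ C_c(Ω), φ ≥ u on K}`. -/
def capacity (p s : ℝ) (Ω : Set (Eu n)) (a : Eu n → Fin n → ℝ) (V u : Eu n → ℝ)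
    (K : Set (Eu n)) : ℝ :=
  sInf {e : ℝ | ∃ φ : Eu n → ℝ, MemW1p p Ω φ ∧ IsCc Ω φ ∧ (∀ x ∈ K, u x ≤ φ x) ∧
    e = energy p s Ω a V φ}

/-- `‖g‖_u`: the infimum of the `L ∈ [0, ∞)` with `∫_K |g| |u|^p ≤ L cap(K, u)` for all compact
`K ⊆ Ω`; it is `∞` if there is no such `L`. -/
def uNorm (p s : ℝ) (Ω : Set (Eu n)) (a : Eu n → Fin n → ℝ) (V u g : Eu n → ℝ) : ℝ≥0∞ :=
  ⨅ (L : ℝ≥0) (_ : ∀ K : Set (Eu n), IsCompact K → K ⊆ Ω →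
    ∫ x in K, |g x| * |u x| ^ p ≤ L * capacity p s Ω a V u K), (L : ℝ≥0∞)

/-- The Hardy constant `S_g`, the infimum of `Q[φ] / ∫_Ω |g| |φ|^p` over the
`φ ∈ W^{1,p}(Ω) ∩ C_c(Ω)` with `∫_Ω |g| |φ|^p > 0`, as an element of `[0, ∞]` (for a nonnegative
functional `Q`). -/
def hardyConst (p s : ℝ) (Ω : Set (Eu n)) (a : Eu n → Fin n → ℝ) (V g : Eu n → ℝ) : ℝ≥0∞ :=
  ⨅ (φ : Eu n → ℝ) (_ : MemW1p p Ω φ) (_ : IsCc Ω φ)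
    (_ : 0 < ∫⁻ x in Ω, ENNReal.ofReal (|g x| * |φ x| ^ p)),
    ENNReal.ofReal (energy p s Ω a V φ) / ∫⁻ x in Ω, ENNReal.ofReal (|g x| * |φ x| ^ p)

/-- `‖g‖_ℋ = 1 / S_g`. -/
def hNorm (p s : ℝ) (Ω : Set (Eu n)) (a : Eu n → Fin n → ℝ) (V g : Eu n → ℝ) : ℝ≥0∞ :=
  (hardyConst p s Ω a V g)⁻¹

/-- `N` is a norm on the real vector space `X`, and `X` is complete with respect to it. -/
def IsBanachNorm (X : Type*) [AddCommGroup X] [Module ℝ X] (N : X → ℝ) : Prop :=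
  ∃ core : @NormedSpace.Core ℝ X _ _ _ ⟨N⟩,
    @CompleteSpace X
      (@NormedAddCommGroup.ofCore ℝ X _ _ _ ⟨N⟩ core).toMetricSpace.toUniformSpace

end HardyMazya

end

open HardyMazya

namespace HardyMazya

/-! ### Bregman distances of powers of a norm -/

/-! Write ψ = φ/u. Testing the equation of u with Picone's function |φ|^p u^{1-p} turns the energy
into an integral of Bregman distances, Q[φ] = ∫ B(x; ψ∇u, ∇φ - ψ∇u), where B(x; ξ, η) = |ξ+η|^p -
|ξ|^p - p⟨𝒜(x,ξ), η⟩ ≥ 0 and |·| = |·|_{s,a} (`IsPosSol.energy_eq`). The potential V no longer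
appears, the integrand is nonnegative, and its second argument is formally u∇ψ.

The comparison ‖g‖_ℋ ≤ C‖g‖_u is Maz'ya's truncation argument applied to ψ. For a function f of one
variable, the energy density of u f(ψ) is B(x; f(ψ)∇u, f'(ψ)u∇ψ). So what is needed is a truncation
f at level t, vanishing for |ψ| ≤ t and equal to 1 for |ψ| ≥ 2t, whose density is at most C t^{-p}
times that of φ, and only where t ≤ |ψ| < 2t. Since B is jointly p-homogeneous, this amounts to
controlling B(ξ, qη) by B(ξ, η) with q = rf'(r)/f(r). The quotient q is unbounded where f is close
to 0, but B grows only polynomially in its second argument, so a high power of a smooth step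
compensates (`exists_bregman_trunc_le`). Using u f(ψ) as a competitor for the capacity of {|ψ| ≥
2t}, and summing over dyadic t, each level contributes the energy of one dyadic annulus and the
annuli are disjoint (`exists_hardy_of_capacity`).

Polynomial growth of B comes from doubling, B(ξ, 2η) ≤ C B(ξ, η), with C depending on p and s only
(`exists_bregman_doubling`). For the square of a real number the Bregman distance is z², so doubling
is plain. It passes from one power of a norm to another because the two Bregman distances are
comparable when the step is at most a multiple of the base point, while for larger steps the p-th
power distance is comparable to the p-th power of the step (`exists_powBreg_doubling`). This is used
twice: from |·|² to |·|^s on the line, then, after summing over coordinates, from the s-th to the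
p-th power of |·|_{s,a}. No ellipticity constant or dimension enters.

The inequality ‖g‖_u ≤ ‖g‖_ℋ is direct, since a competitor φ for cap(K,u) satisfies φ ≥ u > 0 on K
(`IsPosSol.uNorm_le_hNorm`). The norm axioms hold compact set by compact set. Completeness follows
because a ‖·‖_u-Cauchy sequence multiplied by u^p is Cauchy in L¹(K) for every compact K, and
Fatou's lemma carries the capacitary bounds to the limit (`IsPosSol.exists_limit`). -/

theorem rpow_tangent_nonneg {p t : ℝ} (hp : 1 ≤ p) (ht : 0 ≤ t) : 0 ≤ t ^ p - 1 - p * (t - 1) := by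
  have h := one_add_mul_self_le_rpow_one_add (s := t - 1) (by linarith) hp
  rw [add_sub_cancel] at h
  linarith

/-- The Bregman distances of `t ↦ t ^ p` and `t ↦ t ^ s` from the point `1` are comparable on
bounded intervals. -/
theorem exists_rpow_tangent_le {p s : ℝ} (hp : 1 < p) (hs : 1 < s) (T : ℝ) :
    ∃ C : ℝ, 0 < C ∧ ∀ t, 0 ≤ t → t ≤ T →
      t ^ p - 1 - p * (t - 1) ≤ C * (t ^ s - 1 - s * (t - 1)) := by
  obtain ⟨B, hB⟩ := (isCompact_Icc (a := (1 / 2 : ℝ)) (b := max T 2)).exists_bound_of_continuousOn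
    (f := fun t : ℝ => t ^ (p - s)) (fun t ht => (Real.continuousAt_rpow_const _ _
      (Or.inl (by linarith [ht.1]))).continuousWithinAt)
  have hd : 0 < (1 / 2 : ℝ) ^ s - 1 - s * (1 / 2 - 1) := by
    have h := one_add_mul_self_lt_rpow_one_add (s := -1 / 2) (by norm_num) (by norm_num) hs
    norm_num at h ⊢
    linarith
  have hs1 : 0 < s * (s - 1) := by nlinarith
  have hp1 : 0 < p * (p - 1) := by nlinarith
  set d := (1 / 2 : ℝ) ^ s - 1 - s * (1 / 2 - 1) with hd_def
  -- The second entry dominates the ratio of the second derivatives and serves t > 1/2. The third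
  -- serves t ≤ 1/2, where the p-gap is at most p - 1 and the s-gap at least d, its value at 1/2.
  set C := max 1 (max (p * (p - 1) * B / (s * (s - 1))) ((p - 1) / d)) with hC
  have hC0 : 0 < C := lt_of_lt_of_le one_pos (le_max_left _ _)
  have hC1 : p * (p - 1) * B ≤ C * (s * (s - 1)) := by
    rw [← div_le_iff₀ hs1]
    exact (le_max_left _ _).trans (le_max_right _ _)
  have hC2 : p - 1 ≤ C * d := by
    rw [← div_le_iff₀ hd]
    exact (le_max_right _ _).trans (le_max_right _ _)
  refine ⟨C, hC0, fun t ht htT => ?_⟩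
  rcases le_or_gt t (1 / 2) with h2 | h2
  · have h1 : t ^ p ≤ t := by
      simpa using Real.rpow_le_rpow_of_exponent_ge_of_imp ht (by linarith) hp.le (by intro _ h; linarith)
    have h3 : d ≤ t ^ s - 1 - s * (t - 1) := by
      -- Here 1/2 is written as the convex combination l t + (1 - l)·1. The s-gap is convex and
      -- vanishes at 1, so its value at 1/2 is at most l times its value at t.
      have hc := (convexOn_rpow hs.le).2 (mem_Ici.2 ht) (mem_Ici.2 zero_le_one)
        (show 0 ≤ 1 / 2 / (1 - t) by apply div_nonneg <;> linarith)
        (show 0 ≤ 1 - 1 / 2 / (1 - t) by rw [sub_nonneg, div_le_one (by linarith)]; linarith)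
        (by ring)
      set l := 1 / 2 / (1 - t) with hl
      have hl1 : l * (1 - t) = 1 / 2 := by
        rw [hl]; field_simp [show 1 - t ≠ 0 by linarith]
      have hl2 : l ≤ 1 := by rw [hl, div_le_one (by linarith)]; linarith
      have he : l • t + (1 - l) • (1 : ℝ) = 1 / 2 := by simp only [smul_eq_mul]; linarith
      rw [he] at hc
      simp only [smul_eq_mul, Real.one_rpow] at hc
      have hn := rpow_tangent_nonneg hs.le ht
      have : d ≤ l * (t ^ s - 1 - s * (t - 1)) := by
        rw [hd_def]; linear_combination hc - s * hl1
      nlinarith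
    nlinarith [mul_le_mul_of_nonneg_left h3 hC0.le]
  -- The difference f is convex on [1/2, max T 2] and vanishes to first order at 1, hence is
  -- nonnegative there. The 2 keeps the point 1 in the interval for every T.
  · set f : ℝ → ℝ := fun y => C * (y ^ s - 1 - s * (y - 1)) - (y ^ p - 1 - p * (y - 1)) with hf
    set f' : ℝ → ℝ := fun y => C * (s * y ^ (s - 1) - s) - (p * y ^ (p - 1) - p) with hf'
    set f'' : ℝ → ℝ := fun y =>
      C * (s * ((s - 1) * y ^ (s - 1 - 1))) - p * ((p - 1) * y ^ (p - 1 - 1)) with hf''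
    have hder : ∀ y, 0 < y → HasDerivAt f (f' y) y := by
      intro y hy
      have e1 := (Real.hasDerivAt_rpow_const (x := y) (p := s) (Or.inl hy.ne'))
      have e2 := (Real.hasDerivAt_rpow_const (x := y) (p := p) (Or.inl hy.ne'))
      have := (((e1.sub_const 1).sub (((hasDerivAt_id y).sub_const 1).const_mul s)).const_mul C).sub
        ((e2.sub_const 1).sub (((hasDerivAt_id y).sub_const 1).const_mul p))
      exact this.congr_deriv (by simp only [hf']; ring)
    have hder2 : ∀ y, 0 < y → HasDerivAt f' (f'' y) y := by
      intro y hy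
      have e1 := (Real.hasDerivAt_rpow_const (x := y) (p := s - 1) (Or.inl hy.ne'))
      have e2 := (Real.hasDerivAt_rpow_const (x := y) (p := p - 1) (Or.inl hy.ne'))
      exact (((e1.const_mul s).sub_const s).const_mul C).sub ((e2.const_mul p).sub_const p)
    have hpos : ∀ y ∈ interior (Icc (1 / 2 : ℝ) (max T 2)), 0 < y := fun y hy => by
      linarith [(interior_subset hy).1]
    have hconv : ConvexOn ℝ (Icc (1 / 2 : ℝ) (max T 2)) f := by
      refine convexOn_of_hasDerivWithinAt2_nonneg (f' := f') (f'' := f'') (convex_Icc _ _)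
        (fun y hy => (hder y (by linarith [hy.1])).continuousAt.continuousWithinAt)
        (fun y hy => (hder y (hpos y hy)).hasDerivWithinAt)
        (fun y hy => (hder2 y (hpos y hy)).hasDerivWithinAt) (fun y hy => ?_)
      have hy0 := hpos y hy
      have hb := hB y (interior_subset hy)
      rw [Real.norm_of_nonneg (by positivity)] at hb
      have hy2 : y ^ (p - 1 - 1) = y ^ (p - s) * y ^ (s - 1 - 1) := by
        rw [← Real.rpow_add hy0]; ring_nf
      have hq : 0 < y ^ (s - 1 - 1) := by positivity
      simp only [hf'', hy2]
      have : p * (p - 1) * y ^ (p - s) ≤ C * (s * (s - 1)) :=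
        (mul_le_mul_of_nonneg_left hb hp1.le).trans hC1
      nlinarith
    have hf1 : f 1 = 0 := by simp [hf]
    have hf'1 : HasDerivAt f 0 1 := by simpa [hf'] using hder 1 one_pos
    have m1 : (1 : ℝ) ∈ Icc (1 / 2 : ℝ) (max T 2) :=
      ⟨by norm_num, le_trans (by norm_num) (le_max_right _ _)⟩
    have mt : t ∈ Icc (1 / 2 : ℝ) (max T 2) := ⟨h2.le, htT.trans (le_max_left _ _)⟩
    have key : 0 ≤ f t := by
      rcases lt_trichotomy t 1 with h | h | h
      · have := hconv.slope_le_of_hasDerivAt mt m1 h hf'1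
        rw [slope_def_field, hf1, div_le_iff₀ (by linarith)] at this
        linarith
      · rw [h, hf1]
      · have := hconv.le_slope_of_hasDerivAt m1 mt h hf'1
        rw [slope_def_field, hf1, le_div_iff₀ (by linarith)] at this
        linarith
    simp only [hf] at key
    linarith

/-- The Bregman distance of the `p`-th power of a norm, in terms of the norm `N₀` of the base point,
the norm `N₁` of the end point, and the derivative `l` of the norm in the direction of the step. -/
noncomputable def powBreg (p N₀ N₁ l : ℝ) : ℝ := N₁ ^ p - N₀ ^ p - p * (N₀ ^ (p - 1) * l)

/-- The distance splits into the scalar gap of t ↦ t^p at 1 and the defect N₁ - N₀ - l of the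
subgradient inequality. The defect depends on the exponent only through the factor p, so comparing
two exponents reduces to comparing scalar gaps. -/
theorem powBreg_eq {p N₀ N₁ : ℝ} (l : ℝ) (h0 : 0 < N₀) (h1 : 0 ≤ N₁) :
    powBreg p N₀ N₁ l = N₀ ^ p * (((N₁ / N₀) ^ p - 1 - p * (N₁ / N₀ - 1)) +
      p * ((N₁ - N₀ - l) / N₀)) := by
  have e : N₀ ^ p = N₀ ^ (p - 1) * N₀ := by
    rw [← Real.rpow_add_one h0.ne']; ring_nf
  rw [powBreg, Real.div_rpow h1 h0.le]
  have : N₀ ^ p ≠ 0 := by positivity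
  have h3 : N₀ ^ p * (N₁ ^ p / N₀ ^ p) = N₁ ^ p := by field_simp
  have h4 : N₀ ^ p / N₀ = N₀ ^ (p - 1) := by rw [e]; field_simp
  calc _ = N₀ ^ p * (N₁ ^ p / N₀ ^ p) - N₀ ^ p - p * (N₀ ^ p / N₀ * l) := by rw [h3, h4]
    _ = _ := by field_simp; ring

theorem powBreg_nonneg {p N₀ N₁ l : ℝ} (hp : 1 < p) (h0 : 0 ≤ N₀) (h1 : 0 ≤ N₁)
    (hl : l ≤ N₁ - N₀) : 0 ≤ powBreg p N₀ N₁ l := by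
  rcases h0.eq_or_lt with rfl | h0
  · simp [powBreg, Real.zero_rpow (show p - 1 ≠ 0 by linarith),
      Real.zero_rpow (show p ≠ 0 by linarith)]
    positivity
  · rw [powBreg_eq l h0 h1]
    have := rpow_tangent_nonneg hp.le (div_nonneg h1 h0.le)
    have h2 : 0 ≤ (N₁ - N₀ - l) / N₀ := div_nonneg (by linarith) h0.le
    positivity

/-- Both terms of `powBreg_eq` are comparable across exponents as long as N₁/N₀ stays bounded: the
scalar gaps by `exists_rpow_tangent_le`, the defects with ratio p/s. -/
theorem exists_powBreg_le {p s : ℝ} (hp : 1 < p) (hs : 1 < s) (T : ℝ) :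
    ∃ C : ℝ, 0 < C ∧ ∀ N₀ N₁ l : ℝ, 0 < N₀ → 0 ≤ N₁ → N₁ ≤ T * N₀ → l ≤ N₁ - N₀ →
      powBreg p N₀ N₁ l / N₀ ^ p ≤ C * (powBreg s N₀ N₁ l / N₀ ^ s) := by
  obtain ⟨C, hC, h⟩ := exists_rpow_tangent_le hp hs T
  refine ⟨max C (p / s), lt_max_of_lt_left hC, fun N₀ N₁ l h0 h1 hT hl => ?_⟩
  rw [powBreg_eq l h0 h1, powBreg_eq l h0 h1, mul_div_cancel_left₀ _ (by positivity),
    mul_div_cancel_left₀ _ (by positivity)]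
  have h2 : 0 ≤ (N₁ - N₀ - l) / N₀ := div_nonneg (by linarith) h0.le
  have h3 := h (N₁ / N₀) (div_nonneg h1 h0.le) ((div_le_iff₀ h0).2 hT)
  have h4 := rpow_tangent_nonneg hs.le (div_nonneg h1 h0.le)
  have h5 : p ≤ max C (p / s) * s := by
    rw [← div_le_iff₀ (by linarith)]; exact le_max_right _ _
  nlinarith [mul_le_mul_of_nonneg_right h5 h2, mul_le_mul_of_nonneg_right (le_max_left C (p / s)) h4]

/-- If the Bregman distances of the `s`-th power of a norm satisfy a doubling inequality, then so do
those of its `p`-th power. -/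
theorem exists_powBreg_doubling {p s : ℝ} (hp : 1 < p) (hs : 1 < s) (B : ℝ) :
    ∃ C : ℝ, 0 < C ∧ ∀ N₀ N₁ N₂ M l : ℝ, 0 ≤ N₀ → 0 ≤ N₁ → 0 ≤ N₂ → 0 ≤ M → M ≤ N₁ + N₀ →
      N₁ ≤ N₀ + M → N₂ ≤ N₀ + 2 * M → |l| ≤ M → l ≤ N₁ - N₀ → 2 * l ≤ N₂ - N₀ →
      powBreg s N₀ N₂ (2 * l) ≤ B * powBreg s N₀ N₁ l →
      powBreg p N₀ N₂ (2 * l) ≤ C * powBreg p N₀ N₁ l := by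
  -- The expression tends to 1 as ε → 0. It is a lower bound for the p-distance divided by M^p when
  -- N₀ < εM.
  obtain ⟨ε, hε0, hε1, hε⟩ : ∃ ε : ℝ, 0 < ε ∧ ε ≤ 1 ∧
      1 / 2 ≤ (1 - ε) ^ p - ε ^ p - p * ε ^ (p - 1) := by
    have hc : ContinuousAt (fun ε : ℝ => (1 - ε) ^ p - ε ^ p - p * ε ^ (p - 1)) 0 := by
      refine ((ContinuousAt.rpow_const (by fun_prop) (Or.inl (by norm_num))).sub
        (ContinuousAt.rpow_const (by fun_prop) (Or.inr (by linarith)))).sub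
        (ContinuousAt.mul continuousAt_const
          (ContinuousAt.rpow_const (by fun_prop) (Or.inr (by linarith))))
    have h0 : (1 / 2 : ℝ) < (1 - 0) ^ p - 0 ^ p - p * 0 ^ (p - 1) := by
      rw [Real.zero_rpow (by linarith), Real.zero_rpow (by linarith)]; norm_num
    obtain ⟨r, hr, hr'⟩ := Metric.eventually_nhds_iff.1 (hc.eventually (lt_mem_nhds h0))
    refine ⟨min (r / 2) 1, by positivity, min_le_right _ _, (hr' ?_).le⟩
    rw [Real.dist_0_eq_abs, abs_of_pos (by positivity)]
    exact (min_le_left _ _).trans_lt (by linarith)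
  -- If N₀ ≥ εM, then N₁ and N₂ are at most N₀ + 2M ≤ (1 + 2/ε)N₀, which is the range in which the
  -- exponents p and s can be exchanged.
  obtain ⟨C1, hC1, h1⟩ := exists_powBreg_le hp hs (1 + 2 / ε)
  obtain ⟨C2, hC2, h2⟩ := exists_powBreg_le hs hp (1 + 2 / ε)
  set C := max (C1 * |B| * C2) (2 * (3 ^ p + 2 * p)) with hC
  have hCpos : 0 < C := lt_max_of_lt_right (by positivity)
  refine ⟨C, hCpos, fun N₀ N₁ N₂ M l hN0 hN1 hN2 hM hM1 hN1M hN2M hlM hl hl2 hB => ?_⟩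
  have hnn := powBreg_nonneg hp hN0 hN1 hl
  -- For a large step the distance at N₁ is at least M^p/2 and the one at N₂ at most (3^p + 2p)M^p,
  -- since N₂ ≤ 3M. For a small step one passes from p to s, uses doubling for s, and returns to p.
  rcases lt_or_ge N₀ (ε * M) with h | h
  · have hMpos : 0 < M := by
      by_contra hM0
      have : M = 0 := le_antisymm (not_lt.1 hM0) hM
      rw [this] at h; linarith
    have hMp : M ^ p = M ^ (p - 1) * M := by rw [← Real.rpow_add_one hMpos.ne']; ring_nf
    have hp1 : 0 ≤ p - 1 := by linarith
    have hN0M : N₀ ≤ M := h.le.trans (mul_le_of_le_one_left hM hε1)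
    have a1 : ((1 - ε) * M) ^ p ≤ N₁ ^ p :=
      Real.rpow_le_rpow (mul_nonneg (by linarith) hM) (by linarith) (by linarith)
    have a2 : N₀ ^ p ≤ (ε * M) ^ p := Real.rpow_le_rpow hN0 h.le (by linarith)
    have a3 : N₀ ^ (p - 1) ≤ (ε * M) ^ (p - 1) := Real.rpow_le_rpow hN0 h.le hp1
    rw [Real.mul_rpow (by linarith) hM] at a1
    rw [Real.mul_rpow hε0.le hM] at a2 a3
    have a4 : N₀ ^ (p - 1) * l ≤ ε ^ (p - 1) * M ^ p := by
      calc _ ≤ N₀ ^ (p - 1) * M := by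
            gcongr; exact (le_abs_self _).trans hlM
        _ ≤ ε ^ (p - 1) * M ^ (p - 1) * M := by gcongr
        _ = _ := by rw [hMp]; ring
    have a5 : 1 / 2 * M ^ p ≤ powBreg p N₀ N₁ l := by
      have : 0 ≤ M ^ p := by positivity
      rw [powBreg]; nlinarith
    have b1 : N₂ ^ p ≤ (3 * M) ^ p := Real.rpow_le_rpow hN2 (by linarith) (by linarith)
    rw [Real.mul_rpow (by norm_num) hM] at b1
    have b2 : -(N₀ ^ (p - 1) * (2 * l)) ≤ 2 * M ^ p := by
      calc _ = N₀ ^ (p - 1) * (2 * -l) := by ring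
        _ ≤ N₀ ^ (p - 1) * (2 * M) := by
            gcongr; exact (neg_le_abs _).trans hlM
        _ ≤ M ^ (p - 1) * (2 * M) := by gcongr
        _ = _ := by rw [hMp]; ring
    have b3 : powBreg p N₀ N₂ (2 * l) ≤ (3 ^ p + 2 * p) * M ^ p := by
      have : 0 ≤ N₀ ^ p := by positivity
      rw [powBreg]; nlinarith
    calc _ ≤ 2 * (3 ^ p + 2 * p) * (1 / 2 * M ^ p) := by linarith
      _ ≤ C * powBreg p N₀ N₁ l := by
        gcongr
        exact le_max_right _ _
  · rcases hN0.eq_or_lt with h0 | h0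
    · have hM0 : M = 0 := by
        rw [← h0] at h; nlinarith
      have e1 : N₁ = 0 := by linarith
      have e2 : N₂ = 0 := by linarith
      have e3 : l = 0 := by simpa [hM0] using hlM
      simp [e1, e2, e3, ← h0, powBreg, Real.zero_rpow (show p ≠ 0 by linarith)]
    · have hMN : M ≤ N₀ / ε := by rw [le_div_iff₀ hε0]; linarith
      have t2 : N₂ ≤ (1 + 2 / ε) * N₀ := by
        calc N₂ ≤ N₀ + 2 * (N₀ / ε) := by linarith
          _ = _ := by ring
      have t1 : N₁ ≤ (1 + 2 / ε) * N₀ := by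
        calc N₁ ≤ N₀ + 2 * (N₀ / ε) := by linarith
          _ = _ := by ring
      have g1 := h1 N₀ N₂ (2 * l) h0 hN2 t2 hl2
      have g2 := h2 N₀ N₁ l h0 hN1 t1 hl
      have hsn := powBreg_nonneg hs hN0 hN1 hl
      have g3 : powBreg s N₀ N₂ (2 * l) / N₀ ^ s ≤ |B| * (powBreg s N₀ N₁ l / N₀ ^ s) := by
        rw [← mul_div_assoc]
        gcongr
        exact hB.trans (mul_le_mul_of_nonneg_right (le_abs_self B) hsn)
      have g4 : powBreg p N₀ N₂ (2 * l) / N₀ ^ p ≤ C * (powBreg p N₀ N₁ l / N₀ ^ p) := by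
        calc _ ≤ C1 * (powBreg s N₀ N₂ (2 * l) / N₀ ^ s) := g1
          _ ≤ C1 * (|B| * (C2 * (powBreg p N₀ N₁ l / N₀ ^ p))) := by
              gcongr
              exact g3.trans (by gcongr)
          _ = C1 * |B| * C2 * (powBreg p N₀ N₁ l / N₀ ^ p) := by ring
          _ ≤ _ := by
              gcongr
              exact le_max_left _ _
      rw [← mul_div_assoc] at g4
      exact (div_le_div_iff_of_pos_right (by positivity)).1 g4


/-! ### The weighted `ℓˢ` norm and its derivative -/

section Norm

variable {n : ℕ} {p s : ℝ} {a : Eu n → Fin n → ℝ} {x : Eu n}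

theorem saNorm_sum_nonneg (ha : ∀ i, 0 < a x i) (ξ : Eu n) : 0 ≤ ∑ i, a x i * |ξ i| ^ s :=
  Finset.sum_nonneg fun i _ => mul_nonneg (ha i).le (by positivity)

theorem saNorm_nonneg (ha : ∀ i, 0 < a x i) (ξ : Eu n) : 0 ≤ saNorm s a x ξ :=
  Real.rpow_nonneg (saNorm_sum_nonneg ha ξ) _

theorem saNorm_rpow (ha : ∀ i, 0 < a x i) (ξ : Eu n) (r : ℝ) :
    saNorm s a x ξ ^ r = (∑ i, a x i * |ξ i| ^ s) ^ (r / s) := by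
  rw [saNorm, ← Real.rpow_mul (saNorm_sum_nonneg ha ξ), one_div_mul_eq_div]

theorem saNorm_rpow_self (hs : 1 < s) (ha : ∀ i, 0 < a x i) (ξ : Eu n) :
    saNorm s a x ξ ^ s = ∑ i, a x i * |ξ i| ^ s := by
  rw [saNorm_rpow ha, div_self (by linarith), Real.rpow_one]

@[simp]
theorem saNorm_zero (hs : 1 < s) : saNorm s a x 0 = 0 := by
  simp [saNorm, Real.zero_rpow (show s ≠ 0 by linarith), show s ≠ 0 by linarith]

theorem saNorm_eq_zero (hs : 1 < s) (ha : ∀ i, 0 < a x i) {ξ : Eu n} :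
    saNorm s a x ξ = 0 ↔ ξ = 0 := by
  refine ⟨fun h => ?_, fun h => by rw [h, saNorm_zero hs]⟩
  have h1 := saNorm_rpow_self hs ha ξ
  rw [h, Real.zero_rpow (by linarith), eq_comm,
    Finset.sum_eq_zero_iff_of_nonneg fun i _ => mul_nonneg (ha i).le (by positivity)] at h1
  ext i
  have h2 := (mul_eq_zero.1 (h1 i (Finset.mem_univ i))).resolve_left (ha i).ne'
  simpa using (Real.rpow_eq_zero (abs_nonneg _) (by linarith)).1 h2

theorem saNorm_smul (hs : 1 < s) (ha : ∀ i, 0 < a x i) (c : ℝ) (ξ : Eu n) :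
    saNorm s a x (c • ξ) = |c| * saNorm s a x ξ := by
  have : ∑ i, a x i * |(c • ξ) i| ^ s = |c| ^ s * ∑ i, a x i * |ξ i| ^ s := by
    rw [Finset.mul_sum]
    refine Finset.sum_congr rfl fun i _ => ?_
    rw [PiLp.smul_apply, smul_eq_mul, abs_mul, Real.mul_rpow (abs_nonneg _) (abs_nonneg _)]
    ring
  rw [saNorm, this, Real.mul_rpow (by positivity) (saNorm_sum_nonneg ha ξ), ← saNorm,
    one_div, Real.rpow_rpow_inv (abs_nonneg c) (by linarith)]

theorem saNorm_eq_Lp (hs : 1 < s) (ha : ∀ i, 0 < a x i) (ξ : Eu n) :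
    saNorm s a x ξ = (∑ i, |a x i ^ (1 / s) * ξ i| ^ s) ^ (1 / s) := by
  rw [saNorm]
  congr 1
  refine Finset.sum_congr rfl fun i _ => ?_
  rw [abs_mul, Real.mul_rpow (abs_nonneg _) (abs_nonneg _),
    abs_of_nonneg (Real.rpow_nonneg (ha i).le _), one_div,
    Real.rpow_inv_rpow (ha i).le (by linarith)]

theorem saNorm_add_le (hs : 1 < s) (ha : ∀ i, 0 < a x i) (ξ η : Eu n) :
    saNorm s a x (ξ + η) ≤ saNorm s a x ξ + saNorm s a x η := by
  rw [saNorm_eq_Lp hs ha, saNorm_eq_Lp hs ha, saNorm_eq_Lp hs ha]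
  refine le_trans (le_of_eq ?_) (Real.Lp_add_le _ _ _ hs.le)
  simp [mul_add]

theorem saNorm_le_mul_norm (hs : 1 < s) (ha : ∀ i, 0 < a x i) (ξ : Eu n) :
    saNorm s a x ξ ≤ (∑ i, a x i) ^ (1 / s) * ‖ξ‖ := by
  have hA : 0 ≤ ∑ i, a x i := Finset.sum_nonneg fun i _ => (ha i).le
  have h : ∑ i, a x i * |ξ i| ^ s ≤ (∑ i, a x i) * ‖ξ‖ ^ s := by
    rw [Finset.sum_mul]
    refine Finset.sum_le_sum fun i _ => mul_le_mul_of_nonneg_left ?_ (ha i).le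
    exact Real.rpow_le_rpow (abs_nonneg _) (by simpa using PiLp.norm_apply_le ξ i) (by linarith)
  calc saNorm s a x ξ ≤ ((∑ i, a x i) * ‖ξ‖ ^ s) ^ (1 / s) :=
        Real.rpow_le_rpow (saNorm_sum_nonneg ha ξ) h (by positivity)
    _ = _ := by
        rw [Real.mul_rpow hA (by positivity), one_div, Real.rpow_rpow_inv (norm_nonneg _)
          (by linarith)]

/-- The derivative of `|·|_{s,a}` at `ξ` in the direction `η`. -/
noncomputable def saDeriv (s : ℝ) (a : Eu n → Fin n → ℝ) (x ξ η : Eu n) : ℝ :=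
  saNorm s a x ξ ^ (1 - s) * ∑ i, a x i * (|ξ i| ^ (s - 2) * ξ i * η i)

theorem saDeriv_add (ξ η ζ : Eu n) :
    saDeriv s a x ξ (η + ζ) = saDeriv s a x ξ η + saDeriv s a x ξ ζ := by
  simp only [saDeriv, PiLp.add_apply, ← mul_add, ← Finset.sum_add_distrib]

theorem saDeriv_smul (ξ η : Eu n) (c : ℝ) :
    saDeriv s a x ξ (c • η) = c * saDeriv s a x ξ η := by
  simp only [saDeriv, PiLp.smul_apply, smul_eq_mul, Finset.mul_sum]
  exact Finset.sum_congr rfl fun i _ => by ring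

theorem saDeriv_zero_left (η : Eu n) : saDeriv s a x 0 η = 0 := by
  simp [saDeriv]

theorem abs_rpow_sub_two_mul_sq (hs : 1 < s) (y : ℝ) : |y| ^ (s - 2) * y * y = |y| ^ s := by
  rcases eq_or_ne y 0 with rfl | hy
  · simp [Real.zero_rpow (show s ≠ 0 by linarith)]
  · rw [mul_assoc, ← abs_mul_abs_self y, ← sq, ← Real.rpow_natCast, ← Real.rpow_add (by positivity)]
    norm_num

theorem abs_rpow_sub_two_mul_abs (hs : 1 < s) (y : ℝ) : |y| ^ (s - 2) * |y| = |y| ^ (s - 1) := by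
  rcases eq_or_ne y 0 with rfl | hy
  · simp [Real.zero_rpow (show s - 1 ≠ 0 by linarith)]
  · rw [← Real.rpow_add_one (by positivity)]; ring_nf

theorem saDeriv_self (hs : 1 < s) (ha : ∀ i, 0 < a x i) (ξ : Eu n) :
    saDeriv s a x ξ ξ = saNorm s a x ξ := by
  rcases eq_or_ne ξ 0 with rfl | h
  · rw [saDeriv_zero_left, saNorm_zero hs]
  · have hpos : 0 < saNorm s a x ξ := (saNorm_nonneg ha ξ).lt_of_ne'
      (mt (saNorm_eq_zero hs ha).1 h)
    simp only [saDeriv, abs_rpow_sub_two_mul_sq hs]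
    rw [← saNorm_rpow_self hs ha, ← Real.rpow_add hpos]
    simp

/-- Hölder's inequality with exponents s/(s-1) and s for the weights a_i: the derivative of a norm
has dual norm at most 1. The value 0 assigned at ξ = 0 is consistent with this. -/
theorem abs_saDeriv_le (hs : 1 < s) (ha : ∀ i, 0 < a x i) (ξ η : Eu n) :
    |saDeriv s a x ξ η| ≤ saNorm s a x η := by
  rcases eq_or_ne ξ 0 with rfl | h
  · rw [saDeriv_zero_left, abs_zero]; exact saNorm_nonneg ha η
  have hpos : 0 < saNorm s a x ξ := (saNorm_nonneg ha ξ).lt_of_ne'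
    (mt (saNorm_eq_zero hs ha).1 h)
  have hq : (s / (s - 1)).HolderConjugate s := (Real.HolderConjugate.conjExponent hs).symm
  have hs1 : s - 1 ≠ 0 := by linarith
  have key : |∑ i, a x i * (|ξ i| ^ (s - 2) * ξ i * η i)| ≤
      saNorm s a x ξ ^ (s - 1) * saNorm s a x η := by
    calc _ ≤ ∑ i, |a x i * (|ξ i| ^ (s - 2) * ξ i * η i)| := Finset.abs_sum_le_sum_abs _ _
      _ = ∑ i, (a x i * |ξ i| ^ s) ^ (1 / (s / (s - 1))) * (a x i * |η i| ^ s) ^ (1 / s) := by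
        refine Finset.sum_congr rfl fun i _ => ?_
        rw [abs_mul, abs_mul, abs_mul, abs_of_pos (ha i), abs_of_nonneg (by positivity),
          abs_rpow_sub_two_mul_abs hs, Real.mul_rpow (ha i).le (by positivity),
          Real.mul_rpow (ha i).le (by positivity), ← Real.rpow_mul (abs_nonneg _),
          ← Real.rpow_mul (abs_nonneg _)]
        have e1 : s * (1 / (s / (s - 1))) = s - 1 := by field_simp
        have e2 : s * (1 / s) = 1 := by field_simp
        have e3 : a x i = a x i ^ (1 / (s / (s - 1))) * a x i ^ (1 / s) := by
          rw [← Real.rpow_add (ha i), show 1 / (s / (s - 1)) + 1 / s = 1 by field_simp; ring,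
            Real.rpow_one]
        rw [e1, e2, Real.rpow_one]
        nth_rewrite 1 [e3]
        ring
      _ ≤ _ := Real.inner_le_Lp_mul_Lq_of_nonneg _ hq
            (fun i _ => Real.rpow_nonneg (mul_nonneg (ha i).le (by positivity)) _)
            (fun i _ => Real.rpow_nonneg (mul_nonneg (ha i).le (by positivity)) _)
      _ = _ := by
        have e : ∀ ζ : Eu n, ∀ r : ℝ, r ≠ 0 → ∑ i, ((a x i * |ζ i| ^ s) ^ (1 / r)) ^ r =
            ∑ i, a x i * |ζ i| ^ s := fun ζ r hr => Finset.sum_congr rfl fun i _ => by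
          rw [one_div, Real.rpow_inv_rpow (mul_nonneg (ha i).le (by positivity)) hr]
        rw [e ξ _ hq.pos.ne', e η _ (by linarith), saNorm_rpow ha, saNorm, one_div_div]
  rw [saDeriv, abs_mul, abs_of_nonneg (by positivity)]
  calc _ ≤ saNorm s a x ξ ^ (1 - s) * (saNorm s a x ξ ^ (s - 1) * saNorm s a x η) := by gcongr
    _ = _ := by
      rw [← mul_assoc, ← Real.rpow_add hpos]
      simp

/-- The subgradient inequality: apply the dual bound to ξ + η and use that the derivative at ξ in
the direction ξ is |ξ|_{s,a}. At ξ = 0 the assigned value 0 is also a subgradient. -/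
theorem saDeriv_le (hs : 1 < s) (ha : ∀ i, 0 < a x i) (ξ η : Eu n) :
    saDeriv s a x ξ η ≤ saNorm s a x (ξ + η) - saNorm s a x ξ := by
  have h := (le_abs_self _).trans (abs_saDeriv_le hs ha ξ (ξ + η))
  rw [saDeriv_add, saDeriv_self hs ha] at h
  linarith

/-- Away from 0 this is the chain rule for the power p/s of the sum Σ a_i|ξ_i|^s. At 0 the chain
rule may fail, but the p-th power of the norm is O(‖ξ‖^p) with p > 1, so the gradient exists and
vanishes. -/
theorem opA_eq (hp : 1 < p) (hs : 1 < s) (ha : ∀ i, 0 < a x i) (ξ : Eu n) :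
    opA p s a x ξ = WithLp.toLp 2 (fun i =>
      saNorm s a x ξ ^ (p - s) * (a x i * (|ξ i| ^ (s - 2) * ξ i))) := by
  refine HasGradientAt.gradient ?_
  rw [hasGradientAt_iff_hasFDerivAt]
  rcases eq_or_ne ξ 0 with rfl | h
  · have e : (InnerProductSpace.toDual ℝ (Eu n)) (WithLp.toLp 2 (fun i =>
        saNorm s a x 0 ^ (p - s) * (a x i * (|(0 : Eu n) i| ^ (s - 2) * (0 : Eu n) i)))) = 0 := by
      have : (WithLp.toLp 2 (fun i => saNorm s a x 0 ^ (p - s) *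
          (a x i * (|(0 : Eu n) i| ^ (s - 2) * (0 : Eu n) i))) : Eu n) = 0 := by
        ext i; simp
      rw [this, map_zero]
    rw [e]
    -- The Euclidean norm to the power p has derivative 0 at the origin and dominates the p-th power
    -- of the weighted norm up to a constant.
    have h1 := hasFDerivAt_norm_rpow (E := Eu n) 0 hp
    simp only [map_zero, smul_zero] at h1
    refine HasFDerivAt.of_isLittleO (Asymptotics.IsBigO.trans_isLittleO ?_ h1.isLittleO)
    refine Asymptotics.IsBigO.of_bound (1 / p * ((∑ i, a x i) ^ (1 / s)) ^ p)
      (Filter.Eventually.of_forall fun ζ => ?_)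
    have hp0 : p ≠ 0 := by linarith
    simp only [saNorm_zero hs, Real.zero_rpow hp0, norm_zero, mul_zero, sub_zero,
      zero_apply]
    have hA : 0 ≤ ∑ i, a x i := Finset.sum_nonneg fun i _ => (ha i).le
    have hN := saNorm_nonneg (s := s) ha ζ
    rw [Real.norm_of_nonneg (by positivity), Real.norm_of_nonneg (by positivity), mul_assoc,
      ← Real.mul_rpow (by positivity) (norm_nonneg _)]
    gcongr
    exact saNorm_le_mul_norm hs ha ζ
  · have hpos : 0 < saNorm s a x ξ := (saNorm_nonneg ha ξ).lt_of_ne'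
      (mt (saNorm_eq_zero hs ha).1 h)
    have hW : 0 < ∑ i, a x i * |ξ i| ^ s := by
      rw [← saNorm_rpow_self hs ha]; positivity
    have hd : HasFDerivAt (fun ζ : Eu n => ∑ i, a x i * |ζ i| ^ s)
        (∑ i, a x i • ((s * |ξ i| ^ (s - 2) * ξ i) • (EuclideanSpace.proj i : Eu n →L[ℝ] ℝ))) ξ := by
      refine HasFDerivAt.fun_sum fun i _ => ?_
      exact ((hasDerivAt_abs_rpow (ξ i) hs).comp_hasFDerivAt ξ
        (EuclideanSpace.proj i : Eu n →L[ℝ] ℝ).hasFDerivAt).const_mul (a x i)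
    have h2 := (hd.rpow_const (p := p / s) (Or.inl hW.ne')).const_mul (1 / p)
    have e : (fun ζ : Eu n => 1 / p * saNorm s a x ζ ^ p) =
        fun ζ => 1 / p * (∑ i, a x i * |ζ i| ^ s) ^ (p / s) := by
      funext ζ; rw [saNorm_rpow ha]
    rw [e]
    refine h2.congr_fderiv ?_
    ext η
    have hp0 : p ≠ 0 := by linarith
    have hs0 : s ≠ 0 := by linarith
    simp only [smul_apply, sum_apply, smul_eq_mul,
      InnerProductSpace.toDual_apply_apply, PiLp.inner_apply,
      saNorm_rpow ha, RCLike.inner_apply, conj_trivial, Finset.mul_sum]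
    refine Finset.sum_congr rfl fun i _ => ?_
    rw [show (p - s) / s = p / s - 1 by field_simp]
    field_simp
    rfl

theorem inner_opA (hp : 1 < p) (hs : 1 < s) (ha : ∀ i, 0 < a x i) (ξ η : Eu n) :
    inner ℝ (opA p s a x ξ) η = saNorm s a x ξ ^ (p - 1) * saDeriv s a x ξ η := by
  have h1 : inner ℝ (opA p s a x ξ) η =
      saNorm s a x ξ ^ (p - s) * ∑ i, a x i * (|ξ i| ^ (s - 2) * ξ i * η i) := by
    rw [opA_eq hp hs ha, PiLp.inner_apply, Finset.mul_sum]
    refine Finset.sum_congr rfl fun i _ => ?_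
    simp only [RCLike.inner_apply, conj_trivial]
    ring
  rw [h1]
  rcases eq_or_ne ξ 0 with rfl | h
  · simp [saDeriv_zero_left]
  · have hpos : 0 < saNorm s a x ξ := (saNorm_nonneg ha ξ).lt_of_ne'
      (mt (saNorm_eq_zero hs ha).1 h)
    rw [saDeriv, ← mul_assoc, ← Real.rpow_add hpos]
    ring_nf

end Norm


/-! ### The Bregman distance of `|·|_{s,a}^p` -/

/-- The Bregman distance `|ξ + η|_{s,a}^p - |ξ|_{s,a}^p - p ⟨𝒜(x, ξ), η⟩`. -/
noncomputable def bregman {n : ℕ} (p s : ℝ) (a : Eu n → Fin n → ℝ) (x ξ η : Eu n) : ℝ :=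
  saNorm s a x (ξ + η) ^ p - saNorm s a x ξ ^ p - p * inner ℝ (opA p s a x ξ) η

section Bregman

variable {n : ℕ} {p s : ℝ} {a : Eu n → Fin n → ℝ} {x : Eu n}

theorem bregman_eq_powBreg (hp : 1 < p) (hs : 1 < s) (ha : ∀ i, 0 < a x i) (ξ η : Eu n) :
    bregman p s a x ξ η =
      powBreg p (saNorm s a x ξ) (saNorm s a x (ξ + η)) (saDeriv s a x ξ η) := by
  rw [bregman, powBreg, inner_opA hp hs ha]

theorem bregman_nonneg (hp : 1 < p) (hs : 1 < s) (ha : ∀ i, 0 < a x i) (ξ η : Eu n) :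
    0 ≤ bregman p s a x ξ η := by
  rw [bregman_eq_powBreg hp hs ha]
  exact powBreg_nonneg hp (saNorm_nonneg ha _) (saNorm_nonneg ha _) (saDeriv_le hs ha ξ η)

theorem opA_smul (hp : 1 < p) (hs : 1 < s) (ha : ∀ i, 0 < a x i) (c : ℝ) (ξ : Eu n) :
    opA p s a x (c • ξ) = (|c| ^ (p - 2) * c) • opA p s a x ξ := by
  rcases eq_or_ne c 0 with rfl | hc
  · rw [opA_eq hp hs ha]
    ext i
    simp
  rw [opA_eq hp hs ha, opA_eq hp hs ha]
  ext i
  have hc0 : 0 < |c| := abs_pos.2 hc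
  simp only [PiLp.smul_apply, smul_eq_mul, saNorm_smul hs ha, abs_mul]
  rw [Real.mul_rpow hc0.le (saNorm_nonneg ha _), Real.mul_rpow hc0.le (abs_nonneg _),
    show p - 2 = (p - s) + (s - 2) by ring, Real.rpow_add hc0]
  ring

theorem abs_inner_opA_le (hp : 1 < p) (hs : 1 < s) (ha : ∀ i, 0 < a x i) (ξ η : Eu n) :
    |inner ℝ (opA p s a x ξ) η| ≤ saNorm s a x ξ ^ (p - 1) * saNorm s a x η := by
  have := saNorm_nonneg (s := s) ha ξ
  rw [inner_opA hp hs ha, abs_mul, abs_of_nonneg (by positivity)]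
  exact mul_le_mul_of_nonneg_left (abs_saDeriv_le hs ha ξ η) (by positivity)

theorem inner_opA_self (hp : 1 < p) (hs : 1 < s) (ha : ∀ i, 0 < a x i) (ξ : Eu n) :
    inner ℝ (opA p s a x ξ) ξ = saNorm s a x ξ ^ p := by
  rw [inner_opA hp hs ha, saDeriv_self hs ha]
  rcases (saNorm_nonneg (s := s) ha ξ).eq_or_lt with h | h
  · rw [← h, mul_zero, Real.zero_rpow (by linarith)]
  · rw [← Real.rpow_add_one h.ne']; ring_nf

theorem bregman_smul (hp : 1 < p) (hs : 1 < s) (ha : ∀ i, 0 < a x i) (c : ℝ) (ξ η : Eu n) :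
    bregman p s a x (c • ξ) (c • η) = |c| ^ p * bregman p s a x ξ η := by
  rw [bregman, bregman, ← smul_add, saNorm_smul hs ha, saNorm_smul hs ha, opA_smul hp hs ha,
    inner_smul_left, inner_smul_right, conj_trivial, ← mul_assoc (|c| ^ (p - 2) * c),
    abs_rpow_sub_two_mul_sq hp, Real.mul_rpow (abs_nonneg _) (saNorm_nonneg ha _),
    Real.mul_rpow (abs_nonneg _) (saNorm_nonneg ha _)]
  ring

/-- Along a ray the Bregman distance is convex, nonnegative and zero at the origin. Hence its value
at r is at most r/l times its value at l. -/
theorem bregman_smul_right_le (hp : 1 < p) (hs : 1 < s) (ha : ∀ i, 0 < a x i) {r l : ℝ}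
    (hr : 0 ≤ r) (hrl : r ≤ l) (ξ η : Eu n) :
    bregman p s a x ξ (r • η) ≤ bregman p s a x ξ (l • η) := by
  rcases (hr.trans hrl).eq_or_lt with h | h
  · rw [← h] at hrl ⊢
    rw [le_antisymm hrl hr]
  set c := r / l with hc
  have hc0 : 0 ≤ c := div_nonneg hr h.le
  have hc1 : c ≤ 1 := (div_le_one h).2 hrl
  have hcl : r = c * l := by rw [hc]; field_simp
  have h1 : saNorm s a x (ξ + r • η) ^ p ≤
      (1 - c) * saNorm s a x ξ ^ p + c * saNorm s a x (ξ + l • η) ^ p := by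
    have e : ξ + r • η = (1 - c) • ξ + c • (ξ + l • η) := by
      rw [hcl]; module
    have e1 := saNorm_add_le hs ha ((1 - c) • ξ) (c • (ξ + l • η))
    rw [← e, saNorm_smul hs ha, saNorm_smul hs ha, abs_of_nonneg hc0,
      abs_of_nonneg (sub_nonneg.2 hc1)] at e1
    refine (Real.rpow_le_rpow (saNorm_nonneg ha _) e1 (by linarith)).trans ?_
    exact (convexOn_rpow hp.le).2 (mem_Ici.2 (saNorm_nonneg ha ξ))
      (mem_Ici.2 (saNorm_nonneg ha (ξ + l • η))) (sub_nonneg.2 hc1) hc0 (by ring)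
  have h2 := bregman_nonneg hp hs ha ξ (l • η)
  have h3 : bregman p s a x ξ (r • η) ≤ c * bregman p s a x ξ (l • η) := by
    rw [bregman, bregman, inner_smul_right, inner_smul_right, hcl]
    rw [hcl] at h1
    linear_combination h1
  nlinarith

/-- Doubling for the scalar function `|·|^s`. -/
theorem exists_abs_rpow_doubling (hs : 1 < s) :
    ∃ C : ℝ, 0 < C ∧ ∀ y z : ℝ,
      |y + 2 * z| ^ s - |y| ^ s - s * (|y| ^ (s - 2) * y * (2 * z)) ≤
        C * (|y + z| ^ s - |y| ^ s - s * (|y| ^ (s - 2) * y * z)) := by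
  -- For the exponent 2 the Bregman distance on the line is z², so doubling holds with constant 4.
  -- It is transferred from 2 to s with sign(y)z as the derivative of the absolute value.
  obtain ⟨C, hC, h⟩ := exists_powBreg_doubling hs one_lt_two 4
  refine ⟨C, hC, fun y z => ?_⟩
  have e : ∀ {q : ℝ}, 1 < q → ∀ w : ℝ, |y| ^ (q - 1) * (SignType.sign y * w) =
      |y| ^ (q - 2) * y * w := by
    intro q hq w
    rw [← abs_rpow_sub_two_mul_abs hq, mul_assoc, ← mul_assoc |y|, mul_comm |y|, sign_mul_abs]
    ring
  have hsg : |(SignType.sign y : ℝ)| ≤ 1 := by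
    rcases lt_trichotomy y 0 with h | h | h <;> simp [h]
  have hl : ∀ w : ℝ, SignType.sign y * w ≤ |y + w| - |y| := by
    intro w
    have : SignType.sign y * (y + w) ≤ |y + w| := by
      refine (le_abs_self _).trans ?_
      rw [abs_mul]
      exact mul_le_of_le_one_left (abs_nonneg _) hsg
    rw [mul_add, sign_mul_self] at this
    linarith
  have := h |y| |y + z| |y + 2 * z| |z| (SignType.sign y * z) (abs_nonneg _) (abs_nonneg _)
    (abs_nonneg _) (abs_nonneg _)
    (by have := abs_add_le (y + z) (-y); rw [abs_neg] at this; simpa using this) (abs_add_le _ _)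
    ((abs_add_le _ _).trans (by rw [abs_mul, abs_two]))
    (by rw [abs_mul]; exact mul_le_of_le_one_left (abs_nonneg _) hsg) (hl z)
    (by have := hl (2 * z); linarith) (by
      rw [powBreg, powBreg, mul_left_comm 2 (SignType.sign y : ℝ) z, e one_lt_two, e one_lt_two]
      simp only [Real.rpow_two, sq_abs, sub_self, Real.rpow_zero]
      linarith)
  rw [powBreg, powBreg, mul_left_comm 2 (SignType.sign y : ℝ) z, e hs, e hs] at this
  exact this

/-- For the exponent s the power of the norm is a sum of one-variable functions, so its Bregman
distance decouples and scalar estimates apply coordinate by coordinate with the same constant. -/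
theorem powBreg_self_eq_sum (hs : 1 < s) (ha : ∀ i, 0 < a x i) (ξ η : Eu n) :
    powBreg s (saNorm s a x ξ) (saNorm s a x (ξ + η)) (saDeriv s a x ξ η) =
      ∑ i, a x i * (|ξ i + η i| ^ s - |ξ i| ^ s - s * (|ξ i| ^ (s - 2) * ξ i * η i)) := by
  have h : saNorm s a x ξ ^ (s - 1) * saDeriv s a x ξ η =
      ∑ i, a x i * (|ξ i| ^ (s - 2) * ξ i * η i) := by
    rcases eq_or_ne ξ 0 with rfl | h
    · simp [saDeriv_zero_left]
    · have hpos : 0 < saNorm s a x ξ := (saNorm_nonneg ha ξ).lt_of_ne'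
        (mt (saNorm_eq_zero hs ha).1 h)
      rw [saDeriv, ← mul_assoc, ← Real.rpow_add hpos]
      simp
  rw [powBreg, h, saNorm_rpow_self hs ha, saNorm_rpow_self hs ha, Finset.mul_sum,
    ← Finset.sum_sub_distrib, ← Finset.sum_sub_distrib]
  refine Finset.sum_congr rfl fun i _ => ?_
  rw [PiLp.add_apply]
  ring

end Bregman

/-- The doubling property of the Bregman distance, with a constant depending on `p` and `s` only. -/
theorem exists_bregman_doubling {p s : ℝ} (hp : 1 < p) (hs : 1 < s) :
    ∃ C : ℝ, 0 < C ∧ ∀ (n : ℕ) (a : Eu n → Fin n → ℝ) (x : Eu n), (∀ i, 0 < a x i) →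
      ∀ ξ η : Eu n, bregman p s a x ξ ((2 : ℝ) • η) ≤ C * bregman p s a x ξ η := by
  obtain ⟨B, hB, h⟩ := exists_abs_rpow_doubling hs
  -- Summation over coordinates with positive weights keeps the scalar constant B, so the transfer
  -- from s to p yields a constant independent of n, a and x.
  obtain ⟨C, hC, h'⟩ := exists_powBreg_doubling hp hs B
  refine ⟨C, hC, fun n a x ha ξ η => ?_⟩
  rw [bregman_eq_powBreg hp hs ha, bregman_eq_powBreg hp hs ha, saDeriv_smul]
  refine h' _ _ _ (saNorm s a x η) _ (saNorm_nonneg ha _) (saNorm_nonneg ha _)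
    (saNorm_nonneg ha _) (saNorm_nonneg ha _) ?_ (saNorm_add_le hs ha _ _) ?_
    (abs_saDeriv_le hs ha _ _) (saDeriv_le hs ha _ _) ?_ ?_
  · have h1 := saNorm_add_le hs ha (ξ + η) ((-1 : ℝ) • ξ)
    rw [saNorm_smul hs ha] at h1
    simpa using h1
  · have h1 := saNorm_add_le hs ha ξ ((2 : ℝ) • η)
    rwa [saNorm_smul hs ha, abs_two] at h1
  · rw [← saDeriv_smul]; exact saDeriv_le hs ha _ _
  · rw [← saDeriv_smul, powBreg_self_eq_sum hs ha, powBreg_self_eq_sum hs ha, Finset.mul_sum]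
    refine Finset.sum_le_sum fun i _ => ?_
    rw [mul_left_comm B]
    refine mul_le_mul_of_nonneg_left ?_ (ha i).le
    simpa using h (ξ i) (η i)

/-- Iterated doubling. If the doubling constant is below 2^m and 2^k ≤ l < 2^{k+1}, then k + 1
doublings cost (2^{k+1})^m ≤ (2l)^m. The exponent m depends on p and s only. -/
theorem exists_bregman_growth {p s : ℝ} (hp : 1 < p) (hs : 1 < s) :
    ∃ m : ℕ, ∀ (n : ℕ) (a : Eu n → Fin n → ℝ) (x : Eu n), (∀ i, 0 < a x i) →
      ∀ (ξ η : Eu n) (l : ℝ), 1 ≤ l →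
        bregman p s a x ξ (l • η) ≤ (2 * l) ^ m * bregman p s a x ξ η := by
  obtain ⟨C, hC, h⟩ := exists_bregman_doubling hp hs
  obtain ⟨m, hm⟩ := pow_unbounded_of_one_lt C (one_lt_two (α := ℝ))
  refine ⟨m, fun n a x ha ξ η l hl => ?_⟩
  have h0 := bregman_nonneg hp hs ha ξ η
  have hk : ∀ k : ℕ, bregman p s a x ξ ((2 : ℝ) ^ k • η) ≤ ((2 : ℝ) ^ k) ^ m *
      bregman p s a x ξ η := by
    intro k
    induction k with
    | zero => simp
    | succ k ih =>
      have e : (2 : ℝ) ^ (k + 1) • η = (2 : ℝ) • ((2 : ℝ) ^ k • η) := by rw [smul_smul, pow_succ']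
      rw [e]
      calc _ ≤ C * bregman p s a x ξ ((2 : ℝ) ^ k • η) := h n a x ha ξ _
        _ ≤ 2 ^ m * (((2 : ℝ) ^ k) ^ m * bregman p s a x ξ η) :=
            mul_le_mul hm.le ih (bregman_nonneg hp hs ha _ _) (by positivity)
        _ = _ := by rw [pow_succ', mul_pow]; ring
  obtain ⟨k, hk1, hk2⟩ := exists_nat_pow_near hl (one_lt_two (α := ℝ))
  calc _ ≤ bregman p s a x ξ ((2 : ℝ) ^ (k + 1) • η) :=
        bregman_smul_right_le hp hs ha (by linarith) hk2.le ξ η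
    _ ≤ _ := hk (k + 1)
    _ ≤ _ := by
      gcongr
      rw [pow_succ']
      gcongr

/-! ### Smooth truncation -/

/-- A smooth truncation at level `t`: it vanishes on `|r| ≤ t` and equals `1` on `|r| ≥ 2 t`. -/
noncomputable def trunc (k : ℕ) (t r : ℝ) : ℝ := Real.smoothTransition (r ^ 2 / t ^ 2 - 1) ^ k

theorem contDiff_trunc (k : ℕ) (t : ℝ) : ContDiff ℝ 1 (trunc k t) := by
  unfold trunc
  have := Real.smoothTransition.contDiff (n := 1)
  fun_prop

theorem trunc_eq_zero {k : ℕ} (hk : k ≠ 0) {t r : ℝ} (ht : 0 < t) (h : |r| ≤ t) :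
    trunc k t r = 0 := by
  have : r ^ 2 / t ^ 2 - 1 ≤ 0 := by
    rw [sub_nonpos, div_le_one (by positivity), ← sq_abs r]
    gcongr
  rw [trunc, Real.smoothTransition.zero_of_nonpos this, zero_pow hk]

theorem trunc_eq_one {k : ℕ} {t r : ℝ} (ht : 0 < t) (h : 2 * t ≤ |r|) :
    trunc k t r = 1 := by
  have : 1 ≤ r ^ 2 / t ^ 2 - 1 := by
    rw [le_sub_iff_add_le, le_div_iff₀ (by positivity), ← sq_abs r]
    nlinarith
  rw [trunc, Real.smoothTransition.one_of_one_le this, one_pow]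

theorem deriv_smoothTransition_of_nonpos {y : ℝ} (hy : y ≤ 0) :
    deriv Real.smoothTransition y = 0 := by
  apply IsLocalMin.deriv_eq_zero
  refine Filter.Eventually.of_forall fun z => ?_
  simp only [Real.smoothTransition.zero_of_nonpos hy]
  exact Real.smoothTransition.nonneg z

theorem deriv_smoothTransition_of_one_le {y : ℝ} (hy : 1 ≤ y) :
    deriv Real.smoothTransition y = 0 := by
  apply IsLocalMax.deriv_eq_zero
  refine Filter.Eventually.of_forall fun z => ?_
  simp only [Real.smoothTransition.one_of_one_le hy]
  exact Real.smoothTransition.le_one z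

/-- The derivative vanishes outside [0,1] and is continuous. The normalization B ≥ 1 makes the
dilation factor 8kB/g at least 1, as the growth estimate requires. -/
theorem exists_deriv_smoothTransition_le :
    ∃ B : ℝ, 1 ≤ B ∧ ∀ y, deriv Real.smoothTransition y ≤ B := by
  have hc : Continuous (deriv Real.smoothTransition) :=
    (Real.smoothTransition.contDiff (n := 1)).continuous_deriv le_rfl
  obtain ⟨B, hB⟩ := (isCompact_Icc (a := (0 : ℝ)) (b := 1)).exists_bound_of_continuousOn
    hc.continuousOn
  refine ⟨max 1 B, le_max_left _ _, fun y => ?_⟩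
  rcases le_total y 0 with h | h
  · rw [deriv_smoothTransition_of_nonpos h]; positivity
  rcases le_total 1 y with h1 | h1
  · rw [deriv_smoothTransition_of_one_le h1]; positivity
  · exact (le_abs_self _).trans ((hB y ⟨h, h1⟩).trans (le_max_right _ _))

theorem hasDerivAt_trunc (k : ℕ) (t r : ℝ) :
    HasDerivAt (trunc k t) (k * Real.smoothTransition (r ^ 2 / t ^ 2 - 1) ^ (k - 1) *
      (deriv Real.smoothTransition (r ^ 2 / t ^ 2 - 1) * (2 * r / t ^ 2))) r := by
  have h1 : HasDerivAt (fun r : ℝ => r ^ 2 / t ^ 2 - 1) (2 * r / t ^ 2) r := by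
    have := ((hasDerivAt_pow 2 r).div_const (t ^ 2)).sub_const 1
    simpa using this
  have h2 := (((Real.smoothTransition.contDiff (n := 1)).differentiable one_ne_zero)
    (r ^ 2 / t ^ 2 - 1)).hasDerivAt
  exact (h2.comp r h1).pow k

theorem deriv_trunc_eq_zero {k : ℕ} {t r : ℝ} (ht : 0 < t) (h : |r| ≤ t ∨ 2 * t ≤ |r|) :
    deriv (trunc k t) r = 0 := by
  rw [(hasDerivAt_trunc k t r).deriv]
  rcases h with h | h
  · have : r ^ 2 / t ^ 2 - 1 ≤ 0 := by
      rw [sub_nonpos, div_le_one (by positivity), ← sq_abs r]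
      gcongr
    simp [deriv_smoothTransition_of_nonpos this]
  · have : 1 ≤ r ^ 2 / t ^ 2 - 1 := by
      rw [le_sub_iff_add_le, le_div_iff₀ (by positivity), ← sq_abs r]
      nlinarith
    simp [deriv_smoothTransition_of_one_le this]

theorem bregman_zero_right {n : ℕ} {p s : ℝ} {a : Eu n → Fin n → ℝ} {x : Eu n} (ξ : Eu n) :
    bregman p s a x ξ 0 = 0 := by
  simp [bregman]

/-- The effect of a smooth truncation on the Bregman distance. -/
theorem exists_bregman_trunc_le {p s : ℝ} (hp : 1 < p) (hs : 1 < s) :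
    ∃ (k : ℕ) (C : ℝ), k ≠ 0 ∧ 0 < C ∧ ∀ (n : ℕ) (a : Eu n → Fin n → ℝ) (x : Eu n),
      (∀ i, 0 < a x i) → ∀ (ξ η : Eu n) (t r : ℝ), 0 < t →
        t ^ p * bregman p s a x (trunc k t r • ξ) (deriv (trunc k t) r • η) ≤
          if t ≤ |r| ∧ |r| < 2 * t then C * bregman p s a x (r • ξ) η else 0 := by
  obtain ⟨m, hm⟩ := exists_bregman_growth hp hs
  obtain ⟨B, hB1, hB⟩ := exists_deriv_smoothTransition_le
  set k := m + 1 with hk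
  refine ⟨k, (2 * (8 * k * B)) ^ m, by omega, by positivity, fun n a x ha ξ η t r ht => ?_⟩
  by_cases hr : t ≤ |r| ∧ |r| < 2 * t
  swap
  · rw [if_neg hr, deriv_trunc_eq_zero ht, zero_smul, bregman_zero_right, mul_zero]
    by_contra! h
    exact hr ⟨h.1.le, h.2⟩
  rw [if_pos hr]
  have hD := bregman_nonneg hp hs ha (r • ξ) η
  set y := r ^ 2 / t ^ 2 - 1 with hy
  set g := Real.smoothTransition y with hg
  have hg0 : 0 ≤ g := Real.smoothTransition.nonneg y
  have hg1 : g ≤ 1 := Real.smoothTransition.le_one y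
  -- Where g = 0 the quotient q has no meaning, but the derivative of the truncation vanishes there
  -- as well.
  rcases hg0.eq_or_lt with hgz | hgpos
  · have hy0 : y ≤ 0 := by
      by_contra! hy0
      exact (Real.smoothTransition.pos_of_pos hy0).ne hgz
    rw [(hasDerivAt_trunc k t r).deriv, ← hy, deriv_smoothTransition_of_nonpos hy0, zero_mul,
      mul_zero, zero_smul, bregman_zero_right, mul_zero]
    positivity
  have hr0 : r ≠ 0 := abs_pos.1 (ht.trans_le hr.1)
  have hT : trunc k t r = g ^ k := rfl
  -- the quotient `r f'(r) / f(r)` for the truncation `f`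
  set q := k * (deriv Real.smoothTransition y * (2 * r ^ 2 / t ^ 2)) / g with hq
  have hd : deriv (trunc k t) r = g ^ k / r * q := by
    rw [(hasDerivAt_trunc k t r).deriv, ← hy, ← hg, hq, hk, Nat.add_sub_cancel]
    field_simp
    ring
  have hrt : r ^ 2 / t ^ 2 ≤ 4 := by
    rw [div_le_iff₀ (by positivity), ← sq_abs r]
    nlinarith [hr.2, abs_nonneg r]
  have hmono : 0 ≤ deriv Real.smoothTransition y := Real.smoothTransition.monotone.deriv_nonneg
  have hq0 : 0 ≤ q := by positivity
  -- The 8 is twice the bound 4 of r²/t² on the annulus.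
  have hql : q ≤ 8 * k * B / g := by
    rw [hq]
    refine div_le_div_of_nonneg_right ?_ hg0
    calc _ ≤ k * (B * 8) := by
          refine mul_le_mul_of_nonneg_left (mul_le_mul (hB y) ?_ (by positivity) (by linarith))
            (by positivity)
          rw [mul_div_assoc]; linarith
      _ = _ := by ring
  have hk1 : (1 : ℝ) ≤ k := by rw [hk]; push_cast; linarith [Nat.cast_nonneg (α := ℝ) m]
  have hl1 : 1 ≤ 8 * k * B / g := by
    rw [le_div_iff₀ hgpos]
    nlinarith
  -- Both arguments carry the common factor f(r)/r, namely f(r)ξ = (f(r)/r)(rξ) and f'(r)η =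
  -- (f(r)/r)(qη), and homogeneity extracts its p-th power.
  have e1 : bregman p s a x (trunc k t r • ξ) (deriv (trunc k t) r • η) =
      (g ^ k / |r|) ^ p * bregman p s a x (r • ξ) (q • η) := by
    have h1 : trunc k t r • ξ = (g ^ k / r) • (r • ξ) := by
      rw [smul_smul, hT, div_mul_cancel₀ _ hr0]
    rw [h1, hd, ← smul_smul, bregman_smul hp hs ha, abs_div, abs_of_nonneg (pow_nonneg hg0 k)]
  rw [e1]
  have e2 : bregman p s a x (r • ξ) (q • η) ≤
      (2 * (8 * k * B)) ^ m / g ^ m * bregman p s a x (r • ξ) η := by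
    refine (bregman_smul_right_le hp hs ha hq0 hql _ _).trans ((hm n a x ha _ _ _ hl1).trans ?_)
    rw [← mul_div_assoc, div_pow]
  -- On the annulus t ≤ |r|, so t g^k/|r| ≤ g^k ≤ 1. Raising it to the power p > 1 only decreases
  -- it.
  have e3 : t ^ p * (g ^ k / |r|) ^ p ≤ g ^ m := by
    rw [← Real.mul_rpow ht.le (by positivity)]
    have h1 : t * (g ^ k / |r|) ≤ g ^ k := by
      rw [← mul_div_assoc, div_le_iff₀ (ht.trans_le hr.1), mul_comm]
      exact mul_le_mul_of_nonneg_left hr.1 (by positivity)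
    have h2 : t * (g ^ k / |r|) ≤ 1 := h1.trans (pow_le_one₀ hg0 hg1)
    have h3 : 0 ≤ t * (g ^ k / |r|) := by positivity
    calc _ ≤ t * (g ^ k / |r|) := by
          simpa using Real.rpow_le_rpow_of_exponent_ge_of_imp h3 h2 hp.le (by intro _ h; linarith)
      _ ≤ g ^ k := h1
      _ ≤ g ^ m := pow_le_pow_of_le_one hg0 hg1 (by omega)
  calc _ = t ^ p * (g ^ k / |r|) ^ p * bregman p s a x (r • ξ) (q • η) := by ring
    _ ≤ g ^ m * ((2 * (8 * k * B)) ^ m / g ^ m * bregman p s a x (r • ξ) η) :=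
        mul_le_mul e3 e2 (bregman_nonneg hp hs ha _ _) (by positivity)
    _ = _ := by field_simp


/-! ### Mollification in `Lᵖ` -/

section Mollify

open scoped Convolution Topology
open ContinuousLinearMap Filter

variable {n : ℕ} {F : Type*} [NormedAddCommGroup F]

/-- Translations are measure preserving and depend continuously on the vector, and composition with
such maps is continuous in Lᵖ for p < ∞. -/
theorem exists_eLpNorm_translate_sub_le {p : ℝ≥0∞} (hp1 : 1 ≤ p) (hp : p ≠ ∞) {G : Eu n → F}
    (hG : MemLp G p volume) {ε : ℝ≥0∞} (hε : 0 < ε) :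
    ∃ δ : ℝ, 0 < δ ∧ ∀ y : Eu n, ‖y‖ < δ → eLpNorm (fun x => G (x - y) - G x) p volume ≤ ε := by
  have : Fact (1 ≤ p) := ⟨hp1⟩
  let g : Eu n → C(Eu n, Eu n) := fun y => ⟨fun x => x - y, by fun_prop⟩
  have hg : Continuous g := by
    refine ContinuousMap.continuous_of_continuous_uncurry _ ?_
    exact continuous_snd.sub continuous_fst
  have hm : ∀ y, MeasurePreserving (g y) (volume : Measure (Eu n)) volume := fun y =>
    measurePreserving_sub_right volume y
  have hcont := (continuous_const (y := hG.toLp G)).compMeasurePreservingLp hg hm hp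
  have h0 := (hcont.tendsto 0).eventually (Metric.eball_mem_nhds _ hε)
  obtain ⟨δ, hδ, h⟩ := Metric.eventually_nhds_iff.1 h0
  refine ⟨δ, hδ, fun y hy => ?_⟩
  have h1 := h (y := y) (by simpa using hy)
  rw [Lp.edist_def] at h1
  refine le_trans (le_of_eq (eLpNorm_congr_ae ?_)) h1.le
  have e1 := Lp.coeFn_compMeasurePreserving (hG.toLp G) (hm y)
  have e2 := Lp.coeFn_compMeasurePreserving (hG.toLp G) (hm 0)
  have e3 : (hG.toLp G ∘ g y) =ᵐ[volume] G ∘ g y :=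
    (hm y).quasiMeasurePreserving.ae_eq_comp hG.coeFn_toLp
  have e4 : (hG.toLp G ∘ g 0) =ᵐ[volume] G ∘ g 0 :=
    (hm 0).quasiMeasurePreserving.ae_eq_comp hG.coeFn_toLp
  filter_upwards [e1, e2, e3, e4] with x h1 h2 h3 h4
  rw [Pi.sub_apply, h1, h2, h3, h4]
  simp [g]

variable [NormedSpace ℝ F] [CompleteSpace F]

/-- A mollification is an average of translates with respect to the probability measure ρ(y)dy.
Jensen's inequality and Tonelli's theorem bound its Lᵖ error by the largest translation error over
the support of ρ. -/
theorem eLpNorm_convolution_sub_le {p : ℝ≥0∞} (hp1 : 1 ≤ p) (hp : p ≠ ∞) {G : Eu n → F}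
    (hG : MemLp G p volume) {ε : ℝ≥0∞} (φ : ContDiffBump (0 : Eu n))
    (h : ∀ y : Eu n, ‖y‖ < φ.rOut → eLpNorm (fun x => G (x - y) - G x) p volume ≤ ε) :
    eLpNorm (fun x => (φ.normed volume ⋆[lsmul ℝ ℝ, volume] G) x - G x) p volume ≤ ε := by
  -- A strongly measurable representative makes (x, y) ↦ G(x - y) - G(x) jointly measurable, as
  -- Tonelli requires.
  wlog hsm : StronglyMeasurable G generalizing G
  · have e := hG.1.ae_eq_mk
    have hG' : MemLp (hG.1.mk G) p volume := (memLp_congr_ae e).1 hG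
    have h1 := this hG' (fun y hy => ?_) hG.1.stronglyMeasurable_mk
    · rw [convolution_congr _ (EventuallyEq.refl _ (φ.normed volume)) e]
      refine le_trans (le_of_eq (eLpNorm_congr_ae ?_)) h1
      filter_upwards [e] with x hx
      rw [hx]
    · refine le_trans (le_of_eq (eLpNorm_congr_ae ?_)) (h y hy)
      have e2 : (fun x => G (x - y)) =ᵐ[volume] fun x => hG.1.mk G (x - y) :=
        (measurePreserving_sub_right volume y).quasiMeasurePreserving.ae_eq_comp e
      filter_upwards [e, e2] with x hx hx2
      rw [hx, hx2]
  have hp0 : p ≠ 0 := (one_pos.trans_le hp1).ne'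
  set r := p.toReal with hr
  have hr1 : 1 ≤ r := by
    rw [hr, ← ENNReal.toReal_one]; exact ENNReal.toReal_mono hp hp1
  have hr0 : 0 < r := by linarith
  set ρ : Eu n → ℝ := φ.normed volume with hρ
  have hρ0 : ∀ y, 0 ≤ ρ y := φ.nonneg_normed
  have hρm : Measurable fun y => ENNReal.ofReal (ρ y) :=
    φ.continuous_normed.measurable.ennreal_ofReal
  set ν : Measure (Eu n) := volume.withDensity fun y => ENNReal.ofReal (ρ y) with hν
  have hνp : IsProbabilityMeasure ν := by
    refine ⟨?_⟩
    rw [hν, withDensity_apply _ MeasurableSet.univ, Measure.restrict_univ,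
      ← ofReal_integral_eq_lintegral_ofReal φ.integrable_normed (ae_of_all _ hρ0),
      φ.integral_normed, ENNReal.ofReal_one]
  have hloc : LocallyIntegrable G volume := hG.locallyIntegrable hp1
  have hpt : ∀ x, ‖(ρ ⋆[lsmul ℝ ℝ, volume] G) x - G x‖ₑ ^ r ≤
      ∫⁻ y, ‖G (x - y) - G x‖ₑ ^ r ∂ν := by
    intro x
    have hex : Integrable (fun y => ρ y • G (x - y)) volume :=
      (φ.hasCompactSupport_normed.convolutionExists_left (lsmul ℝ ℝ) φ.continuous_normed hloc x)
    have e1 : (ρ ⋆[lsmul ℝ ℝ, volume] G) x - G x = ∫ y, ρ y • (G (x - y) - G x) := by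
      simp only [smul_sub]
      rw [integral_sub hex (φ.integrable_normed.smul_const _), φ.integral_normed_smul]
      rfl
    have hm : StronglyMeasurable fun y => G (x - y) - G x :=
      (hsm.comp_measurable (measurable_const.sub measurable_id)).sub stronglyMeasurable_const
    -- Jensen's inequality enters as monotonicity of the L^r norms in r for a probability measure.
    have e2 : ‖(ρ ⋆[lsmul ℝ ℝ, volume] G) x - G x‖ₑ ≤ eLpNorm' (fun y => G (x - y) - G x) 1 ν := by
      rw [e1, eLpNorm'_eq_lintegral_enorm, hν, lintegral_withDensity_eq_lintegral_mul _ hρm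
        (by simpa using hm.enorm)]
      simp only [ENNReal.rpow_one, Pi.mul_apply, div_one]
      refine (enorm_integral_le_lintegral_enorm _).trans (le_of_eq (lintegral_congr fun y => ?_))
      rw [enorm_smul, Real.enorm_of_nonneg (hρ0 y)]
    have e3 := e2.trans (eLpNorm'_le_eLpNorm'_of_exponent_le one_pos hr1 ν
      hm.aestronglyMeasurable)
    calc _ ≤ _ := ENNReal.rpow_le_rpow e3 hr0.le
      _ = _ := by
        rw [eLpNorm'_eq_lintegral_enorm, one_div, ENNReal.rpow_inv_rpow hr0.ne']
  have hmeas : Measurable fun z : Eu n × Eu n => ‖G (z.1 - z.2) - G z.1‖ₑ ^ r :=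
    ((hsm.comp_measurable (measurable_fst.sub measurable_snd)).sub
      (hsm.comp_measurable measurable_fst)).enorm.pow_const r
  rw [eLpNorm_eq_lintegral_rpow_enorm_toReal hp0 hp, ← hr, one_div, ENNReal.rpow_inv_le_iff hr0]
  calc _ ≤ ∫⁻ x, ∫⁻ y, ‖G (x - y) - G x‖ₑ ^ r ∂ν := lintegral_mono hpt
    _ = ∫⁻ y, (∫⁻ x, ‖G (x - y) - G x‖ₑ ^ r) ∂ν := 
        lintegral_lintegral_swap hmeas.aemeasurable
    _ = ∫⁻ y, ENNReal.ofReal (ρ y) * ∫⁻ x, ‖G (x - y) - G x‖ₑ ^ r := by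
        exact lintegral_withDensity_eq_lintegral_mul _ hρm hmeas.lintegral_prod_left'
    _ ≤ ∫⁻ y, ENNReal.ofReal (ρ y) * ε ^ r := by
        refine lintegral_mono fun y => ?_
        by_cases hy : ‖y‖ < φ.rOut
        · have h1 := h y hy
          rw [eLpNorm_eq_lintegral_rpow_enorm_toReal hp0 hp, ← hr, one_div,
            ENNReal.rpow_inv_le_iff hr0] at h1
          exact mul_le_mul_right h1 _
        · have : ρ y = 0 := by
            rw [← Function.notMem_support, hρ, φ.support_normed_eq]
            simpa using hy
          simp [this]
    _ = ε ^ r := by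
        rw [lintegral_mul_const _ hρm,
          ← ofReal_integral_eq_lintegral_ofReal φ.integrable_normed (ae_of_all _ hρ0),
          φ.integral_normed, ENNReal.ofReal_one, one_mul]

end Mollify


/-! ### Weak gradients -/

section WeakGrad

open scoped Convolution Topology
open ContinuousLinearMap Filter

variable {n : ℕ} {Ω : Set (Eu n)} {f : Eu n → ℝ} {G : Eu n → Eu n}

theorem gradient_apply_eq (f : Eu n → ℝ) (x : Eu n) (i : Fin n) :
    gradient f x i = fderiv ℝ f x (EuclideanSpace.single i 1) := by
  have h : inner ℝ (gradient f x) (EuclideanSpace.single i (1 : ℝ)) =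
      fderiv ℝ f x (EuclideanSpace.single i 1) := by
    rw [gradient, InnerProductSpace.toDual_symm_apply]
  rw [← h, EuclideanSpace.inner_single_right]
  simp

theorem continuous_gradient {f : Eu n → ℝ} (hf : ContDiff ℝ 1 f) : Continuous (gradient f) :=
  (InnerProductSpace.toDual ℝ (Eu n)).symm.continuous.comp (hf.continuous_fderiv one_ne_zero)

theorem gradient_eq_zero_of_notMem_tsupport {f : Eu n → ℝ} {x : Eu n} (hx : x ∉ tsupport f) :
    gradient f x = 0 := by
  have h : fderiv ℝ f x = 0 := by
    by_contra h
    exact hx (support_fderiv_subset ℝ h)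
  rw [gradient, h, map_zero]

theorem setIntegral_eq_of_forall_notMem {A B : Set (Eu n)} {E : Type*} [NormedAddCommGroup E]
    [NormedSpace ℝ E] {g : Eu n → E} (hA : ∀ x ∉ A, g x = 0) (hB : ∀ x ∉ B, g x = 0) :
    ∫ x in A, g x = ∫ x in B, g x := by
  rw [setIntegral_eq_integral_of_forall_compl_eq_zero hA,
    setIntegral_eq_integral_of_forall_compl_eq_zero hB]

theorem locallyIntegrableOn_coord {A : Set (Eu n)} (hG : LocallyIntegrableOn G A) (i : Fin n) :
    LocallyIntegrableOn (fun x => G x i) A := fun x hx => by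
  obtain ⟨u, hu, h⟩ := hG x hx
  exact ⟨u, hu, (EuclideanSpace.proj i : Eu n →L[ℝ] ℝ).integrable_comp h⟩

theorem HasWeakGrad.mono {U : Set (Eu n)} (h : HasWeakGrad Ω f G) (hU : U ⊆ Ω) :
    HasWeakGrad U f G := by
  refine ⟨h.1.mono_set hU, h.2.1.mono_set hU, fun η hη i => ?_⟩
  have h1 : ∀ x ∉ U, η x = 0 := fun x hx => image_eq_zero_of_notMem_tsupport (mt (@hη.2.2 x) hx)
  have h2 : ∀ x ∉ U, fderiv ℝ η x = 0 := fun x hx => by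
    by_contra hc
    exact hx (hη.2.2 (support_fderiv_subset ℝ hc))
  have key := h.2.2 η ⟨hη.1, hη.2.1, hη.2.2.trans hU⟩ i
  rwa [setIntegral_eq_of_forall_notMem (A := Ω) (B := U)
      (fun x hx => by rw [h2 x (mt (@hU x) hx)]; simp) (fun x hx => by rw [h2 x hx]; simp),
    setIntegral_eq_of_forall_notMem (A := Ω) (B := U)
      (fun x hx => by rw [h1 x (mt (@hU x) hx)]; simp) (fun x hx => by rw [h1 x hx]; simp)] at key

theorem HasWeakGrad.congr_left {f' : Eu n → ℝ} (hΩ : IsOpen Ω) (h : HasWeakGrad Ω f G)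
    (hf : EqOn f f' Ω) : HasWeakGrad Ω f' G := by
  refine ⟨fun x hx => ?_, h.2.1, fun η hη i => ?_⟩
  · obtain ⟨u, hu, hi⟩ := h.1 x hx
    exact ⟨u ∩ Ω, inter_mem hu self_mem_nhdsWithin,
      ((hi.mono_set inter_subset_left).congr (by
        have : ∀ᵐ y ∂(volume.restrict (u ∩ Ω)), y ∈ Ω :=
          ae_mono (Measure.restrict_mono inter_subset_right le_rfl)
            (ae_restrict_mem hΩ.measurableSet)
        filter_upwards [this] with y hy using hf hy))⟩
  · rw [← h.2.2 η hη i]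
    exact setIntegral_congr_fun hΩ.measurableSet fun x hx => by simp only [hf hx]

/-- The fundamental lemma of the calculus of variations, coordinate by coordinate. It makes the
chosen `weakGrad` interchangeable with any explicit weak gradient. -/
theorem HasWeakGrad.ae_eq {G' : Eu n → Eu n} (hΩ : IsOpen Ω) (h : HasWeakGrad Ω f G)
    (h' : HasWeakGrad Ω f G') : G =ᵐ[volume.restrict Ω] G' := by
  have key : ∀ i : Fin n, ∀ᵐ x ∂(volume : Measure (Eu n)), x ∈ Ω → G x i - G' x i = 0 := by
    intro i
    have hi := locallyIntegrableOn_coord h.2.1 i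
    have hi' := locallyIntegrableOn_coord h'.2.1 i
    refine hΩ.ae_eq_zero_of_integral_contDiff_smul_eq_zero (hi.sub hi') fun g hg hgc hgs => ?_
    have hz : ∀ x ∉ tsupport g, g x = 0 := fun x hx => image_eq_zero_of_notMem_tsupport hx
    have e := (h.2.2 g ⟨hg, hgc, hgs⟩ i).symm.trans (h'.2.2 g ⟨hg, hgc, hgs⟩ i)
    have hint : ∀ {H : Eu n → ℝ}, LocallyIntegrableOn H Ω →
        Integrable (fun x => H x * g x) (volume.restrict (tsupport g)) := fun {H} hH =>
      (hH.integrableOn_compact_subset hgs hgc).mul_continuousOn hg.continuous.continuousOn hgc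
    rw [setIntegral_eq_of_forall_notMem (B := tsupport g)
        (fun x hx => by rw [hz x (mt (@hgs x) hx), mul_zero])
        (fun x hx => by rw [hz x hx, mul_zero]),
      setIntegral_eq_of_forall_notMem (A := Ω) (B := tsupport g)
        (fun x hx => by rw [hz x (mt (@hgs x) hx), mul_zero])
        (fun x hx => by rw [hz x hx, mul_zero])] at e
    rw [← setIntegral_eq_integral_of_forall_compl_eq_zero (s := tsupport g)
      (fun x hx => by rw [hz x hx, zero_smul])]
    have e2 : ∀ x, g x • (G x i - G' x i) = G x i * g x - G' x i * g x := fun x => by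
      rw [smul_eq_mul]; ring
    simp only [e2]
    rw [integral_sub (hint hi) (hint hi')]
    linarith
  rw [EventuallyEq, ae_restrict_iff' hΩ.measurableSet]
  filter_upwards [ae_all_iff.2 key] with x hx hxΩ
  ext i
  linarith [hx i hxΩ]

theorem HasWeakGrad.weakGrad_ae_eq (hΩ : IsOpen Ω) (h : HasWeakGrad Ω f G) :
    weakGrad Ω f =ᵐ[volume.restrict Ω] G := by
  have hex : ∃ G, HasWeakGrad Ω f G := ⟨G, h⟩
  rw [weakGrad, dif_pos hex]
  exact HasWeakGrad.ae_eq hΩ hex.choose_spec h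

theorem HasWeakGrad.weakGrad_self (h : HasWeakGrad Ω f G) : HasWeakGrad Ω f (weakGrad Ω f) := by
  have hex : ∃ G, HasWeakGrad Ω f G := ⟨G, h⟩
  rw [weakGrad, dif_pos hex]
  exact hex.choose_spec

theorem hasWeakGrad_zero : HasWeakGrad Ω (0 : Eu n → ℝ) 0 := by
  refine ⟨locallyIntegrableOn_zero, locallyIntegrableOn_zero, fun η _ i => ?_⟩
  simp

/-- The weak gradient vanishes a.e. off the support. -/
theorem HasWeakGrad.ae_eq_zero (hΩ : IsOpen Ω) (h : HasWeakGrad Ω f G) {K : Set (Eu n)}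
    (hK : IsClosed K) (hf : ∀ x ∉ K, f x = 0) : ∀ᵐ x ∂(volume.restrict Ω), x ∉ K → G x = 0 := by
  have hU : IsOpen (Ω ∩ Kᶜ) := hΩ.inter hK.isOpen_compl
  have h1 := h.mono (U := Ω ∩ Kᶜ) inter_subset_left
  have h2 := (hasWeakGrad_zero (Ω := Ω ∩ Kᶜ)).congr_left (f' := f) hU
    fun x hx => by rw [Pi.zero_apply, hf x hx.2]
  have := HasWeakGrad.ae_eq hU h1 h2
  rw [EventuallyEq, ae_restrict_iff' hU.measurableSet] at this
  rw [ae_restrict_iff' hΩ.measurableSet]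
  filter_upwards [this] with x hx h1 h2 using hx ⟨h1, h2⟩

theorem hasWeakGrad_of_contDiff (hΩ : IsOpen Ω) (hf : ContDiff ℝ 1 f) :
    HasWeakGrad Ω f (gradient f) := by
  refine ⟨hf.continuous.continuousOn.locallyIntegrableOn hΩ.measurableSet,
    (continuous_gradient hf).continuousOn.locallyIntegrableOn hΩ.measurableSet, fun η hη i => ?_⟩
  have hη1 : ContDiff ℝ 1 η := hη.1.of_le (by exact_mod_cast le_top)
  have hz : ∀ x ∉ Ω, η x = 0 := fun x hx => image_eq_zero_of_notMem_tsupport (mt (@hη.2.2 x) hx)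
  have hz' : ∀ x ∉ Ω, fderiv ℝ η x = 0 := fun x hx => by
    by_contra hc
    exact hx (hη.2.2 (support_fderiv_subset ℝ hc))
  rw [setIntegral_eq_integral_of_forall_compl_eq_zero (fun x hx => by rw [hz' x hx]; simp),
    setIntegral_eq_integral_of_forall_compl_eq_zero (fun x hx => by rw [hz x hx]; simp)]
  simp only [gradient_apply_eq]
  have c1 : Continuous fun x => fderiv ℝ f x (EuclideanSpace.single i 1) :=
    (hf.continuous_fderiv one_ne_zero).clm_apply continuous_const
  have c2 : Continuous fun x => fderiv ℝ η x (EuclideanSpace.single i 1) :=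
    (hη1.continuous_fderiv one_ne_zero).clm_apply continuous_const
  refine integral_mul_fderiv_eq_neg_fderiv_mul_of_integrable ?_ ?_ ?_
    (fun x _ => hf.differentiable one_ne_zero x) (fun x _ => hη1.differentiable one_ne_zero x)
  · exact (c1.mul hη.1.continuous).integrable_of_hasCompactSupport hη.2.1.mul_left
  · exact (hf.continuous.mul c2).integrable_of_hasCompactSupport
      ((hη.2.1.fderiv_apply ℝ _).mul_left)
  · exact (hf.continuous.mul hη.1.continuous).integrable_of_hasCompactSupport hη.2.1.mul_left

/-- Local approximation of a continuous weakly differentiable function by smooth ones. -/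
theorem HasWeakGrad.exists_contDiff_approx (hΩ : IsOpen Ω) (h : HasWeakGrad Ω f G)
    (hf : ContinuousOn f Ω) {p : ℝ≥0∞} (hp1 : 1 ≤ p) (hp : p ≠ ∞)
    (hG : ∀ K : Set (Eu n), IsCompact K → K ⊆ Ω → MemLp G p (volume.restrict K))
    {K : Set (Eu n)} (hK : IsCompact K) (hKΩ : K ⊆ Ω) {ε : ℝ} (hε : 0 < ε) :
    ∃ F : Eu n → ℝ, ContDiff ℝ ((⊤ : ℕ∞) : WithTop ℕ∞) F ∧ (∀ x ∈ K, |F x - f x| ≤ ε) ∧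
      eLpNorm (fun x => gradient F x - G x) p (volume.restrict K) ≤ ENNReal.ofReal ε := by
  -- For x in K a mollifier of radius at most d only sees the compact neighbourhood K' of K, so f
  -- and G may be replaced by their restrictions to K', extended by zero.
  obtain ⟨d, hd, hdΩ⟩ := hK.exists_cthickening_subset_open hΩ hKΩ
  set K' := Metric.cthickening d K with hK'def
  have hK' : IsCompact K' := hK.cthickening
  have hKK' : K ⊆ K' := Metric.self_subset_cthickening K
  set f' := K'.indicator f with hf'
  set G' := K'.indicator G with hG'
  have hfint : IntegrableOn f K' := (hf.mono hdΩ).integrableOn_compact hK'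
  have hf'int : Integrable f' := (integrable_indicator_iff hK'.measurableSet).2 hfint
  have hG'mem : MemLp G' p volume :=
    (memLp_indicator_iff_restrict hK'.measurableSet).2 (hG K' hK' hdΩ)
  obtain ⟨d1, hd1, huc⟩ := Metric.uniformContinuousOn_iff.1
    (hK'.uniformContinuousOn_of_continuous (hf.mono hdΩ)) ε hε
  obtain ⟨d2, hd2, htr⟩ := exists_eLpNorm_translate_sub_le hp1 hp hG'mem (ENNReal.ofReal_pos.2 hε)
  set r := min d (min d1 d2) with hr
  have hr0 : 0 < r := by positivity
  let φ : ContDiffBump (0 : Eu n) := ⟨r / 2, r, by linarith, by linarith⟩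
  have hφr : φ.rOut = r := rfl
  set ρ : Eu n → ℝ := φ.normed volume with hρ
  have hρsmooth : ContDiff ℝ ((⊤ : ℕ∞) : WithTop ℕ∞) ρ := φ.contDiff_normed
  have hρ1 : ContDiff ℝ 1 ρ := hρsmooth.of_le (by exact_mod_cast le_top)
  have hball : ∀ x ∈ K, ∀ y, dist y x ≤ r → y ∈ K' := fun x hx y hy =>
    Metric.mem_cthickening_of_dist_le y x d K hx (hy.trans (min_le_left _ _))
  have hρts : tsupport ρ = Metric.closedBall 0 r := φ.tsupport_normed_eq
  refine ⟨ρ ⋆[lsmul ℝ ℝ, volume] f', ?_, ?_, ?_⟩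
  · exact φ.hasCompactSupport_normed.contDiff_convolution_left _ hρsmooth hf'int.locallyIntegrable
  · intro x hx
    rw [← Real.dist_eq]
    have hfx : f' x = f x := indicator_of_mem (hKK' hx) f
    rw [← hfx]
    refine ContDiffBump.dist_normed_convolution_le hf'int.aestronglyMeasurable fun y hy => ?_
    rw [Metric.mem_ball, hφr] at hy
    have hy' : y ∈ K' := hball x hx y hy.le
    rw [hfx, show f' y = f y from indicator_of_mem hy' f]
    exact (huc y hy' x (hKK' hx)
      (hy.trans_le ((min_le_right _ _).trans (min_le_left _ _)))).le
  -- On K the gradient commutes with mollification, because t ↦ ρ(x - t) is supported in K' ⊆ Ω and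
  -- is therefore admissible in the definition of the weak gradient.
  · have hgrad : ∀ x ∈ K, gradient (ρ ⋆[lsmul ℝ ℝ, volume] f') x =
        (ρ ⋆[lsmul ℝ ℝ, volume] G') x := by
      intro x hx
      have hG'loc : LocallyIntegrable G' volume := hG'mem.locallyIntegrable hp1
      ext i
      set e : Eu n := EuclideanSpace.single i 1 with he
      have hder := φ.hasCompactSupport_normed.hasFDerivAt_convolution_left (lsmul ℝ ℝ) hρ1
        hf'int.locallyIntegrable x
      set η : Eu n → ℝ := fun t => ρ (x - t) with hη
      have hηts : ∀ t, t ∈ tsupport η → dist t x ≤ r := by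
        have hcl : IsClosed {t | dist t x ≤ r} := Metric.isClosed_closedBall
        intro t ht
        refine closure_minimal (fun t ht => ?_) hcl ht
        have h1 : x - t ∈ tsupport ρ := subset_tsupport _ ht
        rw [hρts, mem_closedBall_zero_iff, ← dist_eq_norm, dist_comm] at h1
        exact h1
      have hηtest : IsTest Ω η := by
        refine ⟨hρsmooth.comp (contDiff_const.sub contDiff_id), ?_, fun t ht =>
          hdΩ (hball x hx t (hηts t ht))⟩
        exact (isCompact_closedBall x r).of_isClosed_subset (isClosed_tsupport _)
          fun t ht => hηts t ht
      have hηd : ∀ t, fderiv ℝ η t e = - fderiv ℝ ρ (x - t) e := by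
        intro t
        have h1 : HasFDerivAt η ((fderiv ℝ ρ (x - t)).comp (-ContinuousLinearMap.id ℝ (Eu n))) t := by
          have h2 : HasFDerivAt (fun t : Eu n => x - t) (-ContinuousLinearMap.id ℝ (Eu n)) t := by
            simpa using (hasFDerivAt_id t).const_sub x
          exact ((hρ1.differentiable one_ne_zero) (x - t)).hasFDerivAt.comp t h2
        rw [h1.fderiv]
        simp
      have hηz : ∀ t ∉ K', η t = 0 := fun t ht =>
        image_eq_zero_of_notMem_tsupport fun hc => ht (hball x hx t (hηts t hc))
      have hηdz : ∀ t ∉ K', fderiv ℝ η t e = 0 := fun t ht => by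
        by_contra hc
        exact ht (hball x hx t (hηts t (support_fderiv_subset ℝ
          (fun h0 => hc (by rw [h0]; rfl)))))
      rw [gradient_apply_eq, hder.fderiv]
      calc ((fderiv ℝ ρ ⋆[(lsmul ℝ ℝ).precompL (Eu n), volume] f') x) e
          = ∫ t, fderiv ℝ ρ (x - t) e * f' t := by
            have hex : Integrable (fun t => ((lsmul ℝ ℝ).precompL (Eu n)) (fderiv ℝ ρ (x - t))
                (f' t)) volume := by
              have := (HasCompactSupport.convolutionExists_left ((lsmul ℝ ℝ).precompL (Eu n))
                (φ.hasCompactSupport_normed.fderiv ℝ) (hρ1.continuous_fderiv one_ne_zero)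
                hf'int.locallyIntegrable x)
              exact this.integrable_swap
            rw [convolution_eq_swap, ContinuousLinearMap.integral_apply hex]
            rfl
        _ = - ∫ t in Ω, f t * fderiv ℝ η t e := by
            rw [← integral_neg, setIntegral_eq_integral_of_forall_compl_eq_zero
              (fun t ht => by rw [hηdz t (fun hc => ht (hdΩ hc))]; simp)]
            refine integral_congr_ae (ae_of_all _ fun t => ?_)
            by_cases ht : t ∈ K'
            · simp only [hf', indicator_of_mem ht, hηd]; ring
            · simp only [hf', indicator_of_notMem ht, hηdz t ht]; ring
        _ = ∫ t in Ω, G t i * η t := by rw [h.2.2 η hηtest i, neg_neg]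
        _ = ∫ t, ρ (x - t) * G' t i := by
            rw [setIntegral_eq_integral_of_forall_compl_eq_zero
              (fun t ht => by rw [hηz t (fun hc => ht (hdΩ hc))]; simp)]
            refine integral_congr_ae (ae_of_all _ fun t => ?_)
            by_cases ht : t ∈ K'
            · simp only [hG', indicator_of_mem ht, hη]; ring
            · simp only [hG', indicator_of_notMem ht, hηz t ht]; simp
        _ = (ρ ⋆[lsmul ℝ ℝ, volume] G') x i := by
            have hex : Integrable (fun t => lsmul ℝ ℝ (ρ (x - t)) (G' t)) volume :=
              (φ.hasCompactSupport_normed.convolutionExists_left (lsmul ℝ ℝ)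
                φ.continuous_normed hG'loc x).integrable_swap
            rw [convolution_eq_swap]
            exact ((EuclideanSpace.proj i : Eu n →L[ℝ] ℝ).integral_comp_comm hex)
    calc _ = eLpNorm (fun x => (ρ ⋆[lsmul ℝ ℝ, volume] G') x - G' x) p (volume.restrict K) := by
          refine eLpNorm_congr_ae ?_
          filter_upwards [ae_restrict_mem hK.measurableSet] with x hx
          rw [hgrad x hx, show G' x = G x from indicator_of_mem (hKK' hx) G]
      _ ≤ _ := eLpNorm_mono_measure _ Measure.restrict_le_self
      _ ≤ _ := eLpNorm_convolution_sub_le hp1 hp hG'mem φ fun y hy => htr y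
          (hy.trans_le ((min_le_right _ _).trans (min_le_right _ _)))

end WeakGrad


/-! ### The chain rule -/

section Chain

open scoped Topology
open Filter

/-- Split A_k H_k = A_k(H_k - H₀) + A_k H₀: the first part is small in L¹, the second converges by
dominated convergence. -/
theorem tendsto_integral_mul_of_bounded {α : Type*} [MeasurableSpace α] {μ : Measure α}
    {A : ℕ → α → ℝ} {A₀ : α → ℝ} {H : ℕ → α → ℝ} {H₀ : α → ℝ} {B : ℝ}
    (hA : ∀ k, AEStronglyMeasurable (A k) μ) (hB : ∀ k, ∀ᵐ x ∂μ, |A k x| ≤ B)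
    (hlim : ∀ᵐ x ∂μ, Tendsto (fun k => A k x) atTop (𝓝 (A₀ x)))
    (hH : ∀ k, Integrable (H k) μ) (hH₀ : Integrable H₀ μ)
    (h : Tendsto (fun k => eLpNorm (fun x => H k x - H₀ x) 1 μ) atTop (𝓝 0)) :
    Tendsto (fun k => ∫ x, A k x * H k x ∂μ) atTop (𝓝 (∫ x, A₀ x * H₀ x ∂μ)) := by
  have i1 : ∀ k, Integrable (fun x => A k x * (H k x - H₀ x)) μ := fun k =>
    ((hH k).sub hH₀).bdd_mul (hA k) (hB k)
  have i2 : ∀ k, Integrable (fun x => A k x * H₀ x) μ := fun k => hH₀.bdd_mul (hA k) (hB k)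
  have e : ∀ k, ∫ x, A k x * H k x ∂μ =
      ∫ x, A k x * (H k x - H₀ x) ∂μ + ∫ x, A k x * H₀ x ∂μ := fun k => by
    rw [← integral_add (i1 k) (i2 k)]
    exact integral_congr_ae (ae_of_all _ fun x => by ring)
  simp only [e]
  rw [← zero_add (∫ x, A₀ x * H₀ x ∂μ)]
  refine Tendsto.add ?_ ?_
  · have h1 : Tendsto (fun k => B * (eLpNorm (fun x => H k x - H₀ x) 1 μ).toReal) atTop (𝓝 0) := by
      have := ((ENNReal.tendsto_toReal ENNReal.zero_ne_top).comp h).const_mul B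
      simpa using this
    refine squeeze_zero_norm (fun k => ?_) h1
    calc ‖∫ x, A k x * (H k x - H₀ x) ∂μ‖ ≤ ∫ x, B * ‖H k x - H₀ x‖ ∂μ := by
          refine norm_integral_le_of_norm_le (((hH k).sub hH₀).norm.const_mul B) ?_
          filter_upwards [hB k] with x hx
          rw [norm_mul]
          exact mul_le_mul_of_nonneg_right hx (norm_nonneg _)
      _ = _ := by
          rw [integral_const_mul, eLpNorm_one_eq_lintegral_enorm]
          exact congrArg (B * ·) (integral_norm_eq_lintegral_enorm ((hH k).sub hH₀).1)
  · refine tendsto_integral_of_dominated_convergence (fun x => B * ‖H₀ x‖)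
      (fun k => (i2 k).1) (hH₀.norm.const_mul B) (fun k => ?_) ?_
    · filter_upwards [hB k] with x hx
      rw [norm_mul]
      exact mul_le_mul_of_nonneg_right hx (norm_nonneg _)
    · filter_upwards [hlim] with x hx using hx.mul_const _

variable {n : ℕ} {Ω : Set (Eu n)}

theorem HasWeakGrad.exists_contDiff_seq {f : Eu n → ℝ} {G : Eu n → Eu n} (hΩ : IsOpen Ω)
    (h : HasWeakGrad Ω f G) (hf : ContinuousOn f Ω) {K : Set (Eu n)} (hK : IsCompact K)
    (hKΩ : K ⊆ Ω) {d : ℝ} (hd : 0 < d) :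
    ∃ F : ℕ → Eu n → ℝ, (∀ k, ContDiff ℝ 1 (F k)) ∧ (∀ k, ∀ x ∈ K, |F k x - f x| ≤ d) ∧
      (∀ x ∈ K, Tendsto (fun k => F k x) atTop (𝓝 (f x))) ∧
      Tendsto (fun k => eLpNorm (fun x => gradient (F k) x - G x) 1 (volume.restrict K)) atTop
        (𝓝 0) := by
  have hpos : ∀ k : ℕ, 0 < d * (1 / ((k : ℝ) + 1)) := fun k => by positivity
  choose F hF1 hF2 hF3 using fun k : ℕ => h.exists_contDiff_approx hΩ hf le_rfl ENNReal.one_ne_top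
    (fun K hK hKΩ => memLp_one_iff_integrable.2 (h.2.1.integrableOn_compact_subset hKΩ hK))
    hK hKΩ (hpos k)
  have hlim : Tendsto (fun k : ℕ => d * (1 / ((k : ℝ) + 1))) atTop (𝓝 0) := by
    simpa using tendsto_one_div_add_atTop_nhds_zero_nat.const_mul d
  refine ⟨F, fun k => (hF1 k).of_le (by exact_mod_cast le_top), fun k x hx => ?_, fun x hx => ?_, ?_⟩
  · refine (hF2 k x hx).trans (mul_le_of_le_one_right hd.le ?_)
    rw [div_le_one (by positivity)]
    linarith [Nat.cast_nonneg (α := ℝ) k]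
  · rw [tendsto_iff_dist_tendsto_zero]
    exact squeeze_zero (fun _ => dist_nonneg) (fun k => hF2 k x hx) hlim
  · refine tendsto_of_tendsto_of_tendsto_of_le_of_le tendsto_const_nhds ?_ (fun _ => zero_le)
      hF3
    simpa using ENNReal.tendsto_ofReal hlim

/-- The chain rule for weak gradients of continuous functions. -/
theorem HasWeakGrad.comp₂ {f₁ f₂ : Eu n → ℝ} {G₁ G₂ : Eu n → Eu n} (hΩ : IsOpen Ω)
    (h₁ : HasWeakGrad Ω f₁ G₁) (h₂ : HasWeakGrad Ω f₂ G₂) (hf₁ : ContinuousOn f₁ Ω)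
    (hf₂ : ContinuousOn f₂ Ω) {U : Set (ℝ × ℝ)} (hU : IsOpen U) {Φ Φ₁ Φ₂ : ℝ × ℝ → ℝ}
    (hΦ₁ : ContinuousOn Φ₁ U) (hΦ₂ : ContinuousOn Φ₂ U)
    (hΦ : ∀ z ∈ U, HasFDerivAt Φ (Φ₁ z • ContinuousLinearMap.fst ℝ ℝ ℝ +
      Φ₂ z • ContinuousLinearMap.snd ℝ ℝ ℝ) z)
    (hfU : ∀ x ∈ Ω, (f₁ x, f₂ x) ∈ U) :
    HasWeakGrad Ω (fun x => Φ (f₁ x, f₂ x))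
      (fun x => Φ₁ (f₁ x, f₂ x) • G₁ x + Φ₂ (f₁ x, f₂ x) • G₂ x) := by
  have hΦc : ContinuousOn Φ U := fun z hz => (hΦ z hz).continuousAt.continuousWithinAt
  have hz : ContinuousOn (fun x => (f₁ x, f₂ x)) Ω := hf₁.prodMk hf₂
  have hc₁ : ContinuousOn (fun x => Φ₁ (f₁ x, f₂ x)) Ω := hΦ₁.comp hz hfU
  have hc₂ : ContinuousOn (fun x => Φ₂ (f₁ x, f₂ x)) Ω := hΦ₂.comp hz hfU
  have hloc : LocallyIntegrableOn
      (fun x => Φ₁ (f₁ x, f₂ x) • G₁ x + Φ₂ (f₁ x, f₂ x) • G₂ x) Ω :=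
    (h₁.2.1.continuousOn_smul hΩ.isLocallyClosed hc₁).add
      (h₂.2.1.continuousOn_smul hΩ.isLocallyClosed hc₂)
  refine ⟨(hΦc.comp hz hfU).locallyIntegrableOn hΩ.measurableSet, hloc, fun η hη i => ?_⟩
  have hη1 : ContDiff ℝ 1 η := hη.1.of_le (by exact_mod_cast le_top)
  set K := tsupport η with hKdef
  have hK : IsCompact K := hη.2.1
  have hKΩ : K ⊆ Ω := hη.2.2
  set e : Eu n := EuclideanSpace.single i 1 with he
  have hηz : ∀ x ∉ K, η x = 0 := fun x hx => image_eq_zero_of_notMem_tsupport hx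
  have hηd : ∀ x ∉ K, fderiv ℝ η x e = 0 := fun x hx => by
    by_contra hc
    exact hx (support_fderiv_subset ℝ (fun h0 => hc (by rw [h0]; rfl)))
  have hηdc : Continuous fun x => fderiv ℝ η x e :=
    (hη1.continuous_fderiv one_ne_zero).clm_apply continuous_const
  -- The values on K form a compact subset of U. Uniform approximation within d keeps the
  -- approximants in a compact neighbourhood Z ⊆ U, where Φ and its partial derivatives are bounded.
  have hZ : IsCompact ((fun x => (f₁ x, f₂ x)) '' K) := hK.image_of_continuousOn (hz.mono hKΩ)
  obtain ⟨d, hd, hdU⟩ := hZ.exists_cthickening_subset_open hU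
    (by rintro _ ⟨x, hx, rfl⟩; exact hfU x (hKΩ hx))
  set Z := Metric.cthickening d ((fun x => (f₁ x, f₂ x)) '' K) with hZdef
  have hZc : IsCompact Z := hZ.cthickening
  obtain ⟨B₀, hB₀⟩ := hZc.exists_bound_of_continuousOn (hΦc.mono hdU)
  obtain ⟨B₁, hB₁⟩ := hZc.exists_bound_of_continuousOn (hΦ₁.mono hdU)
  obtain ⟨B₂, hB₂⟩ := hZc.exists_bound_of_continuousOn (hΦ₂.mono hdU)
  obtain ⟨Bη, hBη⟩ := hK.exists_bound_of_continuousOn hη.1.continuous.continuousOn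
  obtain ⟨F₁, hF₁s, hF₁d, hF₁t, hF₁g⟩ := h₁.exists_contDiff_seq hΩ hf₁ hK hKΩ hd
  obtain ⟨F₂, hF₂s, hF₂d, hF₂t, hF₂g⟩ := h₂.exists_contDiff_seq hΩ hf₂ hK hKΩ hd
  have hmem : ∀ k, ∀ x ∈ K, (F₁ k x, F₂ k x) ∈ Z := fun k x hx =>
    Metric.mem_cthickening_of_dist_le _ (f₁ x, f₂ x) d _ (mem_image_of_mem _ hx)
      (max_le (hF₁d k x hx) (hF₂d k x hx))
  have hFc : ∀ k, Continuous fun x => (F₁ k x, F₂ k x) := fun k =>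
    (hF₁s k).continuous.prodMk (hF₂s k).continuous
  have hcomp : ∀ {Ψ : ℝ × ℝ → ℝ}, ContinuousOn Ψ U → ∀ k,
      ContinuousOn (fun x => Ψ (F₁ k x, F₂ k x)) K := fun hΨ k =>
    hΨ.comp (hFc k).continuousOn fun x hx => hdU (hmem k x hx)
  have hlimc : ∀ {Ψ : ℝ × ℝ → ℝ}, ContinuousOn Ψ U → ∀ x ∈ K,
      Tendsto (fun k => Ψ (F₁ k x, F₂ k x)) atTop (𝓝 (Ψ (f₁ x, f₂ x))) := fun hΨ x hx =>
    (hΨ.continuousAt (hU.mem_nhds (hfU x (hKΩ hx)))).tendsto.comp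
      ((hF₁t x hx).prodMk_nhds (hF₂t x hx))
  have hKm : ∀ᵐ x ∂(volume.restrict K), x ∈ K := ae_restrict_mem hK.measurableSet
  have hgc : ∀ {F : Eu n → ℝ}, ContDiff ℝ 1 F → Continuous fun x => gradient F x i := fun hF => by
    simp only [gradient_apply_eq]
    exact (hF.continuous_fderiv one_ne_zero).clm_apply continuous_const
  -- integration by parts for the approximations
  have hparts : ∀ k, ∫ x in K, Φ (F₁ k x, F₂ k x) * fderiv ℝ η x e =
      -((∫ x in K, (Φ₁ (F₁ k x, F₂ k x) * η x) * gradient (F₁ k) x i) +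
        ∫ x in K, (Φ₂ (F₁ k x, F₂ k x) * η x) * gradient (F₂ k) x i) := by
    intro k
    have i1 : IntegrableOn (fun x => (Φ₁ (F₁ k x, F₂ k x) * η x) * gradient (F₁ k) x i) K :=
      (((hcomp hΦ₁ k).mul hη.1.continuous.continuousOn).mul
        (hgc (hF₁s k)).continuousOn).integrableOn_compact hK
    have i2 : IntegrableOn (fun x => (Φ₂ (F₁ k x, F₂ k x) * η x) * gradient (F₂ k) x i) K :=
      (((hcomp hΦ₂ k).mul hη.1.continuous.continuousOn).mul
        (hgc (hF₂s k)).continuousOn).integrableOn_compact hK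
    rw [← integral_add i1 i2]
    set D : Eu n → (Eu n →L[ℝ] ℝ) := fun x => Φ₁ (F₁ k x, F₂ k x) • fderiv ℝ (F₁ k) x +
      Φ₂ (F₁ k x, F₂ k x) • fderiv ℝ (F₂ k) x with hD
    have hDe : ∀ x, D x e * η x = (Φ₁ (F₁ k x, F₂ k x) * η x) * gradient (F₁ k) x i +
        (Φ₂ (F₁ k x, F₂ k x) * η x) * gradient (F₂ k) x i := fun x => by
      rw [gradient_apply_eq, gradient_apply_eq]
      simp only [hD, add_apply, smul_apply, smul_eq_mul]
      ring
    have hext : ∀ {g : Eu n → ℝ}, (∀ x ∉ K, g x = 0) → IntegrableOn g K → Integrable g :=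
      fun hg hi => (integrableOn_iff_integrable_of_support_subset
        (fun x hx => by by_contra hc; exact hx (hg x hc))).1 hi
    have key := integral_bilinear_hasFDerivAt_right_eq_neg_left_of_integrable
      (μ := (volume : Measure (Eu n))) (v := e) (B := ContinuousLinearMap.mul ℝ ℝ)
      (f := fun x => Φ (F₁ k x, F₂ k x)) (f' := D) (g := η) (g' := fderiv ℝ η)
      (hext (fun x hx => by simp [hηz x hx])
        ((i1.add i2).congr (ae_of_all _ fun x => (hDe x).symm)))
      (hext (fun x hx => by simp [hηd x hx])
        (((hcomp hΦc k).mul hηdc.continuousOn).integrableOn_compact hK))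
      (hext (fun x hx => by simp [hηz x hx])
        (((hcomp hΦc k).mul hη.1.continuous.continuousOn).integrableOn_compact hK))
      (fun x hx => by
        have g1 := ((hF₁s k).differentiable one_ne_zero x).hasFDerivAt
        have g2 := ((hF₂s k).differentiable one_ne_zero x).hasFDerivAt
        have := (hΦ _ (hdU (hmem k x hx))).comp x (g1.prodMk g2)
        exact this.congr_fderiv (by ext v; simp [hD]))
      (fun x _ => (hη1.differentiable one_ne_zero x).hasFDerivAt)
    simp only [ContinuousLinearMap.mul_apply'] at key
    rw [setIntegral_eq_integral_of_forall_compl_eq_zero (fun x hx => by rw [hηd x hx, mul_zero]),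
      setIntegral_eq_integral_of_forall_compl_eq_zero (fun x hx => by simp [hηz x hx]), key]
    simp only [hDe]
  have hgint : ∀ {F : Eu n → ℝ}, ContDiff ℝ 1 F →
      Integrable (fun x => gradient F x i) (volume.restrict K) := fun hF =>
    (hgc hF).continuousOn.integrableOn_compact hK
  have hGint : ∀ {f : Eu n → ℝ} {G : Eu n → Eu n}, HasWeakGrad Ω f G →
      Integrable (fun x => G x i) (volume.restrict K) := fun h =>
    (locallyIntegrableOn_coord h.2.1 i).integrableOn_compact_subset hKΩ hK
  have hcoord : ∀ {F : ℕ → Eu n → ℝ} {G : Eu n → Eu n},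
      Tendsto (fun k => eLpNorm (fun x => gradient (F k) x - G x) 1 (volume.restrict K)) atTop
        (𝓝 0) →
      Tendsto (fun k => eLpNorm (fun x => gradient (F k) x i - G x i) 1 (volume.restrict K)) atTop
        (𝓝 0) := fun h =>
    tendsto_of_tendsto_of_tendsto_of_le_of_le tendsto_const_nhds h (fun _ => zero_le)
      fun k => eLpNorm_mono fun x => PiLp.norm_apply_le (gradient _ x - _) i
  have hmul : ∀ {Ψ : ℝ × ℝ → ℝ} {B : ℝ}, (∀ z ∈ Z, ‖Ψ z‖ ≤ B) → ∀ k,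
      ∀ᵐ x ∂(volume.restrict K), |Ψ (F₁ k x, F₂ k x) * η x| ≤ B * Bη := fun hΨ k => by
    filter_upwards [hKm] with x hx
    rw [abs_mul]
    exact mul_le_mul (hΨ _ (hmem k x hx)) (hBη x hx) (abs_nonneg _)
      ((norm_nonneg _).trans (hΨ _ (hmem k x hx)))
  have l1 : Tendsto (fun k => ∫ x in K, (Φ₁ (F₁ k x, F₂ k x) * η x) * gradient (F₁ k) x i) atTop
      (𝓝 (∫ x in K, (Φ₁ (f₁ x, f₂ x) * η x) * G₁ x i)) :=
    tendsto_integral_mul_of_bounded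
      (fun k => ((hcomp hΦ₁ k).mul hη.1.continuous.continuousOn).aestronglyMeasurable
        hK.measurableSet) (hmul hB₁)
      (by filter_upwards [hKm] with x hx using (hlimc hΦ₁ x hx).mul_const _)
      (fun k => hgint (hF₁s k)) (hGint h₁) (hcoord hF₁g)
  have l2 : Tendsto (fun k => ∫ x in K, (Φ₂ (F₁ k x, F₂ k x) * η x) * gradient (F₂ k) x i) atTop
      (𝓝 (∫ x in K, (Φ₂ (f₁ x, f₂ x) * η x) * G₂ x i)) :=
    tendsto_integral_mul_of_bounded
      (fun k => ((hcomp hΦ₂ k).mul hη.1.continuous.continuousOn).aestronglyMeasurable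
        hK.measurableSet) (hmul hB₂)
      (by filter_upwards [hKm] with x hx using (hlimc hΦ₂ x hx).mul_const _)
      (fun k => hgint (hF₂s k)) (hGint h₂) (hcoord hF₂g)
  have l0 : Tendsto (fun k => ∫ x in K, Φ (F₁ k x, F₂ k x) * fderiv ℝ η x e) atTop
      (𝓝 (∫ x in K, Φ (f₁ x, f₂ x) * fderiv ℝ η x e)) :=
    tendsto_integral_mul_of_bounded (B := B₀) (H := fun _ x => fderiv ℝ η x e)
      (fun k => (hcomp hΦc k).aestronglyMeasurable hK.measurableSet)
      (fun k => by filter_upwards [hKm] with x hx using hB₀ _ (hmem k x hx))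
      (by filter_upwards [hKm] with x hx using hlimc hΦc x hx)
      (fun k => hηdc.continuousOn.integrableOn_compact hK)
      (hηdc.continuousOn.integrableOn_compact hK) (by simp)
  simp only [hparts] at l0
  have key := tendsto_nhds_unique l0 (l1.add l2).neg
  rw [setIntegral_eq_of_forall_notMem (A := Ω) (B := K)
      (fun x hx => by rw [hηd x (fun hc => hx (hKΩ hc)), mul_zero])
      (fun x hx => by rw [hηd x hx, mul_zero]), key,
    setIntegral_eq_of_forall_notMem (A := Ω) (B := K)
      (fun x hx => by rw [hηz x (fun hc => hx (hKΩ hc)), mul_zero])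
      (fun x hx => by rw [hηz x hx, mul_zero]), ← integral_add]
  · congr 1
    refine integral_congr_ae (ae_of_all _ fun x => ?_)
    simp only [PiLp.add_apply, PiLp.smul_apply, smul_eq_mul]
    ring
  · exact IntegrableOn.continuousOn_mul ((hc₁.mono hKΩ).mul hη.1.continuous.continuousOn)
      (hGint h₁) hK
  · exact IntegrableOn.continuousOn_mul ((hc₂.mono hKΩ).mul hη.1.continuous.continuousOn)
      (hGint h₂) hK

end Chain


/-! ### Cutoffs and approximation of compactly supported functions -/

section Approx

open scoped Topology Manifold
open Filter

variable {n : ℕ} {Ω : Set (Eu n)}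

theorem exists_test_eq_one (hΩ : IsOpen Ω) {K : Set (Eu n)} (hK : IsCompact K) (hKΩ : K ⊆ Ω) :
    ∃ χ : Eu n → ℝ, IsTest Ω χ ∧ (∀ x, 0 ≤ χ x ∧ χ x ≤ 1) ∧ ∀ x ∈ K, χ =ᶠ[𝓝 x] 1 := by
  obtain ⟨d, hd, hdΩ⟩ := hK.exists_cthickening_subset_open hΩ hKΩ
  obtain ⟨χ, hχ, hr, hs, h1⟩ := exists_contMDiff_support_eq_eq_one_iff (𝓘(ℝ, Eu n))
    (n := (⊤ : ℕ∞)) (s := Metric.thickening d K)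
    (t := Metric.cthickening (d / 2) K) Metric.isOpen_thickening Metric.isClosed_cthickening
    (Metric.cthickening_subset_thickening' hd (by linarith) K)
  have hts : tsupport χ ⊆ Metric.cthickening d K := by
    rw [tsupport, hs]
    exact Metric.closure_thickening_subset_cthickening d K
  refine ⟨χ, ⟨contMDiff_iff_contDiff.1 hχ, ?_, hts.trans hdΩ⟩, fun x => hr (mem_range_self x),
    fun x hx => ?_⟩
  · exact hK.cthickening.of_isClosed_subset (isClosed_tsupport _) hts
  · filter_upwards [Metric.isOpen_thickening.mem_nhds
      (Metric.self_subset_thickening (half_pos hd) K hx)] with y hy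
    exact (h1 y).1 (Metric.thickening_subset_cthickening _ _ hy)

theorem gradient_mul {f g : Eu n → ℝ} {x : Eu n} (hf : DifferentiableAt ℝ f x)
    (hg : DifferentiableAt ℝ g x) :
    gradient (fun y => f y * g y) x = f x • gradient g x + g x • gradient f x := by
  have : fderiv ℝ (fun y => f y * g y) x = f x • fderiv ℝ g x + g x • fderiv ℝ f x :=
    fderiv_fun_mul hf hg
  rw [gradient, this, map_add, map_smulₛₗ, map_smulₛₗ]
  rfl

/-- Functions in `W^{1,p}(Ω) ∩ C_c(Ω)` can be approximated by test functions, uniformly and in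
`W^{1,p}`, with supports in a fixed compact set. -/
theorem HasWeakGrad.exists_test_approx {φ : Eu n → ℝ} {G : Eu n → Eu n} (hΩ : IsOpen Ω)
    (h : HasWeakGrad Ω φ G) (hφ : IsCc Ω φ) {p : ℝ≥0∞} (hp1 : 1 ≤ p) (hp : p ≠ ∞)
    (hG : MemLp G p (volume.restrict Ω)) :
    ∃ K : Set (Eu n), IsCompact K ∧ K ⊆ Ω ∧ tsupport φ ⊆ K ∧ ∀ ε : ℝ, 0 < ε →
      ∃ F : Eu n → ℝ, IsTest Ω F ∧ tsupport F ⊆ K ∧ (∀ x, |F x - φ x| ≤ ε) ∧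
        eLpNorm (fun x => gradient F x - G x) p (volume.restrict Ω) ≤ ENNReal.ofReal ε := by
  obtain ⟨χ, hχ, hχ01, hχ1⟩ := exists_test_eq_one hΩ hφ.2.1 hφ.2.2
  set K := tsupport χ with hKdef
  have hK : IsCompact K := hχ.2.1
  have hsub : tsupport φ ⊆ K := fun x hx => by
    refine subset_tsupport _ ?_
    rw [Function.mem_support, (hχ1 x hx).self_of_nhds]
    exact one_ne_zero
  refine ⟨K, hK, hχ.2.2, hsub, fun ε hε => ?_⟩
  have hχ1' : ContDiff ℝ 1 χ := hχ.1.of_le (by exact_mod_cast le_top)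
  obtain ⟨M, hM⟩ := hK.exists_bound_of_continuousOn (continuous_gradient hχ1').continuousOn
  have hvol : (volume.restrict K) univ ^ (1 / p.toReal) ≠ ∞ := by
    rw [Measure.restrict_apply_univ]
    exact ENNReal.rpow_ne_top_of_nonneg (by positivity) hK.measure_lt_top.ne
  set v := ((volume.restrict K) univ ^ (1 / p.toReal)).toReal with hv
  -- The gradient error of the cut-off function is at most ε' from the mollification plus ε'|M|
  -- pointwise from ∇χ, whose Lᵖ norm over K is at most ε'|M|v.
  set ε' := ε / (1 + v * |M|) with hε'
  have hden : 1 ≤ 1 + v * |M| := by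
    have : 0 ≤ v * |M| := by positivity
    linarith
  have hε'0 : 0 < ε' := by positivity
  have hε'ε : ε' * (1 + v * |M|) = ε := by rw [hε']; field_simp
  have hε'le : ε' ≤ ε := div_le_self hε.le hden
  obtain ⟨F₀, hF₀, hF₀u, hF₀g⟩ := h.exists_contDiff_approx hΩ hφ.1.continuousOn hp1 hp
    (fun K' _ hK' => hG.mono_measure (Measure.restrict_mono hK' le_rfl)) hK hχ.2.2 hε'0
  have hF₀1 : ContDiff ℝ 1 F₀ := hF₀.of_le (by exact_mod_cast le_top)
  set F : Eu n → ℝ := fun x => χ x * F₀ x with hF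
  have hFts : tsupport F ⊆ K := tsupport_mul_subset_left
  have hφz : ∀ x ∉ tsupport φ, φ x = 0 := fun x hx => image_eq_zero_of_notMem_tsupport hx
  have hGz : ∀ᵐ x ∂(volume.restrict Ω), x ∉ tsupport φ → G x = 0 :=
    h.ae_eq_zero hΩ (isClosed_tsupport φ) hφz
  have hχφ : ∀ x, χ x * φ x = φ x := fun x => by
    by_cases hx : x ∈ tsupport φ
    · rw [(hχ1 x hx).self_of_nhds]; simp
    · rw [hφz x hx, mul_zero]
  refine ⟨F, ⟨hχ.1.mul hF₀, ?_, hFts.trans hχ.2.2⟩, hFts, fun x => ?_, ?_⟩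
  · exact hK.of_isClosed_subset (isClosed_tsupport _) hFts
  · by_cases hx : x ∈ K
    · rw [← hχφ x, hF, ← mul_sub, abs_mul, abs_of_nonneg (hχ01 x).1]
      exact (mul_le_of_le_one_left (abs_nonneg _) (hχ01 x).2).trans ((hF₀u x hx).trans hε'le)
    · rw [hφz x (fun hc => hx (hsub hc)), hF]
      simp only [image_eq_zero_of_notMem_tsupport hx]
      simpa using hε.le
  · have hzero : ∀ᵐ x ∂(volume.restrict Ω), x ∉ K → gradient F x - G x = 0 := by
      filter_upwards [hGz] with x hx hxK
      rw [hx (fun hc => hxK (hsub hc)),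
        gradient_eq_zero_of_notMem_tsupport (fun hc => hxK (hFts hc)), sub_zero]
    have e1 : eLpNorm (fun x => gradient F x - G x) p (volume.restrict Ω) =
        eLpNorm (fun x => gradient F x - G x) p (volume.restrict K) := by
      have : (fun x => gradient F x - G x) =ᵐ[volume.restrict Ω]
          K.indicator (fun x => gradient F x - G x) := by
        filter_upwards [hzero] with x hx
        by_cases hxK : x ∈ K
        · rw [indicator_of_mem hxK]
        · rw [indicator_of_notMem hxK, hx hxK]
      rw [eLpNorm_congr_ae this, eLpNorm_indicator_eq_eLpNorm_restrict hK.measurableSet,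
        Measure.restrict_restrict hK.measurableSet, inter_eq_left.2 hχ.2.2]
    rw [e1]
    have hGzK : ∀ᵐ x ∂(volume.restrict K), x ∉ tsupport φ → G x = 0 :=
      ae_mono (Measure.restrict_mono hχ.2.2 le_rfl) hGz
    have hpt : ∀ᵐ x ∂(volume.restrict K),
        ‖gradient F x - G x‖ ≤ ‖‖gradient F₀ x - G x‖ + ε' * |M|‖ := by
      filter_upwards [hGzK, ae_restrict_mem hK.measurableSet] with x hx hxK
      have hMx : ‖gradient χ x‖ ≤ |M| := (hM x hxK).trans (le_abs_self M)
      -- On the support of φ the cutoff is locally 1, so ∇χ = 0; off the support both φ and G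
      -- vanish. In either case χG = G and φ∇χ = 0.
      have e : gradient F x - G x =
          χ x • (gradient F₀ x - G x) + (F₀ x - φ x) • gradient χ x := by
        rw [hF, gradient_mul (hχ1'.differentiable one_ne_zero x)
          (hF₀1.differentiable one_ne_zero x)]
        by_cases hxs : x ∈ tsupport φ
        · have h0 : gradient χ x = 0 := by
            rw [gradient, (hχ1 x hxs).fderiv_eq, show (1 : Eu n → ℝ) = fun _ => 1 from rfl,
              fderiv_const_apply, map_zero]
          rw [(hχ1 x hxs).self_of_nhds, h0]
          simp
        · rw [hx hxs, hφz x hxs]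
          simp
      rw [Real.norm_of_nonneg (by positivity), e]
      refine (norm_add_le _ _).trans (add_le_add ?_ ?_)
      · rw [norm_smul, Real.norm_of_nonneg (hχ01 x).1]
        exact mul_le_of_le_one_left (norm_nonneg _) (hχ01 x).2
      · rw [norm_smul]
        exact mul_le_mul (hF₀u x hxK) hMx (norm_nonneg _) hε'0.le
    have hmeas : AEStronglyMeasurable (fun x => ‖gradient F₀ x - G x‖) (volume.restrict K) :=
      ((continuous_gradient hF₀1).aestronglyMeasurable.sub
        (hG.1.mono_measure (Measure.restrict_mono hχ.2.2 le_rfl))).norm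
    calc _ ≤ eLpNorm (fun x => ‖gradient F₀ x - G x‖ + ε' * |M|) p (volume.restrict K) :=
          eLpNorm_mono_ae hpt
      _ ≤ eLpNorm (fun x => ‖gradient F₀ x - G x‖) p (volume.restrict K) +
          eLpNorm (fun _ => ε' * |M|) p (volume.restrict K) :=
          eLpNorm_add_le hmeas aestronglyMeasurable_const hp1
      _ ≤ ENNReal.ofReal ε' + ENNReal.ofReal (ε' * |M|) * ENNReal.ofReal v := by
          refine add_le_add (by rw [eLpNorm_norm]; exact hF₀g) ?_
          refine (eLpNorm_le_of_ae_bound (C := ε' * |M|) (ae_of_all _ fun x => ?_)).trans ?_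
          · rw [Real.norm_of_nonneg (by positivity)]
          · rw [mul_comm, hv, ENNReal.ofReal_toReal hvol, one_div]
      _ = ENNReal.ofReal ε := by
          rw [← ENNReal.ofReal_mul (by positivity), ← ENNReal.ofReal_add hε'0.le (by positivity),
            ← hε'ε]
          ring_nf

/-- Near a point outside Ω the function is identically zero, so continuity on Ω suffices. This is
what allows expressions in u, which is not controlled outside Ω, to be used as elements of C_c(Ω).
-/
theorem isCc_of_continuousOn (hΩ : IsOpen Ω) {f : Eu n → ℝ} (hf : ContinuousOn f Ω)
    {K : Set (Eu n)} (hK : IsCompact K) (hKΩ : K ⊆ Ω) (hfK : ∀ x ∉ K, f x = 0) : IsCc Ω f := by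
  have hts : tsupport f ⊆ K := closure_minimal
    (fun x hx => by by_contra hc; exact hx (hfK x hc)) hK.isClosed
  refine ⟨continuous_iff_continuousAt.2 fun x => ?_,
    hK.of_isClosed_subset (isClosed_tsupport _) hts, hts.trans hKΩ⟩
  by_cases hx : x ∈ Ω
  · exact hf.continuousAt (hΩ.mem_nhds hx)
  · have : f =ᶠ[𝓝 x] fun _ => 0 := by
      filter_upwards [hK.isClosed.isOpen_compl.mem_nhds (fun hc => hx (hKΩ hc))] with y hy
      exact hfK y hy
    exact continuousAt_const.congr this.symm

theorem HasWeakGrad.memLp_of_isCc {p : ℝ≥0∞} {f : Eu n → ℝ} {G : Eu n → Eu n} (hΩ : IsOpen Ω)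
    (h : HasWeakGrad Ω f G) (hf : IsCc Ω f)
    (hG : MemLp G p (volume.restrict (tsupport f))) : MemLp G p (volume.restrict Ω) := by
  have hm := hf.2.1.measurableSet
  have h0 := h.ae_eq_zero hΩ (isClosed_tsupport f) fun x hx => image_eq_zero_of_notMem_tsupport hx
  have : G =ᵐ[volume.restrict Ω] (tsupport f).indicator G := by
    filter_upwards [h0] with x hx
    by_cases hxK : x ∈ tsupport f
    · rw [indicator_of_mem hxK]
    · rw [indicator_of_notMem hxK, hx hxK]
  rw [memLp_congr_ae this, memLp_indicator_iff_restrict hm, Measure.restrict_restrict hm,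
    inter_eq_left.2 hf.2.2]
  exact hG

theorem HasWeakGrad.memW1p_of_isCc {p : ℝ} {f : Eu n → ℝ} {G : Eu n → Eu n} (hΩ : IsOpen Ω)
    (h : HasWeakGrad Ω f G) (hf : IsCc Ω f)
    (hG : MemLp G (ENNReal.ofReal p) (volume.restrict (tsupport f))) : MemW1p p Ω f :=
  ⟨(hf.1.memLp_of_hasCompactSupport hf.2.1).mono_measure Measure.restrict_le_self, G, h,
    h.memLp_of_isCc hΩ hf hG⟩

theorem IsTest.isCc {f : Eu n → ℝ} (h : IsTest Ω f) : IsCc Ω f := ⟨h.1.continuous, h.2⟩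

theorem IsTest.contDiff_one {f : Eu n → ℝ} (h : IsTest Ω f) : ContDiff ℝ 1 f :=
  h.1.of_le (by exact_mod_cast le_top)

theorem IsTest.memW1p {p : ℝ} {f : Eu n → ℝ} (hΩ : IsOpen Ω) (h : IsTest Ω f) : MemW1p p Ω f :=
  (hasWeakGrad_of_contDiff hΩ h.contDiff_one).memW1p_of_isCc hΩ h.isCc
    (((continuous_gradient h.contDiff_one).memLp_of_hasCompactSupport
      (h.2.1.mono' fun _ hx => by
        by_contra hc; exact hx (gradient_eq_zero_of_notMem_tsupport hc))).mono_measure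
      Measure.restrict_le_self)

end Approx


/-! ### The energy density -/

section Coeff

open scoped Topology
open Filter

variable {n : ℕ} {Ω : Set (Eu n)} {p s : ℝ} {a : Eu n → Fin n → ℝ}

theorem exists_isSubdom_ball (hΩ : IsOpen Ω) {x : Eu n} (hx : x ∈ Ω) :
    ∃ r : ℝ, 0 < r ∧ IsSubdom (Metric.ball x r) Ω := by
  obtain ⟨r, hr, hrΩ⟩ := Metric.nhds_basis_closedBall.mem_iff.1 (hΩ.mem_nhds hx)
  refine ⟨r, hr, ⟨Metric.isOpen_ball, ⟨⟨x, Metric.mem_ball_self hr⟩,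
    (convex_ball x r).isPreconnected⟩⟩, ?_, Metric.closure_ball_subset_closedBall.trans hrΩ⟩
  exact (isCompact_closedBall x r).of_isClosed_subset isClosed_closure
    Metric.closure_ball_subset_closedBall

theorem MemMorrey.locallyIntegrableOn {q : ℝ} {ω : Set (Eu n)} {V : Eu n → ℝ}
    (h : MemMorrey p q ω V) : LocallyIntegrableOn V ω := by
  rcases h with h | h | h
  · exact h.2.2.1
  · exact h.2.2.1
  · exact h.2.2.locallyIntegrableOn

/-- Each alternative of the Morrey condition contains local integrability, and every point of Ω has
a ball compactly contained in Ω. This gives a meaning to ∫V|φ|^p for φ in C_c(Ω). -/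
theorem MemMorreyLoc.locallyIntegrableOn {q : ℝ} {V : Eu n → ℝ} (hΩ : IsOpen Ω)
    (h : MemMorreyLoc p q Ω V) : LocallyIntegrableOn V Ω := fun x hx => by
  obtain ⟨r, hr, hb⟩ := exists_isSubdom_ball hΩ hx
  have h1 := (h _ hb).locallyIntegrableOn x (Metric.mem_ball_self hr)
  rw [nhdsWithin_eq_nhds.2 (Metric.ball_mem_nhds x hr)] at h1
  exact h1.filter_mono nhdsWithin_le_nhds

/-- The coefficients are assumed bounded on subdomains only; a compact set is covered by finitely
many balls that are such subdomains. -/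
theorem IsCoeff.exists_le (hΩ : IsOpen Ω) (ha : IsCoeff Ω a) {K : Set (Eu n)} (hK : IsCompact K)
    (hKΩ : K ⊆ Ω) : ∃ C : ℝ, ∀ᵐ x ∂(volume.restrict K), ∀ i, a x i ≤ C := by
  refine hK.induction_on (p := fun K => ∃ C : ℝ, ∀ᵐ x ∂(volume.restrict K), ∀ i, a x i ≤ C)
    ⟨0, by simp⟩ ?_ ?_ ?_
  · rintro A B hAB ⟨C, hC⟩
    exact ⟨C, ae_mono (Measure.restrict_mono hAB le_rfl) hC⟩
  · rintro A B ⟨C, hC⟩ ⟨D, hD⟩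
    refine ⟨max C D, ae_restrict_union_iff A B _ |>.2 ⟨?_, ?_⟩⟩
    · filter_upwards [hC] with x hx i using (hx i).trans (le_max_left _ _)
    · filter_upwards [hD] with x hx i using (hx i).trans (le_max_right _ _)
  · intro x hx
    obtain ⟨r, hr, hb⟩ := exists_isSubdom_ball hΩ (hKΩ hx)
    obtain ⟨c, C, _, hC⟩ := ha.2.2 _ hb
    refine ⟨_, mem_nhdsWithin_of_mem_nhds (Metric.ball_mem_nhds x hr), C, ?_⟩
    filter_upwards [hC] with y hy i using (hy i).2

theorem IsCoeff.exists_saNorm_le (hs : 1 < s) (hΩ : IsOpen Ω) (ha : IsCoeff Ω a) {K : Set (Eu n)}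
    (hK : IsCompact K) (hKΩ : K ⊆ Ω) :
    ∃ C : ℝ, 0 ≤ C ∧ ∀ᵐ x ∂(volume.restrict K), ∀ ξ, saNorm s a x ξ ≤ C * ‖ξ‖ := by
  obtain ⟨C, hC⟩ := ha.exists_le hΩ hK hKΩ
  refine ⟨(∑ _i : Fin n, |C|) ^ (1 / s), by positivity, ?_⟩
  filter_upwards [hC, ae_restrict_mem hK.measurableSet] with x hx hxK ξ
  have hpos := ha.2.1 x (hKΩ hxK)
  refine (saNorm_le_mul_norm hs hpos ξ).trans (mul_le_mul_of_nonneg_right ?_ (norm_nonneg _))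
  exact Real.rpow_le_rpow (Finset.sum_nonneg fun i _ => (hpos i).le)
    (Finset.sum_le_sum fun i _ => (hx i).trans (le_abs_self C)) (by positivity)

theorem ae_pos_of_isCoeff (hΩ : IsOpen Ω) (ha : IsCoeff Ω a) :
    ∀ᵐ x ∂(volume.restrict Ω), ∀ i, 0 < a x i := by
  filter_upwards [ae_restrict_mem hΩ.measurableSet] with x hx using ha.2.1 x hx

theorem aemeasurable_coord {A : Set (Eu n)} {G : Eu n → Eu n}
    (hG : AEStronglyMeasurable G (volume.restrict A)) (i : Fin n) :
    AEMeasurable (fun x => G x i) (volume.restrict A) :=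
  ((EuclideanSpace.proj i : Eu n →L[ℝ] ℝ).continuous.comp_aestronglyMeasurable hG).aemeasurable

theorem IsCoeff.aemeasurable_saNorm (ha : IsCoeff Ω a) {A : Set (Eu n)} (hA : A ⊆ Ω)
    {G : Eu n → Eu n} (hG : AEStronglyMeasurable G (volume.restrict A)) :
    AEMeasurable (fun x => saNorm s a x (G x)) (volume.restrict A) := by
  have h1 : ∀ i, AEMeasurable (fun x => a x i) (volume.restrict A) := fun i =>
    (ha.1 i).mono_measure (Measure.restrict_mono hA le_rfl)
  have h2 := aemeasurable_coord hG
  unfold saNorm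
  refine AEMeasurable.pow_const (Finset.aemeasurable_fun_sum _ fun i _ => ?_) _
  exact (h1 i).mul ((measurable_norm.comp_aemeasurable (h2 i)).pow_const s)

theorem IsCoeff.aemeasurable_inner_opA (hp : 1 < p) (hs : 1 < s) (hΩ : IsOpen Ω)
    (ha : IsCoeff Ω a) {A : Set (Eu n)} (hA : A ⊆ Ω) {G H : Eu n → Eu n}
    (hG : AEStronglyMeasurable G (volume.restrict A))
    (hH : AEStronglyMeasurable H (volume.restrict A)) :
    AEMeasurable (fun x => inner ℝ (opA p s a x (G x)) (H x)) (volume.restrict A) := by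
  have h1 : ∀ i, AEMeasurable (fun x => a x i) (volume.restrict A) := fun i =>
    (ha.1 i).mono_measure (Measure.restrict_mono hA le_rfl)
  have h2 := aemeasurable_coord hG
  have h3 := aemeasurable_coord hH
  have h4 := ha.aemeasurable_saNorm (s := s) hA hG
  have key : AEMeasurable (fun x => saNorm s a x (G x) ^ (p - 1) * (saNorm s a x (G x) ^ (1 - s) *
      ∑ i, a x i * (|G x i| ^ (s - 2) * G x i * H x i))) (volume.restrict A) := by
    refine (h4.pow_const _).mul ((h4.pow_const _).mul (Finset.aemeasurable_fun_sum _ fun i _ => ?_))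
    exact (h1 i).mul ((((measurable_norm.comp_aemeasurable (h2 i)).pow_const (s - 2)).mul
      (h2 i)).mul (h3 i))
  refine key.congr ?_
  filter_upwards [ae_mono (Measure.restrict_mono hA le_rfl) (ae_pos_of_isCoeff hΩ ha)] with x hx
  rw [inner_opA hp hs hx, saDeriv]

theorem IsCoeff.memLp_saNorm (hs : 1 < s) (hΩ : IsOpen Ω) (ha : IsCoeff Ω a) {K : Set (Eu n)}
    (hK : IsCompact K) (hKΩ : K ⊆ Ω) {P : ℝ≥0∞} {G : Eu n → Eu n}
    (hG : MemLp G P (volume.restrict K)) :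
    MemLp (fun x => saNorm s a x (G x)) P (volume.restrict K) := by
  obtain ⟨C, _, hC⟩ := ha.exists_saNorm_le hs hΩ hK hKΩ
  refine hG.of_le_mul (ha.aemeasurable_saNorm hKΩ hG.1).aestronglyMeasurable (c := C) ?_
  filter_upwards [hC, ae_restrict_mem hK.measurableSet] with x hx hxK
  rw [Real.norm_of_nonneg (saNorm_nonneg (ha.2.1 x (hKΩ hxK)) _)]
  exact hx _

theorem IsCoeff.integrable_saNorm_rpow (hp : 1 < p) (hs : 1 < s) (hΩ : IsOpen Ω)
    (ha : IsCoeff Ω a) {K : Set (Eu n)} (hK : IsCompact K) (hKΩ : K ⊆ Ω) {G : Eu n → Eu n}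
    (hG : MemLp G (ENNReal.ofReal p) (volume.restrict K)) :
    IntegrableOn (fun x => saNorm s a x (G x) ^ p) K := by
  have h := (ha.memLp_saNorm hs hΩ hK hKΩ hG).integrable_norm_rpow
    (ENNReal.ofReal_pos.2 (by linarith)).ne' ENNReal.ofReal_ne_top
  rw [ENNReal.toReal_ofReal (by linarith)] at h
  refine Integrable.congr h ?_
  filter_upwards [ae_restrict_mem hK.measurableSet] with x hxK
  rw [Real.norm_of_nonneg (saNorm_nonneg (ha.2.1 x (hKΩ hxK)) _)]

/-- The vector field `𝒜(x, G)` defines a bounded functional on `Lᵖ(K)`. -/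
theorem IsCoeff.exists_lintegral_inner_opA_le (hp : 1 < p) (hs : 1 < s) (hΩ : IsOpen Ω)
    (ha : IsCoeff Ω a) {K : Set (Eu n)} (hK : IsCompact K) (hKΩ : K ⊆ Ω) {G : Eu n → Eu n}
    (hG : MemLp G (ENNReal.ofReal p) (volume.restrict K)) :
    ∃ C : ℝ≥0∞, C ≠ ∞ ∧ ∀ H : Eu n → Eu n, AEStronglyMeasurable H (volume.restrict K) →
      ∫⁻ x in K, ‖inner ℝ (opA p s a x (G x)) (H x)‖ₑ ≤
        C * eLpNorm H (ENNReal.ofReal p) (volume.restrict K) := by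
  have hp0 : 0 < p := by linarith
  obtain ⟨B, hB0, hB⟩ := ha.exists_saNorm_le hs hΩ hK hKΩ
  have hN := ha.memLp_saNorm hs hΩ hK hKΩ hG
  have hpq : p.HolderConjugate p.conjExponent := Real.HolderConjugate.conjExponent hp
  set q := p.conjExponent with hq
  have hq0 : 0 < q := hpq.symm.pos
  set I : ℝ≥0∞ := ∫⁻ x in K, ENNReal.ofReal (saNorm s a x (G x) ^ (p - 1)) ^ q with hI
  have hIfin : I ≠ ∞ := by
    -- Since (p - 1)q = p for the conjugate exponent q, the L^q integral of |G|^{p-1} is the L^p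
    -- integral of |G|.
    have e : I = ∫⁻ x in K, ENNReal.ofReal (saNorm s a x (G x) ^ p) := by
      refine lintegral_congr_ae ?_
      filter_upwards [ae_restrict_mem hK.measurableSet] with x hxK
      have h0 := saNorm_nonneg (s := s) (ha.2.1 x (hKΩ hxK)) (G x)
      rw [ENNReal.ofReal_rpow_of_nonneg (by positivity) hq0.le, ← Real.rpow_mul h0,
        hpq.sub_one_mul_conj]
    rw [e]
    exact (ha.integrable_saNorm_rpow hp hs hΩ hK hKΩ hG).lintegral_lt_top.ne
  refine ⟨ENNReal.ofReal B * I ^ (1 / q), ENNReal.mul_ne_top ENNReal.ofReal_ne_top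
    (ENNReal.rpow_ne_top_of_nonneg (by positivity) hIfin), fun H hH => ?_⟩
  have hNH := ha.aemeasurable_saNorm (s := s) hKΩ hH
  calc ∫⁻ x in K, ‖inner ℝ (opA p s a x (G x)) (H x)‖ₑ
      ≤ ∫⁻ x in K, ((fun x => ENNReal.ofReal (saNorm s a x (H x))) *
          fun x => ENNReal.ofReal (saNorm s a x (G x) ^ (p - 1))) x := by
        refine lintegral_mono_ae ?_
        filter_upwards [ae_restrict_mem hK.measurableSet] with x hxK
        have hpos := ha.2.1 x (hKΩ hxK)
        have h0 := saNorm_nonneg (s := s) hpos (G x)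
        rw [Pi.mul_apply, mul_comm, ← ENNReal.ofReal_mul (by positivity),
          Real.enorm_eq_ofReal_abs]
        exact ENNReal.ofReal_le_ofReal (abs_inner_opA_le hp hs hpos _ _)
    _ ≤ _ := ENNReal.lintegral_mul_le_Lp_mul_Lq _ hpq hNH.ennreal_ofReal
          (hN.1.aemeasurable.pow_const _).ennreal_ofReal
    _ ≤ (ENNReal.ofReal B * eLpNorm H (ENNReal.ofReal p) (volume.restrict K)) * I ^ (1 / q) := by
        gcongr
        have h1 := eLpNorm_le_mul_eLpNorm_of_ae_le_mul (f := fun x => saNorm s a x (H x)) (g := H)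
          (c := B) (μ := volume.restrict K) (by
            filter_upwards [hB, ae_restrict_mem hK.measurableSet] with x hx hxK
            rw [Real.norm_of_nonneg (saNorm_nonneg (ha.2.1 x (hKΩ hxK)) _)]
            exact hx _) (ENNReal.ofReal p)
        refine le_trans (le_of_eq ?_) h1
        rw [eLpNorm_eq_lintegral_rpow_enorm_toReal (ENNReal.ofReal_pos.2 hp0).ne'
          ENNReal.ofReal_ne_top, ENNReal.toReal_ofReal hp0.le]
        congr 1
        refine lintegral_congr_ae ?_
        filter_upwards [ae_restrict_mem hK.measurableSet] with x hxK
        rw [Real.enorm_of_nonneg (saNorm_nonneg (ha.2.1 x (hKΩ hxK)) _)]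
    _ = _ := by ring

theorem IsCoeff.integrable_inner_opA (hp : 1 < p) (hs : 1 < s) (hΩ : IsOpen Ω)
    (ha : IsCoeff Ω a) {K : Set (Eu n)} (hK : IsCompact K) (hKΩ : K ⊆ Ω) {G H : Eu n → Eu n}
    (hG : MemLp G (ENNReal.ofReal p) (volume.restrict K))
    (hH : MemLp H (ENNReal.ofReal p) (volume.restrict K)) :
    IntegrableOn (fun x => inner ℝ (opA p s a x (G x)) (H x)) K := by
  refine ⟨(ha.aemeasurable_inner_opA hp hs hΩ hKΩ hG.1 hH.1).aestronglyMeasurable, ?_⟩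
  obtain ⟨C, hC, h⟩ := ha.exists_lintegral_inner_opA_le hp hs hΩ hK hKΩ hG
  exact (h H hH.1).trans_lt (ENNReal.mul_lt_top hC.lt_top hH.2)

end Coeff


/-! ### Positive solutions and the energy identity -/

section AEZero

variable {n : ℕ} {Ω K : Set (Eu n)} {f : Eu n → ℝ}

theorem ae_eq_indicator_of_ae_zero {E : Type*} [Zero E] {f : Eu n → E}
    (h : ∀ᵐ x ∂(volume.restrict Ω), x ∉ K → f x = 0) :
    f =ᵐ[volume.restrict Ω] K.indicator f := by
  filter_upwards [h] with x hx
  by_cases hxK : x ∈ K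
  · rw [indicator_of_mem hxK]
  · rw [indicator_of_notMem hxK, hx hxK]

theorem setIntegral_of_ae_zero (hK : MeasurableSet K) (hKΩ : K ⊆ Ω)
    (h : ∀ᵐ x ∂(volume.restrict Ω), x ∉ K → f x = 0) : ∫ x in Ω, f x = ∫ x in K, f x := by
  rw [integral_congr_ae (ae_eq_indicator_of_ae_zero h), integral_indicator hK,
    Measure.restrict_restrict hK, inter_eq_left.2 hKΩ]

theorem integrableOn_of_ae_zero (hK : MeasurableSet K)
    (h : ∀ᵐ x ∂(volume.restrict Ω), x ∉ K → f x = 0) (hi : IntegrableOn f K) :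
    IntegrableOn f Ω := by
  refine Integrable.congr ?_ (ae_eq_indicator_of_ae_zero h).symm
  exact ((integrable_indicator_iff hK).2 hi).restrict

end AEZero

/-- `u` is a positive continuous weak solution, and `V` is locally integrable. -/
structure IsPosSol {n : ℕ} (p s : ℝ) (Ω : Set (Eu n)) (a : Eu n → Fin n → ℝ) (V u : Eu n → ℝ) :
    Prop where
  one_lt_p : 1 < p
  one_lt_s : 1 < s
  isOpen : IsOpen Ω
  isCoeff : IsCoeff Ω a
  locallyIntegrableOn : LocallyIntegrableOn V Ω
  continuousOn : ContinuousOn u Ω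
  pos : ∀ x ∈ Ω, 0 < u x
  isWeakSol : IsWeakSol p s Ω a V u

section Energy

open scoped Topology
open Filter

variable {n : ℕ} {p s : ℝ} {Ω : Set (Eu n)} {a : Eu n → Fin n → ℝ} {V u : Eu n → ℝ}

theorem one_le_ofReal (hp : 1 < p) : 1 ≤ ENNReal.ofReal p := by
  rw [← ENNReal.ofReal_one]; exact ENNReal.ofReal_le_ofReal hp.le

theorem IsPosSol.hasWeakGrad (h : IsPosSol p s Ω a V u) : HasWeakGrad Ω u (weakGrad Ω u) := by
  obtain ⟨G, hG, _⟩ := h.isWeakSol.1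
  exact hG.weakGrad_self

theorem IsPosSol.memLp_weakGrad (h : IsPosSol p s Ω a V u) {K : Set (Eu n)} (hK : IsCompact K)
    (hKΩ : K ⊆ Ω) : MemLp (weakGrad Ω u) (ENNReal.ofReal p) (volume.restrict K) := by
  obtain ⟨G, hG, hGp⟩ := h.isWeakSol.1
  exact (memLp_congr_ae (ae_mono (Measure.restrict_mono hKΩ le_rfl)
    (hG.weakGrad_ae_eq h.isOpen))).2 (hGp K hK hKΩ).2

theorem abs_rpow_sub_two_mul_self {y : ℝ} (hy : 0 < y) : |y| ^ (p - 2) * y = y ^ (p - 1) := by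
  rw [abs_of_pos hy, ← Real.rpow_add_one hy.ne']
  ring_nf

theorem IsPosSol.continuousOn_rpow (h : IsPosSol p s Ω a V u) :
    ContinuousOn (fun x => |u x| ^ (p - 2) * u x) Ω := by
  have : ContinuousOn (fun x => u x ^ (p - 1)) Ω :=
    h.continuousOn.rpow_const fun x hx => Or.inl (h.pos x hx).ne'
  exact this.congr fun x hx => abs_rpow_sub_two_mul_self (h.pos x hx)

/-- The weak formulation holds for test functions in `W^{1,p}(Ω) ∩ C_c(Ω)`. -/
theorem IsPosSol.weak_eq (h : IsPosSol p s Ω a V u) {Φ : Eu n → ℝ} {G : Eu n → Eu n}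
    (hΦ : IsCc Ω Φ) (hG : HasWeakGrad Ω Φ G)
    (hGp : MemLp G (ENNReal.ofReal p) (volume.restrict Ω)) :
    (∫ x in Ω, inner ℝ (opA p s a x (weakGrad Ω u x)) (G x)) +
      ∫ x in Ω, V x * (|u x| ^ (p - 2) * u x) * Φ x = 0 := by
  obtain ⟨K, hK, hKΩ, hΦK, happ⟩ := hG.exists_test_approx h.isOpen hΦ
    (one_le_ofReal h.one_lt_p) ENNReal.ofReal_ne_top hGp
  have hW : IntegrableOn (fun x => V x * (|u x| ^ (p - 2) * u x)) K :=
    (h.locallyIntegrableOn.integrableOn_compact_subset hKΩ hK).mul_continuousOn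
      (h.continuousOn_rpow.mono hKΩ) hK
  have hDu := h.memLp_weakGrad hK hKΩ
  obtain ⟨C, hC, hop⟩ := h.isCoeff.exists_lintegral_inner_opA_le h.one_lt_p h.one_lt_s h.isOpen
    hK hKΩ hDu
  have hGK : MemLp G (ENNReal.ofReal p) (volume.restrict K) :=
    hGp.mono_measure (Measure.restrict_mono hKΩ le_rfl)
  have hGz := hG.ae_eq_zero h.isOpen (isClosed_tsupport Φ)
    fun x hx => image_eq_zero_of_notMem_tsupport hx
  have hΦz : ∀ x ∉ K, Φ x = 0 := fun x hx =>
    image_eq_zero_of_notMem_tsupport fun hc => hx (hΦK hc)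
  rw [setIntegral_of_ae_zero hK.measurableSet hKΩ (by
      filter_upwards [hGz] with x hx hxK
      rw [hx fun hc => hxK (hΦK hc), inner_zero_right]),
    setIntegral_of_ae_zero hK.measurableSet hKΩ (by
      filter_upwards with x hxK
      rw [hΦz x hxK, mul_zero])]
  set E := (∫ x in K, inner ℝ (opA p s a x (weakGrad Ω u x)) (G x)) +
    ∫ x in K, V x * (|u x| ^ (p - 2) * u x) * Φ x with hE
  set D := ∫ x in K, |V x * (|u x| ^ (p - 2) * u x)| with hD
  have hD0 : 0 ≤ D := integral_nonneg fun _ => abs_nonneg _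
  -- The weak formulation vanishes on test functions. Replacing Φ by a test function within ε costs
  -- at most C·ε in the gradient term (Hölder) and D·ε in the potential term (uniform closeness).
  have key : ∀ ε : ℝ, 0 < ε → |E| ≤ (C.toReal + D) * ε := by
    intro ε hε
    obtain ⟨F, hF, hFK, hFu, hFg⟩ := happ ε hε
    have hFz : ∀ x ∉ K, F x = 0 := fun x hx =>
      image_eq_zero_of_notMem_tsupport fun hc => hx (hFK hc)
    have h0 := h.isWeakSol.2 F hF
    rw [setIntegral_of_ae_zero hK.measurableSet hKΩ (by
        filter_upwards with x hxK
        rw [gradient_eq_zero_of_notMem_tsupport fun hc => hxK (hFK hc), inner_zero_right]),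
      setIntegral_of_ae_zero hK.measurableSet hKΩ (by
        filter_upwards with x hxK
        rw [hFz x hxK, mul_zero])] at h0
    have hgK : MemLp (gradient F) (ENNReal.ofReal p) (volume.restrict K) :=
      ((continuous_gradient hF.contDiff_one).memLp_of_hasCompactSupport
        (hF.2.1.mono' fun _ hx => by
          by_contra hc; exact hx (gradient_eq_zero_of_notMem_tsupport hc))).mono_measure
        Measure.restrict_le_self
    have i1 := h.isCoeff.integrable_inner_opA h.one_lt_p h.one_lt_s h.isOpen hK hKΩ hDu hGK
    have i2 := h.isCoeff.integrable_inner_opA h.one_lt_p h.one_lt_s h.isOpen hK hKΩ hDu hgK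
    have i3 : IntegrableOn (fun x => V x * (|u x| ^ (p - 2) * u x) * Φ x) K :=
      hW.mul_continuousOn hΦ.1.continuousOn hK
    have i4 : IntegrableOn (fun x => V x * (|u x| ^ (p - 2) * u x) * F x) K :=
      hW.mul_continuousOn hF.1.continuous.continuousOn hK
    have e1 : -E = (∫ x in K, inner ℝ (opA p s a x (weakGrad Ω u x)) (gradient F x - G x)) +
        ∫ x in K, V x * (|u x| ^ (p - 2) * u x) * (F x - Φ x) := by
      simp only [inner_sub_right, mul_sub]
      rw [integral_sub i2 i1, integral_sub i4 i3]
      linarith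
    have b1 : |∫ x in K, inner ℝ (opA p s a x (weakGrad Ω u x)) (gradient F x - G x)| ≤
        C.toReal * ε := by
      have h1 := hop (fun x => gradient F x - G x) (hgK.1.sub hGK.1)
      have h2 := (enorm_integral_le_lintegral_enorm
        (fun x => inner ℝ (opA p s a x (weakGrad Ω u x)) (gradient F x - G x))).trans (h1.trans
        (mul_le_mul_right ((eLpNorm_mono_measure _ (Measure.restrict_mono hKΩ le_rfl)).trans hFg) C))
      rw [Real.enorm_eq_ofReal_abs, ← ENNReal.ofReal_toReal hC,
        ← ENNReal.ofReal_mul ENNReal.toReal_nonneg,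
        ENNReal.ofReal_le_ofReal_iff (by positivity)] at h2
      exact h2
    have b2 : |∫ x in K, V x * (|u x| ^ (p - 2) * u x) * (F x - Φ x)| ≤ D * ε := by
      rw [hD, ← integral_mul_const, ← Real.norm_eq_abs]
      simp only [← Real.norm_eq_abs (V _ * (|u _| ^ (p - 2) * u _))]
      refine norm_integral_le_of_norm_le (hW.norm.mul_const ε) (ae_of_all _ fun x => ?_)
      rw [norm_mul]
      exact mul_le_mul_of_nonneg_left (hFu x) (norm_nonneg _)
    rw [← abs_neg, e1]
    calc _ ≤ _ := abs_add_le _ _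
      _ ≤ C.toReal * ε + D * ε := add_le_add b1 b2
      _ = _ := by ring
  by_contra hne
  have hEpos : 0 < |E| := abs_pos.2 hne
  have hCD : 0 ≤ C.toReal + D := by positivity
  have := key (|E| / (2 * (C.toReal + D + 1))) (by positivity)
  rw [← mul_div_assoc, le_div_iff₀ (by positivity)] at this
  nlinarith

/-- For p < 2 the factor |y|^{p-2} is singular at 0; the product is continuous because it is the
derivative of the C¹ function |y|^p. -/
theorem continuous_abs_rpow_sub_two_mul (hp : 1 < p) :
    Continuous fun y : ℝ => p * |y| ^ (p - 2) * y := by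
  have h : ContDiff ℝ 1 fun y : ℝ => |y| ^ p := contDiff_norm_rpow hp
  have := h.continuous_deriv le_rfl
  convert this using 1
  funext y
  exact (hasDerivAt_abs_rpow y hp).deriv.symm

/-- Picone's function `|φ|^p u^{1-p}` and its weak gradient. -/
theorem IsPosSol.hasWeakGrad_picone (h : IsPosSol p s Ω a V u) {φ : Eu n → ℝ} {G : Eu n → Eu n}
    (hφ : ContinuousOn φ Ω) (hG : HasWeakGrad Ω φ G) :
    HasWeakGrad Ω (fun x => |φ x| ^ p * u x ^ (1 - p))
      (fun x => (p * |φ x| ^ (p - 2) * φ x * u x ^ (1 - p)) • G x +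
        (|φ x| ^ p * ((1 - p) * u x ^ (1 - p - 1))) • weakGrad Ω u x) := by
  have hp := h.one_lt_p
  have hU : IsOpen {z : ℝ × ℝ | 0 < z.2} := isOpen_lt continuous_const continuous_snd
  refine HasWeakGrad.comp₂ h.isOpen hG h.hasWeakGrad hφ h.continuousOn hU
    (Φ := fun z : ℝ × ℝ => |z.1| ^ p * z.2 ^ (1 - p))
    (Φ₁ := fun z => p * |z.1| ^ (p - 2) * z.1 * z.2 ^ (1 - p))
    (Φ₂ := fun z => |z.1| ^ p * ((1 - p) * z.2 ^ (1 - p - 1))) ?_ ?_ ?_ (fun x hx => h.pos x hx)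
  · refine ((continuous_abs_rpow_sub_two_mul hp).comp continuous_fst).continuousOn.mul ?_
    exact continuousOn_snd.rpow_const fun z hz => Or.inl (ne_of_gt hz)
  · refine ContinuousOn.mul ?_ (continuousOn_const.mul
      (continuousOn_snd.rpow_const fun z hz => Or.inl (ne_of_gt hz)))
    exact ((continuous_abs.comp continuous_fst).rpow_const
      fun z => Or.inr (by linarith)).continuousOn
  · intro z hz
    have h1 := (hasDerivAt_abs_rpow z.1 hp).comp_hasFDerivAt z
      (hasFDerivAt_fst (𝕜 := ℝ) (p := z))
    have h2 := (Real.hasDerivAt_rpow_const (p := 1 - p) (Or.inl (ne_of_gt hz))).comp_hasFDerivAt z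
      (hasFDerivAt_snd (𝕜 := ℝ) (p := z))
    refine (h1.mul h2).congr_fderiv ?_
    ext
    · simp
      ring
    · simp

/-- The integrand of the energy in terms of the Bregman distance. -/
theorem bregman_picone (hp : 1 < p) (hs : 1 < s) {x : Eu n} (ha : ∀ i, 0 < a x i) {y w : ℝ}
    (hw : 0 < w) (ξ ζ : Eu n) :
    bregman p s a x ((y / w) • ξ) (ζ - (y / w) • ξ) = saNorm s a x ζ ^ p -
      inner ℝ (opA p s a x ξ) ((p * |y| ^ (p - 2) * y * w ^ (1 - p)) • ζ +
        (|y| ^ p * ((1 - p) * w ^ (1 - p - 1))) • ξ) := by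
  have hself := inner_opA_self hp hs ha ξ
  have hq0 : 0 ≤ |y / w| := abs_nonneg _
  -- These are the homogeneity factors of 𝒜 and of the p-th power of the norm at (y/w)ξ. They match
  -- the coefficients in the gradient of Picone's function.
  have e1 : |y / w| ^ (p - 2) * (y / w) = |y| ^ (p - 2) * y * w ^ (1 - p) := by
    rw [abs_div, abs_of_pos hw, Real.div_rpow (abs_nonneg _) hw.le,
      show 1 - p = -(p - 2) + -1 by ring, Real.rpow_add hw, Real.rpow_neg hw.le, Real.rpow_neg_one]
    field_simp
  have e2 : |y / w| ^ p = |y| ^ p * w ^ (1 - p - 1) := by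
    rw [abs_div, abs_of_pos hw, Real.div_rpow (abs_nonneg _) hw.le,
      show 1 - p - 1 = -p by ring, Real.rpow_neg hw.le]
    field_simp
  have e3 := abs_rpow_sub_two_mul_sq hp (y / w)
  rw [bregman, add_sub_cancel, saNorm_smul hs ha, opA_smul hp hs ha, inner_smul_left,
    inner_sub_right, inner_smul_right, inner_add_right, inner_smul_right, inner_smul_right,
    conj_trivial, hself, Real.mul_rpow hq0 (saNorm_nonneg ha _)]
  set N := saNorm s a x ξ ^ p
  set I := inner ℝ (opA p s a x ξ) ζ
  rw [show p * |y| ^ (p - 2) * y * w ^ (1 - p) = p * (|y| ^ (p - 2) * y * w ^ (1 - p)) by ring,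
    ← e1, show |y| ^ p * ((1 - p) * w ^ (1 - p - 1)) = (1 - p) * (|y| ^ p * w ^ (1 - p - 1)) by ring,
    ← e2]
  linear_combination (-(1 : ℝ) * p * -N) * e3

theorem MemW1p.hasWeakGrad {φ : Eu n → ℝ} (hφ : MemW1p p Ω φ) :
    HasWeakGrad Ω φ (weakGrad Ω φ) := by
  obtain ⟨_, G, hG, _⟩ := hφ
  exact hG.weakGrad_self

theorem MemW1p.memLp_weakGrad (hΩ : IsOpen Ω) {φ : Eu n → ℝ} (hφ : MemW1p p Ω φ) :
    MemLp (weakGrad Ω φ) (ENNReal.ofReal p) (volume.restrict Ω) := by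
  obtain ⟨_, G, hG, hGp⟩ := hφ
  exact (memLp_congr_ae (hG.weakGrad_ae_eq hΩ)).2 hGp

/-- Products of `Lᵖ` vector fields with continuous functions. -/
theorem memLp_continuousOn_smul {P : ℝ≥0∞} {K : Set (Eu n)} (hK : IsCompact K) {c : Eu n → ℝ}
    (hc : ContinuousOn c K) {G : Eu n → Eu n} (hG : MemLp G P (volume.restrict K)) :
    MemLp (fun x => c x • G x) P (volume.restrict K) := by
  obtain ⟨B, hB⟩ := hK.exists_bound_of_continuousOn hc
  refine hG.of_le_mul ((hc.aestronglyMeasurable hK.measurableSet).smul hG.1) (c := B) ?_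
  filter_upwards [ae_restrict_mem hK.measurableSet] with x hx
  rw [norm_smul]
  exact mul_le_mul_of_nonneg_right (hB x hx) (norm_nonneg _)

/-- The Bregman density of the energy. -/
noncomputable def density (p s : ℝ) (Ω : Set (Eu n)) (a : Eu n → Fin n → ℝ) (u φ : Eu n → ℝ)
    (x : Eu n) : ℝ :=
  bregman p s a x ((φ x / u x) • weakGrad Ω u x) (weakGrad Ω φ x - (φ x / u x) • weakGrad Ω u x)

theorem IsPosSol.density_nonneg (h : IsPosSol p s Ω a V u) (φ : Eu n → ℝ) {x : Eu n} (hx : x ∈ Ω) :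
    0 ≤ density p s Ω a u φ x :=
  bregman_nonneg h.one_lt_p h.one_lt_s (h.isCoeff.2.1 x hx) _ _

/-- Testing the equation with Φ = |φ|^p u^{1-p} gives ∫⟨𝒜(∇u), ∇Φ⟩ = -∫V|φ|^p. By `bregman_picone`
the density is |∇φ|^p - ⟨𝒜(∇u), ∇Φ⟩, so its integral is Q[φ]. -/
theorem IsPosSol.energy_eq (h : IsPosSol p s Ω a V u) {φ : Eu n → ℝ} (hφ : MemW1p p Ω φ)
    (hc : IsCc Ω φ) :
    IntegrableOn (density p s Ω a u φ) Ω ∧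
      energy p s Ω a V φ = ∫ x in Ω, density p s Ω a u φ x := by
  have hp := h.one_lt_p
  have hs := h.one_lt_s
  have hG := hφ.hasWeakGrad
  have hGp := hφ.memLp_weakGrad h.isOpen
  have hPic := h.hasWeakGrad_picone hc.1.continuousOn hG
  set Φ : Eu n → ℝ := fun x => |φ x| ^ p * u x ^ (1 - p) with hΦ
  set c₁ : Eu n → ℝ := fun x => p * |φ x| ^ (p - 2) * φ x * u x ^ (1 - p) with hc₁
  set c₂ : Eu n → ℝ := fun x => |φ x| ^ p * ((1 - p) * u x ^ (1 - p - 1)) with hc₂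
  set H : Eu n → Eu n := fun x => c₁ x • weakGrad Ω φ x + c₂ x • weakGrad Ω u x with hH
  set K := tsupport φ with hKdef
  have hK : IsCompact K := hc.2.1
  have hKΩ : K ⊆ Ω := hc.2.2
  have hφz : ∀ x ∉ K, φ x = 0 := fun x hx => image_eq_zero_of_notMem_tsupport hx
  have hp0 : p ≠ 0 := by linarith
  have hΦz : ∀ x ∉ K, Φ x = 0 := fun x hx => by simp [hΦ, hφz x hx, Real.zero_rpow hp0]
  have hupow : ∀ r : ℝ, ContinuousOn (fun x => u x ^ r) Ω := fun r =>
    h.continuousOn.rpow_const fun x hx => Or.inl (h.pos x hx).ne'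
  have hφpow : Continuous fun x => |φ x| ^ p :=
    (continuous_abs.comp hc.1).rpow_const fun x => Or.inr (by linarith)
  have hΦc : ContinuousOn Φ Ω := hφpow.continuousOn.mul (hupow _)
  have hΦcc : IsCc Ω Φ := isCc_of_continuousOn h.isOpen hΦc hK hKΩ hΦz
  have hc₁c : ContinuousOn c₁ Ω :=
    ((continuous_abs_rpow_sub_two_mul hp).comp hc.1).continuousOn.mul (hupow _)
  have hc₂c : ContinuousOn c₂ Ω := hφpow.continuousOn.mul (continuousOn_const.mul (hupow _))
  have hGK : MemLp (weakGrad Ω φ) (ENNReal.ofReal p) (volume.restrict K) :=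
    hGp.mono_measure (Measure.restrict_mono hKΩ le_rfl)
  have hDu := h.memLp_weakGrad hK hKΩ
  have hHK : MemLp H (ENNReal.ofReal p) (volume.restrict K) :=
    (memLp_continuousOn_smul hK (hc₁c.mono hKΩ) hGK).add
      (memLp_continuousOn_smul hK (hc₂c.mono hKΩ) hDu)
  have hΦK : tsupport Φ ⊆ K := closure_minimal
    (fun x hx => by by_contra hcx; exact hx (hΦz x hcx)) hK.isClosed
  have hHp : MemLp H (ENNReal.ofReal p) (volume.restrict Ω) :=
    hPic.memLp_of_isCc h.isOpen hΦcc (hHK.mono_measure (Measure.restrict_mono hΦK le_rfl))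
  have hweak := h.weak_eq hΦcc hPic hHp
  have hGz := hG.ae_eq_zero h.isOpen (isClosed_tsupport φ) hφz
  have hHz : ∀ᵐ x ∂(volume.restrict Ω), x ∉ K → H x = 0 := by
    filter_upwards [hGz] with x hx hxK
    simp [hH, hc₂, hx hxK, hφz x hxK, Real.zero_rpow hp0]
  have hmem : ∀ᵐ x ∂(volume.restrict Ω), x ∈ Ω := ae_restrict_mem h.isOpen.measurableSet
  have i1 : IntegrableOn (fun x => saNorm s a x (weakGrad Ω φ x) ^ p) Ω := by
    refine integrableOn_of_ae_zero hK.measurableSet ?_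
      (h.isCoeff.integrable_saNorm_rpow hp hs h.isOpen hK hKΩ hGK)
    filter_upwards [hGz] with x hx hxK
    rw [hx hxK, saNorm_zero hs, Real.zero_rpow hp0]
  have i2 : IntegrableOn (fun x => inner ℝ (opA p s a x (weakGrad Ω u x)) (H x)) Ω := by
    refine integrableOn_of_ae_zero hK.measurableSet ?_
      (h.isCoeff.integrable_inner_opA hp hs h.isOpen hK hKΩ hDu hHK)
    filter_upwards [hHz] with x hx hxK
    rw [hx hxK, inner_zero_right]
  have i3 : IntegrableOn (fun x => V x * |φ x| ^ p) Ω := by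
    refine integrableOn_of_ae_zero hK.measurableSet ?_
      ((h.locallyIntegrableOn.integrableOn_compact_subset hKΩ hK).mul_continuousOn
        hφpow.continuousOn hK)
    filter_upwards with x hxK
    rw [hφz x hxK, abs_zero, Real.zero_rpow hp0, mul_zero]
  have hd : ∀ᵐ x ∂(volume.restrict Ω), density p s Ω a u φ x =
      saNorm s a x (weakGrad Ω φ x) ^ p - inner ℝ (opA p s a x (weakGrad Ω u x)) (H x) := by
    filter_upwards [hmem] with x hx
    exact bregman_picone hp hs (h.isCoeff.2.1 x hx) (h.pos x hx) _ _
  -- The powers cancel, u^{p-1}u^{1-p} = 1, which is why Φ is the right test function.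
  have hV : ∫ x in Ω, V x * (|u x| ^ (p - 2) * u x) * Φ x = ∫ x in Ω, V x * |φ x| ^ p := by
    refine integral_congr_ae ?_
    filter_upwards [hmem] with x hx
    have hux := h.pos x hx
    rw [abs_rpow_sub_two_mul_self hux, hΦ]
    have : u x ^ (p - 1) * u x ^ (1 - p) = 1 := by
      rw [← Real.rpow_add hux]; simp
    linear_combination (V x * |φ x| ^ p) * this
  refine ⟨(i1.sub i2).congr (by filter_upwards [hd] with x hx using hx.symm), ?_⟩
  rw [energy, integral_add i1 i3, integral_congr_ae hd, integral_sub i1 i2]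
  rw [hV] at hweak
  linarith

/-- The positive solution makes Q an integral of Bregman distances. Nonnegativity keeps the infima
defining the capacity bounded below. -/
theorem IsPosSol.energy_nonneg (h : IsPosSol p s Ω a V u) {φ : Eu n → ℝ} (hφ : MemW1p p Ω φ)
    (hc : IsCc Ω φ) : 0 ≤ energy p s Ω a V φ := by
  rw [(h.energy_eq hφ hc).2]
  exact setIntegral_nonneg h.isOpen.measurableSet fun x hx => h.density_nonneg φ hx

end Energy


/-! ### Truncation and the capacitary inequality -/

section Mazya

open scoped Topology
open Filter

variable {n : ℕ} {p s : ℝ} {Ω : Set (Eu n)} {a : Eu n → Fin n → ℝ} {V u : Eu n → ℝ}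

theorem IsPosSol.isCc_div (h : IsPosSol p s Ω a V u) {φ : Eu n → ℝ} (hc : IsCc Ω φ) :
    IsCc Ω (fun x => φ x / u x) :=
  isCc_of_continuousOn h.isOpen (hc.1.continuousOn.div h.continuousOn fun x hx => (h.pos x hx).ne')
    hc.2.1 hc.2.2 fun x hx => by rw [image_eq_zero_of_notMem_tsupport hx, zero_div]

/-- The truncation `u f_t(φ / u)`. -/
theorem IsPosSol.truncation (h : IsPosSol p s Ω a V u) {φ : Eu n → ℝ} (hφ : MemW1p p Ω φ)
    (hc : IsCc Ω φ) {k : ℕ} (hk : k ≠ 0) {t : ℝ} (ht : 0 < t) :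
    MemW1p p Ω (fun x => u x * trunc k t (φ x / u x)) ∧
      IsCc Ω (fun x => u x * trunc k t (φ x / u x)) ∧
      ∀ᵐ x ∂(volume.restrict Ω), density p s Ω a u (fun x => u x * trunc k t (φ x / u x)) x =
        bregman p s a x (trunc k t (φ x / u x) • weakGrad Ω u x)
          (deriv (trunc k t) (φ x / u x) •
            (weakGrad Ω φ x - (φ x / u x) • weakGrad Ω u x)) := by
  set f := trunc k t with hf
  have hfC : ContDiff ℝ 1 f := contDiff_trunc k t
  have hf'c : Continuous (deriv f) := hfC.continuous_deriv le_rfl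
  set τ : Eu n → ℝ := fun x => u x * f (φ x / u x) with hτ
  have hψ := h.isCc_div hc
  have hU : IsOpen {z : ℝ × ℝ | 0 < z.2} := isOpen_lt continuous_const continuous_snd
  have hq : ContinuousOn (fun z : ℝ × ℝ => z.1 / z.2) {z | 0 < z.2} :=
    continuousOn_fst.div continuousOn_snd fun z hz => ne_of_gt hz
  have hG := hφ.hasWeakGrad
  have hτg : HasWeakGrad Ω τ (fun x => deriv f (φ x / u x) • weakGrad Ω φ x +
      (f (φ x / u x) - φ x / u x * deriv f (φ x / u x)) • weakGrad Ω u x) := by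
    refine HasWeakGrad.comp₂ h.isOpen hG h.hasWeakGrad hc.1.continuousOn h.continuousOn hU
      (Φ := fun z : ℝ × ℝ => z.2 * f (z.1 / z.2)) (Φ₁ := fun z => deriv f (z.1 / z.2))
      (Φ₂ := fun z => f (z.1 / z.2) - z.1 / z.2 * deriv f (z.1 / z.2)) ?_ ?_ ?_
      (fun x hx => h.pos x hx)
    · exact hf'c.comp_continuousOn hq
    · exact (hfC.continuous.comp_continuousOn hq).sub (hq.mul (hf'c.comp_continuousOn hq))
    · intro z hz
      have hz0 : z.2 ≠ 0 := ne_of_gt hz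
      have h1 : HasFDerivAt (fun z : ℝ × ℝ => z.1) (ContinuousLinearMap.fst ℝ ℝ ℝ) z :=
        hasFDerivAt_fst
      have h2 : HasFDerivAt (fun z : ℝ × ℝ => z.2) (ContinuousLinearMap.snd ℝ ℝ ℝ) z :=
        hasFDerivAt_snd
      have h3 := h1.mul ((hasDerivAt_inv hz0).comp_hasFDerivAt z h2)
      have h4 := ((hfC.differentiable one_ne_zero (z.1 / z.2)).hasDerivAt).comp_hasFDerivAt z h3
      refine (h2.mul h4).congr_fderiv ?_
      ext
      · simp
        field_simp
      · simp
        field_simp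
        ring
  have hτz : ∀ x ∉ tsupport φ, τ x = 0 := fun x hx => by
    simp only [hτ, image_eq_zero_of_notMem_tsupport hx, zero_div]
    rw [hf, trunc_eq_zero hk ht (by simpa using ht.le), mul_zero]
  have hτc : IsCc Ω τ := isCc_of_continuousOn h.isOpen
    (h.continuousOn.mul (hfC.continuous.comp hψ.1).continuousOn) hc.2.1 hc.2.2 hτz
  have hτs : tsupport τ ⊆ Ω := hτc.2.2
  have hτm : MemW1p p Ω τ := by
    refine hτg.memW1p_of_isCc h.isOpen hτc (MemLp.add ?_ ?_)
    · exact memLp_continuousOn_smul hτc.2.1 (hf'c.comp hψ.1).continuousOn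
        ((hφ.memLp_weakGrad h.isOpen).mono_measure (Measure.restrict_mono hτs le_rfl))
    · exact memLp_continuousOn_smul hτc.2.1
        ((hfC.continuous.comp hψ.1).sub (hψ.1.mul (hf'c.comp hψ.1))).continuousOn
        (h.memLp_weakGrad hτc.2.1 hτs)
  refine ⟨hτm, hτc, ?_⟩
  filter_upwards [hτg.weakGrad_ae_eq h.isOpen, ae_restrict_mem h.isOpen.measurableSet] with x hx hxΩ
  have hu0 : u x ≠ 0 := (h.pos x hxΩ).ne'
  -- The base point of the new density is f(ψ)∇u, and subtracting it from ∇τ leaves f'(ψ)(∇φ - ψ∇u).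
  have e : τ x / u x = f (φ x / u x) := by rw [hτ]; field_simp
  rw [density, e, hx]
  congr 1
  module

theorem IsPosSol.capacity_le (h : IsPosSol p s Ω a V u) {φ : Eu n → ℝ} (hφ : MemW1p p Ω φ)
    (hc : IsCc Ω φ) {K : Set (Eu n)} (hK : ∀ x ∈ K, u x ≤ φ x) :
    capacity p s Ω a V u K ≤ energy p s Ω a V φ := by
  refine csInf_le ⟨0, ?_⟩ ⟨φ, hφ, hc, hK, rfl⟩
  rintro e ⟨φ', hφ', hc', _, rfl⟩
  exact h.energy_nonneg hφ' hc'

theorem IsPosSol.ofReal_energy (h : IsPosSol p s Ω a V u) {φ : Eu n → ℝ} (hφ : MemW1p p Ω φ)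
    (hc : IsCc Ω φ) :
    ENNReal.ofReal (energy p s Ω a V φ) = ∫⁻ x in Ω, ENNReal.ofReal (density p s Ω a u φ x) := by
  rw [(h.energy_eq hφ hc).2, ofReal_integral_eq_lintegral_ofReal (h.energy_eq hφ hc).1]
  filter_upwards [ae_restrict_mem h.isOpen.measurableSet] with x hx using h.density_nonneg φ hx

theorem IsPosSol.integrableOn_mul_rpow (h : IsPosSol p s Ω a V u) {g : Eu n → ℝ}
    (hg : LocallyIntegrableOn g Ω) {K : Set (Eu n)} (hK : IsCompact K) (hKΩ : K ⊆ Ω) :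
    IntegrableOn (fun x => |g x| * |u x| ^ p) K := by
  have hp := h.one_lt_p
  exact IntegrableOn.mul_continuousOn (hg.integrableOn_compact_subset hKΩ hK).norm
    ((h.continuousOn.mono hKΩ).abs.rpow_const fun x _ => Or.inr (by linarith)) hK

end Mazya

/-- Maz'ya's truncation argument: a capacitary inequality implies a Hardy inequality, with a constant
that depends on `p` and `s` only. -/
theorem exists_hardy_of_capacity {p s : ℝ} (hp : 1 < p) (hs : 1 < s) :
    ∃ C : ℝ, 0 < C ∧ ∀ (n : ℕ) (Ω : Set (Eu n)) (a : Eu n → Fin n → ℝ) (V u : Eu n → ℝ),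
      IsPosSol p s Ω a V u → ∀ g : Eu n → ℝ, LocallyIntegrableOn g Ω → ∀ L : ℝ≥0,
      (∀ K : Set (Eu n), IsCompact K → K ⊆ Ω →
        ∫ x in K, |g x| * |u x| ^ p ≤ L * capacity p s Ω a V u K) →
      ∀ φ : Eu n → ℝ, MemW1p p Ω φ → IsCc Ω φ →
        ∫⁻ x in Ω, ENNReal.ofReal (|g x| * |φ x| ^ p) ≤
          ENNReal.ofReal C * L * ENNReal.ofReal (energy p s Ω a V φ) := by
  obtain ⟨k, C, hk, hC, htr⟩ := exists_bregman_trunc_le hp hs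
  refine ⟨4 ^ p * C, by positivity, fun n Ω a V u h g hg L hL φ hφ hc => ?_⟩
  have hψ := h.isCc_div hc
  set ψ : Eu n → ℝ := fun x => φ x / u x with hψdef
  -- The dyadic annuli of |φ/u|. The truncation depends on r², so both signs of φ are treated at
  -- once.
  set A : ℤ → Set (Eu n) := fun j => {x | (2 : ℝ) ^ j ≤ |ψ x| ∧ |ψ x| < (2 : ℝ) ^ (j + 1)} with hA
  have hAm : ∀ j, MeasurableSet (A j) := fun j =>
    (measurableSet_le measurable_const hψ.1.abs.measurable).inter
      (measurableSet_lt hψ.1.abs.measurable measurable_const)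
  have hAd : Pairwise (Function.onFun Disjoint A) := by
    intro i j hij
    refine Set.disjoint_left.2 fun x hi hj => hij ?_
    have h1 : (2 : ℝ) ^ i < (2 : ℝ) ^ (j + 1) := hi.1.trans_lt hj.2
    have h2 : (2 : ℝ) ^ j < (2 : ℝ) ^ (i + 1) := hj.1.trans_lt hi.2
    rw [zpow_lt_zpow_iff_right₀ one_lt_two] at h1 h2
    omega
  have hpow : ∀ j : ℤ, (0 : ℝ) < 2 ^ j := fun j => by positivity
  have hAsub : ∀ j, A j ⊆ tsupport φ := fun j x hx => by
    by_contra hcx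
    have h0 : ψ x = 0 := by simp only [hψdef, image_eq_zero_of_notMem_tsupport hcx, zero_div]
    have := hx.1
    rw [h0, abs_zero] at this
    exact absurd (hpow j) this.not_gt
  have hAΩ : ∀ j, A j ⊆ Ω := fun j => (hAsub j).trans hc.2.2
  have hp0 : p ≠ 0 := by linarith
  -- the energy of a truncation is controlled by the energy density on one dyadic level
  have htrunc : ∀ j : ℤ, ENNReal.ofReal (((2 : ℝ) ^ j) ^ p *
      energy p s Ω a V (fun x => u x * trunc k ((2 : ℝ) ^ j) (ψ x))) ≤
      ENNReal.ofReal C * ∫⁻ x in A j, ENNReal.ofReal (density p s Ω a u φ x) := by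
    intro j
    obtain ⟨m1, m2, m3⟩ := h.truncation hφ hc hk (hpow j)
    rw [ENNReal.ofReal_mul (by positivity), h.ofReal_energy m1 m2,
      ← lintegral_const_mul' _ _ ENNReal.ofReal_ne_top,
      ← lintegral_const_mul' _ _ ENNReal.ofReal_ne_top, ← lintegral_indicator (hAm j),
      ← lintegral_indicator h.isOpen.measurableSet]
    rw [ae_restrict_iff' h.isOpen.measurableSet] at m3
    refine lintegral_mono_ae ?_
    filter_upwards [m3] with x hx
    by_cases hxΩ : x ∈ Ω
    swap
    · rw [indicator_of_notMem hxΩ]; exact zero_le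
    rw [indicator_of_mem hxΩ, hx hxΩ, ← ENNReal.ofReal_mul (by positivity)]
    refine (ENNReal.ofReal_le_ofReal (htr n a x (h.isCoeff.2.1 x hxΩ) _ _ _ _ (hpow j))).trans ?_
    by_cases hxA : x ∈ A j
    · rw [indicator_of_mem hxA, if_pos ⟨hxA.1, by rw [← zpow_one_add₀ two_ne_zero, add_comm 1 j]; exact hxA.2⟩,
        ← ENNReal.ofReal_mul hC.le]
      rfl
    · rw [if_neg, ENNReal.ofReal_zero]
      · exact zero_le
      · rintro ⟨h1, h2⟩
        rw [← zpow_one_add₀ two_ne_zero, add_comm 1 j] at h2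
        exact hxA ⟨h1, h2⟩
  -- one dyadic level of the weighted integral
  have hlevel : ∀ j : ℤ, ∫⁻ x in A j, ENNReal.ofReal (|g x| * |φ x| ^ p) ≤
      ENNReal.ofReal (4 ^ p * C) * L *
        ∫⁻ x in A (j - 1), ENNReal.ofReal (density p s Ω a u φ x) := by
    intro j
    set K : Set (Eu n) := {x | (2 : ℝ) ^ j ≤ |ψ x|} with hKdef
    have hKs : K ⊆ tsupport φ := fun x hx => by
      by_contra hcx
      have h0 : ψ x = 0 := by simp only [hψdef, image_eq_zero_of_notMem_tsupport hcx, zero_div]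
      have hx' : (2 : ℝ) ^ j ≤ |ψ x| := hx
      rw [h0, abs_zero] at hx'
      exact absurd (hpow j) hx'.not_gt
    have hKc : IsCompact K := hc.2.1.of_isClosed_subset
      (isClosed_le continuous_const hψ.1.abs) hKs
    have hKΩ : K ⊆ Ω := hKs.trans hc.2.2
    obtain ⟨m1, m2, -⟩ := h.truncation hφ hc hk (hpow (j - 1))
    have h2j : 2 * (2 : ℝ) ^ (j - 1) = 2 ^ j := by
      rw [← zpow_one_add₀ two_ne_zero]; congr 1; ring
    -- The truncation at level t equals 1 from 2t on, so level 2^{j-1} gives a function equal to u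
    -- on {|ψ| ≥ 2^j}, admissible for the capacity of that set.
    have hcap : capacity p s Ω a V u K ≤
        energy p s Ω a V (fun x => u x * trunc k ((2 : ℝ) ^ (j - 1)) (ψ x)) :=
      h.capacity_le m1 m2 fun x hx => by
        rw [trunc_eq_one (hpow _) (by rw [h2j]; exact hx), mul_one]
    set E := energy p s Ω a V (fun x => u x * trunc k ((2 : ℝ) ^ (j - 1)) (ψ x)) with hE
    have hgi := h.integrableOn_mul_rpow hg hKc hKΩ
    -- The factor 4^p compares the upper bound 2^{j+1} of |ψ| on the annulus with the truncation
    -- level 2^{j-1}.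
    have h4 : ((2 : ℝ) ^ (j + 1)) ^ p = 4 ^ p * ((2 : ℝ) ^ (j - 1)) ^ p := by
      rw [← Real.mul_rpow (by norm_num) (by positivity)]
      congr 1
      rw [show (4 : ℝ) = 2 ^ (2 : ℤ) by norm_num, ← zpow_add₀ two_ne_zero]
      congr 1
      ring
    calc ∫⁻ x in A j, ENNReal.ofReal (|g x| * |φ x| ^ p)
        ≤ ∫⁻ x in A j, ENNReal.ofReal (((2 : ℝ) ^ (j + 1)) ^ p) *
            ENNReal.ofReal (|g x| * |u x| ^ p) := by
          refine setLIntegral_mono_ae' (hAm j) (ae_of_all _ fun x hx => ?_)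
          rw [← ENNReal.ofReal_mul (by positivity)]
          refine ENNReal.ofReal_le_ofReal ?_
          have hu := h.pos x (hAΩ j hx)
          have e : |φ x| = |ψ x| * |u x| := by
            rw [← abs_mul, hψdef]; field_simp
          have h1 : |ψ x| ^ p ≤ ((2 : ℝ) ^ (j + 1)) ^ p :=
            Real.rpow_le_rpow (abs_nonneg _) hx.2.le (by linarith)
          rw [e, Real.mul_rpow (abs_nonneg _) (abs_nonneg _)]
          calc _ = |ψ x| ^ p * (|g x| * |u x| ^ p) := by ring
            _ ≤ _ := mul_le_mul_of_nonneg_right h1 (by positivity)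
      _ ≤ ENNReal.ofReal (((2 : ℝ) ^ (j + 1)) ^ p) *
            ∫⁻ x in K, ENNReal.ofReal (|g x| * |u x| ^ p) := by
          rw [lintegral_const_mul' _ _ ENNReal.ofReal_ne_top]
          gcongr
          exact fun x hx => hx.1
      _ = ENNReal.ofReal (((2 : ℝ) ^ (j + 1)) ^ p) *
            ENNReal.ofReal (∫ x in K, |g x| * |u x| ^ p) := by
          rw [ofReal_integral_eq_lintegral_ofReal hgi (ae_of_all _ fun x => by positivity)]
      _ ≤ ENNReal.ofReal (((2 : ℝ) ^ (j + 1)) ^ p) * ENNReal.ofReal (L * E) := by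
          gcongr
          exact (hL K hKc hKΩ).trans (mul_le_mul_of_nonneg_left hcap L.2)
      _ = ENNReal.ofReal (4 ^ p) * L * ENNReal.ofReal (((2 : ℝ) ^ (j - 1)) ^ p * E) := by
          rw [h4, ENNReal.ofReal_mul (by positivity), ENNReal.ofReal_mul (q := E) L.coe_nonneg,
            ENNReal.ofReal_mul (q := E) (by positivity), ENNReal.ofReal_coe_nnreal]
          ring
      _ ≤ ENNReal.ofReal (4 ^ p) * L * (ENNReal.ofReal C *
            ∫⁻ x in A (j - 1), ENNReal.ofReal (density p s Ω a u φ x)) := by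
          gcongr
          exact htrunc (j - 1)
      _ = _ := by
          rw [ENNReal.ofReal_mul (by positivity)]
          ring
  have hcover : ∀ x ∈ Ω, x ∉ ⋃ j, A j → φ x = 0 := by
    intro x hxΩ hx
    by_contra hne
    have hψx : 0 < |ψ x| := abs_pos.2 (div_ne_zero hne (h.pos x hxΩ).ne')
    obtain ⟨j, hj⟩ := exists_mem_Ico_zpow hψx (one_lt_two (α := ℝ))
    exact hx (mem_iUnion.2 ⟨j, hj⟩)
  calc ∫⁻ x in Ω, ENNReal.ofReal (|g x| * |φ x| ^ p)
      ≤ ∫⁻ x in ⋃ j, A j, ENNReal.ofReal (|g x| * |φ x| ^ p) := by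
        rw [← lintegral_indicator h.isOpen.measurableSet,
          ← lintegral_indicator (MeasurableSet.iUnion hAm)]
        refine lintegral_mono fun x => ?_
        by_cases hxΩ : x ∈ Ω
        swap
        · rw [indicator_of_notMem hxΩ]; exact zero_le
        by_cases hx : x ∈ ⋃ j, A j
        · rw [indicator_of_mem hxΩ, indicator_of_mem hx]
        · rw [indicator_of_mem hxΩ, hcover x hxΩ hx]
          simp [Real.zero_rpow hp0]
    _ = ∑' j, ∫⁻ x in A j, ENNReal.ofReal (|g x| * |φ x| ^ p) := lintegral_iUnion hAm hAd _
    _ ≤ ∑' j : ℤ, ENNReal.ofReal (4 ^ p * C) * L *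
        ∫⁻ x in A (j - 1), ENNReal.ofReal (density p s Ω a u φ x) := ENNReal.tsum_le_tsum hlevel
    _ = ENNReal.ofReal (4 ^ p * C) * L *
        ∫⁻ x in ⋃ j, A j, ENNReal.ofReal (density p s Ω a u φ x) := by
        rw [ENNReal.tsum_mul_left, lintegral_iUnion hAm hAd]
        congr 1
        -- The shift from j to j - 1 costs nothing because the levels are indexed by all integers.
        exact (Equiv.subRight (1 : ℤ)).tsum_eq
          (fun j => ∫⁻ x in A j, ENNReal.ofReal (density p s Ω a u φ x))
    _ ≤ _ := by
        rw [h.ofReal_energy hφ hc]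
        gcongr
        exact iUnion_subset hAΩ


/-! ### The Hardy inequality for Sobolev functions -/

section Extension

open scoped Topology
open Filter

variable {n : ℕ} {p s : ℝ} {Ω K : Set (Eu n)} {a : Eu n → Fin n → ℝ} {V u g φ : Eu n → ℝ}

theorem toReal_eLpNorm_rpow {α : Type*} [MeasurableSpace α] {μ : Measure α} {f : α → ℝ}
    (hp : 0 < p) (hf : MemLp f (ENNReal.ofReal p) μ) (h0 : 0 ≤ᵐ[μ] f) :
    (eLpNorm f (ENNReal.ofReal p) μ).toReal ^ p = ∫ x, f x ^ p ∂μ := by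
  have hi : 0 ≤ ∫ x, f x ^ p ∂μ := integral_nonneg_of_ae (by
    filter_upwards [h0] with x hx using Real.rpow_nonneg hx p)
  have e : ∫ x, ‖f x‖ ^ p ∂μ = ∫ x, f x ^ p ∂μ := integral_congr_ae (by
    filter_upwards [h0] with x hx
    rw [Real.norm_of_nonneg hx])
  rw [hf.eLpNorm_eq_integral_rpow_norm (ENNReal.ofReal_pos.2 hp).ne' ENNReal.ofReal_ne_top,
    ENNReal.toReal_ofReal hp.le, e, ENNReal.toReal_ofReal (by positivity),
    Real.rpow_inv_rpow hi hp.ne']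

theorem abs_rpow_eq_zero_of_notMem (hp : 0 < p) (hφK : tsupport φ ⊆ K) {x : Eu n} (hx : x ∉ K) :
    |φ x| ^ p = 0 := by
  rw [image_eq_zero_of_notMem_tsupport fun h => hx (hφK h), abs_zero, Real.zero_rpow hp.ne']

theorem continuous_abs_rpow (hp : 0 ≤ p) (hφ : Continuous φ) : Continuous fun x => |φ x| ^ p :=
  (continuous_abs.comp hφ).rpow_const fun _ => Or.inr hp

theorem integrableOn_mul_abs_rpow (hp : 0 < p) (hg : LocallyIntegrableOn g Ω) (hK : IsCompact K)
    (hKΩ : K ⊆ Ω) (hφ : Continuous φ) : IntegrableOn (fun x => g x * |φ x| ^ p) K :=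
  (hg.integrableOn_compact_subset hKΩ hK).mul_continuousOn
    (continuous_abs_rpow hp.le hφ).continuousOn hK

theorem setIntegral_mul_abs_rpow (hp : 0 < p) (hK : MeasurableSet K) (hKΩ : K ⊆ Ω)
    (hφK : tsupport φ ⊆ K) : ∫ x in Ω, g x * |φ x| ^ p = ∫ x in K, g x * |φ x| ^ p :=
  setIntegral_of_ae_zero hK hKΩ (ae_of_all _ fun x hx => by
    rw [abs_rpow_eq_zero_of_notMem hp hφK hx, mul_zero])

theorem integrableOn_abs_mul_abs_rpow (hp : 0 < p) (hg : LocallyIntegrableOn g Ω)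
    (hc : IsCc Ω φ) : IntegrableOn (fun x => |g x| * |φ x| ^ p) Ω :=
  integrableOn_of_ae_zero hc.2.1.measurableSet
    (ae_of_all _ fun x hx => by rw [abs_rpow_eq_zero_of_notMem hp Subset.rfl hx, mul_zero])
    (integrableOn_mul_abs_rpow hp hg.norm hc.2.1 hc.2.2 hc.1)

theorem IsPosSol.energy_eq_add (h : IsPosSol p s Ω a V u) (hφ : MemW1p p Ω φ) (hc : IsCc Ω φ)
    (hK : IsCompact K) (hKΩ : K ⊆ Ω) (hφK : tsupport φ ⊆ K) :
    energy p s Ω a V φ =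
      (∫ x in K, saNorm s a x (weakGrad Ω φ x) ^ p) + ∫ x in K, V x * |φ x| ^ p := by
  have hp0 : 0 < p := by linarith [h.one_lt_p]
  have hGz := hφ.hasWeakGrad.ae_eq_zero h.isOpen hK.isClosed fun x hx =>
    image_eq_zero_of_notMem_tsupport fun h => hx (hφK h)
  rw [energy, setIntegral_of_ae_zero hK.measurableSet hKΩ, integral_add]
  · exact h.isCoeff.integrable_saNorm_rpow h.one_lt_p h.one_lt_s h.isOpen hK hKΩ
      ((hφ.memLp_weakGrad h.isOpen).mono_measure (Measure.restrict_mono hKΩ le_rfl))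
  · exact integrableOn_mul_abs_rpow hp0 h.locallyIntegrableOn hK hKΩ hc.1
  · filter_upwards [hGz] with x hx hxK
    rw [hx hxK, saNorm_zero h.one_lt_s, Real.zero_rpow hp0.ne',
      abs_rpow_eq_zero_of_notMem hp0 hφK hxK, mul_zero, add_zero]

theorem tendsto_setIntegral_mul_abs_rpow (hp : 0 < p) {w : Eu n → ℝ} (hw : IntegrableOn w K)
    (hK : IsCompact K) (hφ : Continuous φ) {F : ℕ → Eu n → ℝ} (hF : ∀ k, Continuous (F k))
    (hFφ : ∀ k x, |F k x - φ x| ≤ 1 / ((k : ℝ) + 1)) :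
    Tendsto (fun k => ∫ x in K, w x * |F k x| ^ p) atTop (𝓝 (∫ x in K, w x * |φ x| ^ p)) := by
  obtain ⟨M, hM⟩ := hK.exists_bound_of_continuousOn hφ.continuousOn
  refine tendsto_integral_of_dominated_convergence (fun x => ‖w x‖ * (|M| + 1) ^ p) ?_ ?_ ?_ ?_
  · exact fun k => hw.1.mul (continuous_abs_rpow hp.le (hF k)).aestronglyMeasurable
  · exact hw.norm.mul_const _
  · intro k
    filter_upwards [ae_restrict_mem hK.measurableSet] with x hx
    rw [norm_mul, Real.norm_of_nonneg (Real.rpow_nonneg (abs_nonneg (F k x)) p)]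
    refine mul_le_mul_of_nonneg_left (Real.rpow_le_rpow (abs_nonneg _) ?_ hp.le) (norm_nonneg _)
    have h1 : 1 / ((k : ℝ) + 1) ≤ 1 := by
      rw [div_le_one (by positivity)]
      linarith [(Nat.cast_nonneg k : (0 : ℝ) ≤ k)]
    have h2 := hM x hx
    rw [Real.norm_eq_abs] at h2
    calc |F k x| = |(F k x - φ x) + φ x| := by ring_nf
      _ ≤ |F k x - φ x| + |φ x| := abs_add_le _ _
      _ ≤ |M| + 1 := by linarith [hFφ k x, le_abs_self M]
  · refine ae_of_all _ fun x => Tendsto.const_mul _ ?_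
    have hlim : Tendsto (fun k => F k x) atTop (𝓝 (φ x)) := by
      rw [tendsto_iff_norm_sub_tendsto_zero]
      exact squeeze_zero (fun _ => norm_nonneg _) (fun k => hFφ k x)
        tendsto_one_div_add_atTop_nhds_zero_nat
    exact (hlim.abs).rpow_const (Or.inr hp.le)

/-- A Hardy inequality for test functions extends to `W^{1,p}(Ω) ∩ C_c(Ω)`. -/
theorem IsPosSol.hardy_of_forall_isTest (h : IsPosSol p s Ω a V u) (hg : LocallyIntegrableOn g Ω)
    {C : ℝ} (H : ∀ φ, IsTest Ω φ → C * ∫ x in Ω, |g x| * |φ x| ^ p ≤ energy p s Ω a V φ)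
    (hφ : MemW1p p Ω φ) (hc : IsCc Ω φ) :
    C * ∫ x in Ω, |g x| * |φ x| ^ p ≤ energy p s Ω a V φ := by
  have hp := h.one_lt_p
  have hs := h.one_lt_s
  have hp0 : 0 < p := by linarith
  set P := ENNReal.ofReal p with hP
  have hP1 : 1 ≤ P := one_le_ofReal hp
  set G := weakGrad Ω φ with hGdef
  have hGp : MemLp G P (volume.restrict Ω) := hφ.memLp_weakGrad h.isOpen
  obtain ⟨K, hK, hKΩ, hφK, happ⟩ := hφ.hasWeakGrad.exists_test_approx h.isOpen hc hP1
    ENNReal.ofReal_ne_top hGp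
  choose F hFt hFK hFφ hFG using fun k : ℕ => happ (1 / ((k : ℝ) + 1)) (by positivity)
  have hrest : volume.restrict K ≤ volume.restrict Ω := Measure.restrict_mono hKΩ le_rfl
  have hGK : MemLp G P (volume.restrict K) := hGp.mono_measure hrest
  obtain ⟨B, hB0, hB⟩ := h.isCoeff.exists_saNorm_le hs h.isOpen hK hKΩ
  have hN := h.isCoeff.memLp_saNorm hs h.isOpen hK hKΩ hGK
  have hpos : ∀ᵐ x ∂(volume.restrict K), ∀ i, 0 < a x i :=
    ae_mono hrest (ae_pos_of_isCoeff h.isOpen h.isCoeff)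
  have hnn : ∀ H : Eu n → Eu n, 0 ≤ᵐ[volume.restrict K] fun x => saNorm s a x (H x) := fun H => by
    filter_upwards [hpos] with x hx using saNorm_nonneg hx _
  set A : ℝ := (eLpNorm (fun x => saNorm s a x (G x)) P (volume.restrict K)).toReal with hA
  have hFW : ∀ k, MemW1p p Ω (F k) := fun k => (hFt k).memW1p h.isOpen
  -- Only an upper bound for the energy of the approximants is needed. Minkowski's inequality for
  -- the weighted norm bounds the Lᵖ norm of the gradient by A plus an error B/(k+1).
  have hgrad : ∀ k, ∫ x in K, saNorm s a x (weakGrad Ω (F k) x) ^ p ≤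
      (A + B * (1 / ((k : ℝ) + 1))) ^ p := by
    intro k
    set W := weakGrad Ω (F k) with hW
    have hWp : MemLp W P (volume.restrict K) :=
      ((hFW k).memLp_weakGrad h.isOpen).mono_measure hrest
    have hWe : W =ᵐ[volume.restrict Ω] gradient (F k) :=
      (hasWeakGrad_of_contDiff h.isOpen (hFt k).contDiff_one).weakGrad_ae_eq h.isOpen
    have hd : eLpNorm (fun x => W x - G x) P (volume.restrict K) ≤
        ENNReal.ofReal (1 / ((k : ℝ) + 1)) := by
      refine (eLpNorm_mono_measure _ hrest).trans ?_
      rw [eLpNorm_congr_ae (g := fun x => gradient (F k) x - G x)]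
      · exact hFG k
      · filter_upwards [hWe] with x hx
        rw [hx]
    have hNW := h.isCoeff.memLp_saNorm hs h.isOpen hK hKΩ hWp
    have hND := h.isCoeff.memLp_saNorm hs h.isOpen hK hKΩ (hWp.sub hGK)
    rw [← toReal_eLpNorm_rpow hp0 hNW (hnn W)]
    refine Real.rpow_le_rpow ENNReal.toReal_nonneg ?_ hp0.le
    have h1 : eLpNorm (fun x => saNorm s a x (W x)) P (volume.restrict K) ≤
        eLpNorm (fun x => saNorm s a x (G x)) P (volume.restrict K) +
          ENNReal.ofReal (B * (1 / ((k : ℝ) + 1))) := by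
      calc eLpNorm (fun x => saNorm s a x (W x)) P (volume.restrict K)
          ≤ eLpNorm ((fun x => saNorm s a x (G x)) + fun x => saNorm s a x ((W - G) x)) P
              (volume.restrict K) := by
            refine eLpNorm_mono_ae ?_
            filter_upwards [hpos] with x hx
            have e0 := saNorm_nonneg (s := s) hx (G x)
            have e1 := saNorm_nonneg (s := s) hx ((W - G) x)
            rw [Pi.add_apply, Real.norm_of_nonneg (saNorm_nonneg hx _),
              Real.norm_of_nonneg (by positivity)]
            have := saNorm_add_le hs hx (G x) ((W - G) x)
            rwa [Pi.sub_apply, add_sub_cancel] at this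
        _ ≤ eLpNorm (fun x => saNorm s a x (G x)) P (volume.restrict K) +
            eLpNorm (fun x => saNorm s a x ((W - G) x)) P (volume.restrict K) :=
            eLpNorm_add_le hN.1 hND.1 hP1
        _ ≤ _ := by
            gcongr
            rw [ENNReal.ofReal_mul hB0]
            refine (eLpNorm_le_mul_eLpNorm_of_ae_le_mul (g := fun x => W x - G x) (c := B) ?_ P).trans
              (mul_le_mul_right hd _)
            filter_upwards [hB, hpos] with x hx hx'
            rw [Real.norm_of_nonneg (saNorm_nonneg hx' _)]
            exact hx _
    calc _ ≤ (eLpNorm (fun x => saNorm s a x (G x)) P (volume.restrict K) +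
          ENNReal.ofReal (B * (1 / ((k : ℝ) + 1)))).toReal :=
          ENNReal.toReal_mono (ENNReal.add_ne_top.2 ⟨hN.2.ne, ENNReal.ofReal_ne_top⟩) h1
      _ = _ := by
          rw [ENNReal.toReal_add hN.2.ne ENNReal.ofReal_ne_top,
            ENNReal.toReal_ofReal (by positivity)]
  have hlimg := tendsto_setIntegral_mul_abs_rpow hp0
    (hg.norm.integrableOn_compact_subset hKΩ hK) hK hc.1 (fun k => (hFt k).isCc.1) hFφ
  have hlimV := tendsto_setIntegral_mul_abs_rpow hp0
    (h.locallyIntegrableOn.integrableOn_compact_subset hKΩ hK) hK hc.1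
    (fun k => (hFt k).isCc.1) hFφ
  have hlimA : Tendsto (fun k : ℕ => (A + B * (1 / ((k : ℝ) + 1))) ^ p) atTop (𝓝 (A ^ p)) := by
    have : Tendsto (fun k : ℕ => A + B * (1 / ((k : ℝ) + 1))) atTop (𝓝 (A + B * 0)) :=
      tendsto_const_nhds.add (tendsto_one_div_add_atTop_nhds_zero_nat.const_mul B)
    rw [mul_zero, add_zero] at this
    exact this.rpow_const (Or.inr hp0.le)
  rw [h.energy_eq_add hφ hc hK hKΩ hφK, ← toReal_eLpNorm_rpow hp0 hN (hnn G),
    setIntegral_mul_abs_rpow (g := fun x => |g x|) hp0 hK.measurableSet hKΩ hφK]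
  refine le_of_tendsto_of_tendsto' (hlimg.const_mul C) (hlimA.add hlimV) fun k => ?_
  have h1 := H (F k) (hFt k)
  rw [h.energy_eq_add (hFW k) (hFt k).isCc hK hKΩ (hFK k),
    setIntegral_mul_abs_rpow (g := fun x => |g x|) hp0 hK.measurableSet hKΩ (hFK k)] at h1
  exact h1.trans (add_le_add_left (hgrad k) _)

end Extension


/-! ### Comparison of the two norms -/

section Norms

open scoped Topology
open Filter

variable {n : ℕ} {p s : ℝ} {Ω K : Set (Eu n)} {a : Eu n → Fin n → ℝ} {V u g φ : Eu n → ℝ}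

theorem IsPosSol.capacity_nonneg (h : IsPosSol p s Ω a V u) (K : Set (Eu n)) :
    0 ≤ capacity p s Ω a V u K := by
  refine Real.sInf_nonneg ?_
  rintro e ⟨φ, hφ, hc, _, rfl⟩
  exact h.energy_nonneg hφ hc

/-- The function χu with a cutoff χ is admissible. Thus the infimum in the capacity is never over
the empty set, for which `sInf` would return 0. -/
theorem IsPosSol.exists_le_on_compact (h : IsPosSol p s Ω a V u) (hK : IsCompact K)
    (hKΩ : K ⊆ Ω) : ∃ φ, MemW1p p Ω φ ∧ IsCc Ω φ ∧ ∀ x ∈ K, u x ≤ φ x := by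
  obtain ⟨χ, hχ, _, hχ1⟩ := exists_test_eq_one h.isOpen hK hKΩ
  have hχc := hχ.isCc
  have hg : HasWeakGrad Ω (fun x => χ x * u x)
      (fun x => u x • gradient χ x + χ x • weakGrad Ω u x) := by
    refine HasWeakGrad.comp₂ h.isOpen (hasWeakGrad_of_contDiff h.isOpen hχ.contDiff_one)
      h.hasWeakGrad hχc.1.continuousOn h.continuousOn isOpen_univ
      (Φ := fun z => z.1 * z.2) (Φ₁ := fun z => z.2) (Φ₂ := fun z => z.1)
      continuousOn_snd continuousOn_fst ?_ fun _ _ => mem_univ _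
    intro z _
    have h1 : HasFDerivAt (fun z : ℝ × ℝ => z.1) (ContinuousLinearMap.fst ℝ ℝ ℝ) z :=
      hasFDerivAt_fst
    have h2 : HasFDerivAt (fun z : ℝ × ℝ => z.2) (ContinuousLinearMap.snd ℝ ℝ ℝ) z :=
      hasFDerivAt_snd
    exact (h1.mul h2).congr_fderiv (add_comm _ _)
  have hc : IsCc Ω (fun x => χ x * u x) :=
    isCc_of_continuousOn h.isOpen (hχc.1.continuousOn.mul h.continuousOn) hχc.2.1 hχc.2.2
      fun x hx => by rw [image_eq_zero_of_notMem_tsupport hx, zero_mul]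
  refine ⟨_, hg.memW1p_of_isCc h.isOpen hc (MemLp.add ?_ ?_), hc, fun x hx => ?_⟩
  · refine memLp_continuousOn_smul hc.2.1 (h.continuousOn.mono hc.2.2) ?_
    refine ((continuous_gradient hχ.contDiff_one).memLp_of_hasCompactSupport ?_).restrict _
    exact HasCompactSupport.intro hχc.2.1 fun x => gradient_eq_zero_of_notMem_tsupport
  · exact memLp_continuousOn_smul hc.2.1 hχc.1.continuousOn (h.memLp_weakGrad hc.2.1 hc.2.2)
  · have := (hχ1 x hx).self_of_nhds
    rw [this, Pi.one_apply, one_mul]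

/-- `∫_K |g| u^p ≤ L cap(K, u)` for all compact `K ⊆ Ω`. -/
def CapBound (p s : ℝ) (Ω : Set (Eu n)) (a : Eu n → Fin n → ℝ) (V u g : Eu n → ℝ) (L : ℝ≥0) :
    Prop :=
  ∀ K : Set (Eu n), IsCompact K → K ⊆ Ω →
    ∫ x in K, |g x| * |u x| ^ p ≤ L * capacity p s Ω a V u K

theorem CapBound.uNorm_le {L : ℝ≥0} (hL : CapBound p s Ω a V u g L) :
    uNorm p s Ω a V u g ≤ L :=
  iInf₂_le L hL

/-- The infimum in ‖g‖_u is attained: for positive capacity the condition on L is a closed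
half-line. For zero capacity L is irrelevant, and any finite admissible constant gives the claim. -/
theorem IsPosSol.capBound_of_uNorm_le (h : IsPosSol p s Ω a V u) {L : ℝ≥0}
    (hL : uNorm p s Ω a V u g ≤ L) : CapBound p s Ω a V u g L := by
  intro K hK hKΩ
  rcases (h.capacity_nonneg K).eq_or_lt with h0 | h0
  · have hlt : uNorm p s Ω a V u g < ∞ := hL.trans_lt ENNReal.coe_lt_top
    obtain ⟨M, hM⟩ := iInf_lt_iff.1 hlt
    obtain ⟨hM, -⟩ := iInf_lt_iff.1 hM
    have := hM K hK hKΩ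
    rw [← h0, mul_zero] at this ⊢
    exact this
  · rw [← div_le_iff₀ h0]
    have h1 : ENNReal.ofReal ((∫ x in K, |g x| * |u x| ^ p) / capacity p s Ω a V u K) ≤
        uNorm p s Ω a V u g := by
      refine le_iInf₂ fun M hM => ?_
      rw [ENNReal.ofReal_le_coe, div_le_iff₀ h0]
      exact hM K hK hKΩ
    have h2 := h1.trans hL
    rwa [ENNReal.ofReal_le_coe] at h2

theorem IsPosSol.uNorm_le_iff (h : IsPosSol p s Ω a V u) {L : ℝ≥0} :
    uNorm p s Ω a V u g ≤ L ↔ CapBound p s Ω a V u g L :=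
  ⟨h.capBound_of_uNorm_le, CapBound.uNorm_le⟩

theorem lintegral_mul_abs_rpow_eq (hp : 0 < p) (hg : LocallyIntegrableOn g Ω) (hc : IsCc Ω φ) :
    ∫⁻ x in Ω, ENNReal.ofReal (|g x| * |φ x| ^ p) =
      ENNReal.ofReal (∫ x in Ω, |g x| * |φ x| ^ p) :=
  (ofReal_integral_eq_lintegral_ofReal (integrableOn_abs_mul_abs_rpow hp hg hc)
    (ae_of_all _ fun x => by positivity)).symm

theorem IsPosSol.hNorm_lt_top (h : IsPosSol p s Ω a V u) (hg : IsHardyWeight p s Ω a V g) :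
    hNorm p s Ω a V g < ∞ := by
  have hp0 : 0 < p := by linarith [h.one_lt_p]
  obtain ⟨hgi, C, hC, H⟩ := hg
  rw [hNorm, ENNReal.inv_lt_top]
  refine (ENNReal.ofReal_pos.2 hC).trans_le (le_iInf fun φ => le_iInf fun hφ => le_iInf fun hc =>
    le_iInf fun hI => ?_)
  have e := lintegral_mul_abs_rpow_eq hp0 hgi hc
  rw [ENNReal.le_div_iff_mul_le (Or.inl hI.ne') (Or.inl (by rw [e]; exact ENNReal.ofReal_ne_top)),
    e, ← ENNReal.ofReal_mul hC.le]
  exact ENNReal.ofReal_le_ofReal (h.hardy_of_forall_isTest hgi H hφ hc)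

theorem lintegral_le_hNorm_mul_energy (hp : 0 < p) (hg : LocallyIntegrableOn g Ω)
    (hφ : MemW1p p Ω φ) (hc : IsCc Ω φ) (hfin : hNorm p s Ω a V g < ∞) :
    ∫⁻ x in Ω, ENNReal.ofReal (|g x| * |φ x| ^ p) ≤
      hNorm p s Ω a V g * ENNReal.ofReal (energy p s Ω a V φ) := by
  set I := ∫⁻ x in Ω, ENNReal.ofReal (|g x| * |φ x| ^ p) with hIdef
  have hItop : I ≠ ∞ := by
    rw [hIdef, lintegral_mul_abs_rpow_eq hp hg hc]; exact ENNReal.ofReal_ne_top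
  rcases eq_or_ne I 0 with h0 | h0
  · rw [h0]; exact zero_le
  have h1 : hardyConst p s Ω a V g ≤ ENNReal.ofReal (energy p s Ω a V φ) / I :=
    iInf₂_le_of_le φ hφ (iInf₂_le_of_le hc (pos_iff_ne_zero.2 h0) le_rfl)
  have h2 : I / ENNReal.ofReal (energy p s Ω a V φ) ≤ hNorm p s Ω a V g := by
    rw [hNorm, ← ENNReal.inv_div (Or.inl hItop) (Or.inl h0)]
    exact ENNReal.inv_le_inv.2 h1
  -- Zero energy with I > 0 would give I/0 = ∞, contradicting finiteness of ‖g‖_ℋ.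
  have hE : ENNReal.ofReal (energy p s Ω a V φ) ≠ 0 := fun hE => by
    rw [hE, ENNReal.div_zero h0] at h2
    exact absurd h2 (not_le.2 hfin)
  exact (ENNReal.div_le_iff_le_mul (Or.inl hE) (Or.inl ENNReal.ofReal_ne_top)).1 h2

/-- If φ ≥ u > 0 on K, then ∫_K |g|u^p ≤ ∫|g||φ|^p ≤ ‖g‖_ℋ Q[φ]. Taking the infimum over φ gives the
capacity. -/
theorem IsPosSol.uNorm_le_hNorm (h : IsPosSol p s Ω a V u) (hg : IsHardyWeight p s Ω a V g) :
    uNorm p s Ω a V u g ≤ hNorm p s Ω a V g := by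
  have hp0 : 0 < p := by linarith [h.one_lt_p]
  have hfin := h.hNorm_lt_top hg
  obtain ⟨L, hL⟩ : ∃ L : ℝ≥0, (L : ℝ≥0∞) = hNorm p s Ω a V g :=
    ⟨_, ENNReal.coe_toNNReal hfin.ne⟩
  rw [← hL, h.uNorm_le_iff]
  intro K hK hKΩ
  have key : ∀ φ, MemW1p p Ω φ → IsCc Ω φ → (∀ x ∈ K, u x ≤ φ x) →
      ∫ x in K, |g x| * |u x| ^ p ≤ L * energy p s Ω a V φ := by
    intro φ hφ hc hKφ
    have h1 := lintegral_le_hNorm_mul_energy (a := a) (V := V) (s := s) hp0 hg.1 hφ hc hfin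
    rw [lintegral_mul_abs_rpow_eq hp0 hg.1 hc, ← hL, ← ENNReal.ofReal_coe_nnreal,
      ← ENNReal.ofReal_mul L.coe_nonneg, ENNReal.ofReal_le_ofReal_iff
      (mul_nonneg L.coe_nonneg (h.energy_nonneg hφ hc))] at h1
    have hi := integrableOn_abs_mul_abs_rpow hp0 hg.1 hc
    calc ∫ x in K, |g x| * |u x| ^ p ≤ ∫ x in K, |g x| * |φ x| ^ p := by
          refine setIntegral_mono_on (h.integrableOn_mul_rpow hg.1 hK hKΩ) (hi.mono_set hKΩ)
            hK.measurableSet fun x hx => ?_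
          have hu := h.pos x (hKΩ hx)
          refine mul_le_mul_of_nonneg_left (Real.rpow_le_rpow (abs_nonneg _) ?_ hp0.le)
            (abs_nonneg _)
          exact abs_le_abs_of_nonneg hu.le (hKφ x hx)
      _ ≤ ∫ x in Ω, |g x| * |φ x| ^ p :=
          setIntegral_mono_set hi (ae_of_all _ fun x => by positivity) hKΩ.eventuallyLE
      _ ≤ _ := h1
  obtain ⟨φ₀, hφ₀, hc₀, hK₀⟩ := h.exists_le_on_compact hK hKΩ
  -- The infimum is taken after division by L. For L = 0 a single admissible function already gives
  -- the bound 0.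
  rcases eq_or_ne L 0 with hL0 | hL0
  · have := key φ₀ hφ₀ hc₀ hK₀
    rw [hL0, NNReal.coe_zero, zero_mul] at this ⊢
    exact this
  · have hLpos : (0 : ℝ) < L := NNReal.coe_pos.2 (pos_iff_ne_zero.2 hL0)
    rw [← div_le_iff₀' hLpos]
    refine le_csInf ⟨_, φ₀, hφ₀, hc₀, hK₀, rfl⟩ ?_
    rintro e ⟨φ, hφ, hc, hKφ, rfl⟩
    rw [div_le_iff₀' hLpos]
    exact key φ hφ hc hKφ

theorem hNorm_le_of_forall_lintegral_le (hp : 0 < p) (hg : LocallyIntegrableOn g Ω) {M : ℝ≥0∞}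
    (hM : ∀ φ, MemW1p p Ω φ → IsCc Ω φ → ∫⁻ x in Ω, ENNReal.ofReal (|g x| * |φ x| ^ p) ≤
      M * ENNReal.ofReal (energy p s Ω a V φ)) : hNorm p s Ω a V g ≤ M := by
  rw [hNorm, ENNReal.inv_le_iff_inv_le]
  refine le_iInf fun φ => le_iInf fun hφ => le_iInf fun hc => le_iInf fun hI => ?_
  have h1 := hM φ hφ hc
  have hItop : ∫⁻ x in Ω, ENNReal.ofReal (|g x| * |φ x| ^ p) ≠ ∞ := by
    rw [lintegral_mul_abs_rpow_eq hp hg hc]; exact ENNReal.ofReal_ne_top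
  rw [ENNReal.le_div_iff_mul_le (Or.inl hI.ne') (Or.inl hItop)]
  rcases eq_or_ne M ∞ with hMt | hMt
  · simp [hMt]
  rcases eq_or_ne M 0 with hM0 | hM0
  · rw [hM0, zero_mul] at h1
    exact absurd hI (not_lt.2 h1)
  calc _ ≤ M⁻¹ * (M * ENNReal.ofReal (energy p s Ω a V φ)) := by gcongr
    _ = _ := by rw [← mul_assoc, ENNReal.inv_mul_cancel hM0 hMt, one_mul]

theorem IsPosSol.isHardyWeight_of_forall_lintegral_le (h : IsPosSol p s Ω a V u)
    (hg : LocallyIntegrableOn g Ω) {M : ℝ} (hM0 : 0 ≤ M)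
    (hM : ∀ φ, MemW1p p Ω φ → IsCc Ω φ → ∫⁻ x in Ω, ENNReal.ofReal (|g x| * |φ x| ^ p) ≤
      ENNReal.ofReal M * ENNReal.ofReal (energy p s Ω a V φ)) : IsHardyWeight p s Ω a V g := by
  have hp0 : 0 < p := by linarith [h.one_lt_p]
  -- M may be 0, so the Hardy constant is taken as 1/(M+1) instead of 1/M.
  refine ⟨hg, 1 / (M + 1), by positivity, fun φ hφ => ?_⟩
  have hc := hφ.isCc
  have hE := h.energy_nonneg (hφ.memW1p h.isOpen) hc
  have h1 := hM φ (hφ.memW1p h.isOpen) hc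
  rw [lintegral_mul_abs_rpow_eq hp0 hg hc, ← ENNReal.ofReal_mul hM0,
    ENNReal.ofReal_le_ofReal_iff (mul_nonneg hM0 hE)] at h1
  rw [one_div, inv_mul_le_iff₀ (by positivity)]
  nlinarith

/-- The capacitary characterization of Hardy-weights and the comparison of the norms. -/
theorem exists_hNorm_le_uNorm (hp : 1 < p) (hs : 1 < s) :
    ∃ C : ℝ, 0 < C ∧ ∀ (n : ℕ) (Ω : Set (Eu n)) (a : Eu n → Fin n → ℝ) (V u : Eu n → ℝ),
      IsPosSol p s Ω a V u → ∀ g : Eu n → ℝ, LocallyIntegrableOn g Ω →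
        (IsHardyWeight p s Ω a V g ↔ uNorm p s Ω a V u g < ∞) ∧
        (uNorm p s Ω a V u g < ∞ →
          hNorm p s Ω a V g ≤ ENNReal.ofReal C * uNorm p s Ω a V u g) := by
  have hp0 : 0 < p := by linarith
  obtain ⟨C, hC, H⟩ := exists_hardy_of_capacity hp hs
  refine ⟨C, hC, fun n Ω a V u h g hg => ⟨⟨fun hw => ?_, fun hlt => ?_⟩, fun hlt => ?_⟩⟩
  · exact (h.uNorm_le_hNorm hw).trans_lt (h.hNorm_lt_top hw)
  · obtain ⟨L, hL⟩ : ∃ L : ℝ≥0, (L : ℝ≥0∞) = uNorm p s Ω a V u g :=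
      ⟨_, ENNReal.coe_toNNReal hlt.ne⟩
    refine h.isHardyWeight_of_forall_lintegral_le hg (M := C * L) (by positivity) ?_
    rw [ENNReal.ofReal_mul hC.le, ENNReal.ofReal_coe_nnreal]
    exact H n Ω a V u h g hg L (h.capBound_of_uNorm_le hL.ge)
  · obtain ⟨L, hL⟩ : ∃ L : ℝ≥0, (L : ℝ≥0∞) = uNorm p s Ω a V u g :=
      ⟨_, ENNReal.coe_toNNReal hlt.ne⟩
    rw [← hL]
    exact hNorm_le_of_forall_lintegral_le hp0 hg
      (H n Ω a V u h g hg L (h.capBound_of_uNorm_le hL.ge))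

end Norms


/-! ### The Banach space of Hardy-weights -/

section Banach

open scoped Topology
open Filter

/-- Completeness only has to be tested on sequences whose tails are controlled geometrically, which
is the form suited to almost everywhere convergence. -/
theorem isBanachNorm_of_core {X : Type*} [AddCommGroup X] [Module ℝ X] {N : X → ℝ}
    (core : @NormedSpace.Core ℝ X _ _ _ ⟨N⟩)
    (H : ∀ f : ℕ → X, (∀ k l m, k ≤ l → k ≤ m → N (f l - f m) ≤ (1 / 2) ^ k) →
      ∃ x, ∀ k, N (f k - x) ≤ (1 / 2) ^ k) : IsBanachNorm X N := by
  refine ⟨core, ?_⟩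
  let _ : NormedAddCommGroup X := @NormedAddCommGroup.ofCore ℝ X _ _ _ ⟨N⟩ core
  have hd : ∀ x y : X, dist x y = N (x - y) := fun x y => dist_eq_norm x y
  refine Metric.complete_of_convergent_controlled_sequences (fun k => (1 / 2 : ℝ) ^ k)
    (fun k => by positivity) fun f hf => ?_
  obtain ⟨x, hx⟩ := H f fun k l m hl hm => by
    rw [← hd]; exact (hf k l m hl hm).le
  refine ⟨x, tendsto_iff_dist_tendsto_zero.2 ?_⟩
  refine squeeze_zero (fun _ => dist_nonneg) (fun k => ?_)
    (tendsto_pow_atTop_nhds_zero_of_lt_one (r := (1 / 2 : ℝ)) (by norm_num) (by norm_num))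
  rw [hd]
  exact hx k

variable {n : ℕ} {p s : ℝ} {Ω K : Set (Eu n)} {a : Eu n → Fin n → ℝ} {V u g g' : Eu n → ℝ}
  {L L' : ℝ≥0}

theorem ae_restrict_of_forall_isCompact (hΩ : IsOpen Ω) {P : Eu n → Prop}
    (h : ∀ K, IsCompact K → K ⊆ Ω → ∀ᵐ x ∂(volume.restrict K), P x) :
    ∀ᵐ x ∂(volume.restrict Ω), P x := by
  have : LocallyCompactSpace Ω := hΩ.isLocallyClosed.locallyCompactSpace
  obtain ⟨K, hK, hKu⟩ := isSigmaCompact_iff_sigmaCompactSpace.2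
    (inferInstance : SigmaCompactSpace Ω)
  rw [← hKu, ae_restrict_iUnion_iff]
  exact fun i => h _ (hK i) (hKu ▸ subset_iUnion K i)

theorem locallyIntegrableOn_of_ae_eq (hΩ : IsOpen Ω) (hg : LocallyIntegrableOn g Ω)
    (e : g =ᵐ[volume.restrict Ω] g') : LocallyIntegrableOn g' Ω := by
  rw [locallyIntegrableOn_iff hΩ.isLocallyClosed] at hg ⊢
  exact fun K hKΩ hK => (hg K hKΩ hK).congr (ae_mono (Measure.restrict_mono hKΩ le_rfl) e)

theorem CapBound.congr (hL : CapBound p s Ω a V u g L) (e : g =ᵐ[volume.restrict Ω] g') :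
    CapBound p s Ω a V u g' L := fun K hK hKΩ => by
  rw [← integral_congr_ae (f := fun x => |g x| * |u x| ^ p)]
  · exact hL K hK hKΩ
  · filter_upwards [ae_mono (Measure.restrict_mono hKΩ le_rfl) e] with x hx
    rw [hx]

theorem IsPosSol.capBound_zero (h : IsPosSol p s Ω a V u) :
    CapBound p s Ω a V u 0 L := fun K _ _ => by
  simpa using mul_nonneg L.coe_nonneg (h.capacity_nonneg K)

theorem IsPosSol.capBound_add (h : IsPosSol p s Ω a V u) (hg : LocallyIntegrableOn g Ω)
    (hg' : LocallyIntegrableOn g' Ω) (hL : CapBound p s Ω a V u g L)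
    (hL' : CapBound p s Ω a V u g' L') : CapBound p s Ω a V u (g + g') (L + L') := by
  intro K hK hKΩ
  have i := h.integrableOn_mul_rpow hg hK hKΩ
  have i' := h.integrableOn_mul_rpow hg' hK hKΩ
  calc ∫ x in K, |(g + g') x| * |u x| ^ p
      ≤ ∫ x in K, (|g x| * |u x| ^ p + |g' x| * |u x| ^ p) := by
        refine integral_mono (h.integrableOn_mul_rpow (hg.add hg') hK hKΩ) (i.add i') fun x => ?_
        beta_reduce
        rw [← add_mul]
        exact mul_le_mul_of_nonneg_right (abs_add_le _ _) (by positivity)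
    _ = _ := integral_add i i'
    _ ≤ _ := add_le_add (hL K hK hKΩ) (hL' K hK hKΩ)
    _ = _ := by rw [NNReal.coe_add, add_mul]

theorem CapBound.smul (hL : CapBound p s Ω a V u g L) (c : ℝ) :
    CapBound p s Ω a V u (c • g) (‖c‖₊ * L) := by
  intro K hK hKΩ
  have e : ∀ x, |(c • g) x| * |u x| ^ p = |c| * (|g x| * |u x| ^ p) := fun x => by
    rw [Pi.smul_apply, smul_eq_mul, abs_mul, mul_assoc]
  simp_rw [e, integral_const_mul]
  rw [NNReal.coe_mul, coe_nnnorm, Real.norm_eq_abs, mul_assoc]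
  exact mul_le_mul_of_nonneg_left (hL K hK hKΩ) (abs_nonneg c)

/-- With L = 0 the integral of |g|u^p vanishes on every compact set; u is positive and Ω is a
countable union of compact sets. -/
theorem IsPosSol.ae_eq_zero_of_capBound_zero (h : IsPosSol p s Ω a V u)
    (hg : LocallyIntegrableOn g Ω) (h0 : CapBound p s Ω a V u g 0) :
    g =ᵐ[volume.restrict Ω] 0 := by
  refine ae_restrict_of_forall_isCompact h.isOpen fun K hK hKΩ => ?_
  have i := h.integrableOn_mul_rpow hg hK hKΩ
  have h1 : ∫ x in K, |g x| * |u x| ^ p = 0 := le_antisymm (by simpa using h0 K hK hKΩ)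
    (integral_nonneg fun x => by positivity)
  rw [integral_eq_zero_iff_of_nonneg (fun x => by positivity) i] at h1
  filter_upwards [h1, ae_restrict_mem hK.measurableSet] with x hx hxK
  have hu : |u x| ^ p ≠ 0 := (Real.rpow_pos_of_pos (abs_pos.2 (h.pos x (hKΩ hxK)).ne') p).ne'
  rcases mul_eq_zero.1 hx with hx | hx
  · exact abs_eq_zero.1 hx
  · exact absurd hx hu

theorem IsPosSol.continuousOn_abs_rpow (h : IsPosSol p s Ω a V u) (r : ℝ) :
    ContinuousOn (fun x => |u x| ^ r) Ω :=
  h.continuousOn.abs.rpow_const fun x hx => Or.inl (abs_pos.2 (h.pos x hx).ne').ne'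

theorem IsPosSol.eLpNorm_sub_le (h : IsPosSol p s Ω a V u) (hg : LocallyIntegrableOn g Ω)
    (hg' : LocallyIntegrableOn g' Ω) (hL : CapBound p s Ω a V u (g - g') L) (hK : IsCompact K)
    (hKΩ : K ⊆ Ω) :
    eLpNorm ((fun x => g x * |u x| ^ p) - fun x => g' x * |u x| ^ p) 1 (volume.restrict K) ≤
      ENNReal.ofReal (L * capacity p s Ω a V u K) := by
  have i := h.integrableOn_mul_rpow (hg.sub hg') hK hKΩ
  refine le_trans (le_of_eq ?_) (ENNReal.ofReal_le_ofReal (hL K hK hKΩ))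
  rw [eLpNorm_one_eq_lintegral_enorm,
    ofReal_integral_eq_lintegral_ofReal i (ae_of_all _ fun x => by positivity)]
  refine lintegral_congr fun x => ?_
  rw [← ofReal_norm, Pi.sub_apply, Pi.sub_apply, ← sub_mul, norm_mul, Real.norm_eq_abs,
    Real.norm_of_nonneg (by positivity : 0 ≤ |u x| ^ p)]

/-- Local integrability of g is recovered from that of g u^p by multiplying with u^{-p}, which is
continuous and hence bounded on compact subsets of Ω. -/
theorem IsPosSol.capBound_of_eLpNorm_le (h : IsPosSol p s Ω a V u)
    (hL : ∀ K, IsCompact K → K ⊆ Ω →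
      AEStronglyMeasurable (fun x => g x * |u x| ^ p) (volume.restrict K) ∧
      eLpNorm (fun x => g x * |u x| ^ p) 1 (volume.restrict K) ≤
        ENNReal.ofReal (L * capacity p s Ω a V u K)) :
    LocallyIntegrableOn g Ω ∧ CapBound p s Ω a V u g L := by
  have hi : ∀ K, IsCompact K → K ⊆ Ω → IntegrableOn (fun x => g x * |u x| ^ p) K :=
    fun K hK hKΩ => memLp_one_iff_integrable.1
      ⟨(hL K hK hKΩ).1, (hL K hK hKΩ).2.trans_lt ENNReal.ofReal_lt_top⟩
  refine ⟨(locallyIntegrableOn_iff h.isOpen.isLocallyClosed).2 fun K hKΩ hK => ?_,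
    fun K hK hKΩ => ?_⟩
  · refine Integrable.congr ((hi K hK hKΩ).mul_continuousOn
      ((h.continuousOn_abs_rpow (-p)).mono hKΩ) hK) ?_
    filter_upwards [ae_restrict_mem hK.measurableSet] with x hx
    have hu := abs_pos.2 (h.pos x (hKΩ hx)).ne'
    rw [mul_assoc, ← Real.rpow_add hu, add_neg_cancel, Real.rpow_zero, mul_one]
  · have h1 := (hL K hK hKΩ).2
    rw [eLpNorm_one_eq_lintegral_enorm] at h1
    have e : ∫⁻ x in K, ‖g x * |u x| ^ p‖ₑ =
        ENNReal.ofReal (∫ x in K, |g x| * |u x| ^ p) := by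
      rw [show (fun x => |g x| * |u x| ^ p) = fun x => ‖g x * |u x| ^ p‖ from funext fun x => by
        rw [norm_mul, Real.norm_eq_abs, Real.norm_of_nonneg (by positivity : 0 ≤ |u x| ^ p)],
        ofReal_integral_norm_eq_lintegral_enorm (hi K hK hKΩ)]
    rw [e] at h1
    exact (ENNReal.ofReal_le_ofReal_iff
      (mul_nonneg L.coe_nonneg (h.capacity_nonneg K))).1 h1

/-- On each compact K the capacity is a finite constant, so f_k u^p is Cauchy in L¹(K) at a
geometric rate and converges almost everywhere. Lower semicontinuity of the L¹ norm preserves the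
capacitary bounds with the same constants. -/
theorem IsPosSol.exists_limit (h : IsPosSol p s Ω a V u) {f : ℕ → Eu n → ℝ}
    (hf : ∀ k, LocallyIntegrableOn (f k) Ω)
    (hc : ∀ k l m, k ≤ l → k ≤ m → CapBound p s Ω a V u (f l - f m) ((1 / 2) ^ k)) :
    ∃ g, AEStronglyMeasurable g (volume.restrict Ω) ∧ LocallyIntegrableOn g Ω ∧
      ∀ k, CapBound p s Ω a V u (f k - g) ((1 / 2) ^ k) := by
  set F : ℕ → Eu n → ℝ := fun k x => f k x * |u x| ^ p with hF
  have hFm : ∀ k, AEStronglyMeasurable (F k) (volume.restrict Ω) := fun k =>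
    (hf k).aestronglyMeasurable.mul
      ((h.continuousOn_abs_rpow p).aestronglyMeasurable h.isOpen.measurableSet)
  have hFmK : ∀ k {K : Set (Eu n)}, K ⊆ Ω → AEStronglyMeasurable (F k) (volume.restrict K) :=
    fun k K hKΩ => (hFm k).mono_measure (Measure.restrict_mono hKΩ le_rfl)
  have hcau : ∀ K, IsCompact K → K ⊆ Ω → ∀ k l m, k ≤ l → k ≤ m →
      eLpNorm (F l - F m) 1 (volume.restrict K) ≤
        ENNReal.ofReal (((1 / 2 : ℝ≥0) ^ k : ℝ≥0) * capacity p s Ω a V u K) :=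
    fun K hK hKΩ k l m hl hm => h.eLpNorm_sub_le (hf l) (hf m) (hc k l m hl hm) hK hKΩ
  have hlim : ∀ᵐ x ∂(volume.restrict Ω), ∃ l, Tendsto (fun k => F k x) atTop (𝓝 l) := by
    refine ae_restrict_of_forall_isCompact h.isOpen fun K hK hKΩ => ?_
    have hcap := h.capacity_nonneg K
    refine Lp.ae_tendsto_of_cauchy_eLpNorm (p := 1)
      -- The added 1 makes the Cauchy estimate strict, also when the capacity of K is zero.
      (B := fun k => ENNReal.ofReal ((1 / 2 : ℝ) ^ k * (capacity p s Ω a V u K + 1)))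
      (fun k => hFmK k hKΩ) le_rfl ?_ fun k l m hl hm => ?_
    · exact ((summable_geometric_of_lt_one (by norm_num) (by norm_num)).mul_right _).tsum_ofReal_ne_top
    · refine (hcau K hK hKΩ k l m hl hm).trans_lt ((ENNReal.ofReal_lt_ofReal_iff
        (by positivity)).2 ?_)
      push_cast
      have : (0 : ℝ) < (1 / 2) ^ k := by positivity
      nlinarith
  obtain ⟨G, hG, hGl⟩ := exists_stronglyMeasurable_limit_of_tendsto_ae hFm hlim
  set g : Eu n → ℝ := fun x => G x * |u x| ^ (-p) with hg
  have hgm : AEStronglyMeasurable g (volume.restrict Ω) := hG.aestronglyMeasurable.mul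
    ((h.continuousOn_abs_rpow (-p)).aestronglyMeasurable h.isOpen.measurableSet)
  have key : ∀ k, LocallyIntegrableOn (f k - g) Ω ∧
      CapBound p s Ω a V u (f k - g) ((1 / 2) ^ k) := by
    intro k
    refine h.capBound_of_eLpNorm_le fun K hK hKΩ => ?_
    have e : (fun x => (f k - g) x * |u x| ^ p) =ᵐ[volume.restrict K] F k - G := by
      filter_upwards [ae_restrict_mem hK.measurableSet] with x hx
      have hu := abs_pos.2 (h.pos x (hKΩ hx)).ne'
      rw [Pi.sub_apply, Pi.sub_apply, sub_mul, hg]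
      beta_reduce
      rw [mul_assoc, ← Real.rpow_add hu, neg_add_cancel, Real.rpow_zero, mul_one]
    refine ⟨((hFmK k hKΩ).sub hG.aestronglyMeasurable).congr e.symm, ?_⟩
    rw [eLpNorm_congr_ae e]
    have h1 := Lp.eLpNorm_lim_le_liminf_eLpNorm (p := 1) (μ := volume.restrict K)
      (f := fun m => F k - F m) (fun m => (hFmK k hKΩ).sub (hFmK m hKΩ)) (F k - G) (by
        filter_upwards [ae_mono (Measure.restrict_mono hKΩ le_rfl) hGl] with x hx
        exact tendsto_const_nhds.sub hx)
    -- The bound holds for all m ≥ k, so an eventual lower bound is tested at an index beyond both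
    -- its threshold and k.
    refine h1.trans (liminf_le_of_le (by isBoundedDefault) fun b hb => ?_)
    obtain ⟨M, hM⟩ := eventually_atTop.1 hb
    exact (hM (max M k) (le_max_left _ _)).trans
      (hcau K hK hKΩ k k (max M k) le_rfl (le_max_right _ _))
  refine ⟨g, hgm, ?_, fun k => (key k).2⟩
  have := (hf 0).sub (key 0).1
  rwa [sub_sub_cancel] at this

/-- The capacitary description reduces the vector space operations to pointwise inequalities for |g|
integrated over compact sets. -/
theorem IsPosSol.isHardyWeight_iff (h : IsPosSol p s Ω a V u) :
    IsHardyWeight p s Ω a V g ↔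
      LocallyIntegrableOn g Ω ∧ ∃ L, CapBound p s Ω a V u g L := by
  obtain ⟨C, _, H⟩ := exists_hNorm_le_uNorm h.one_lt_p h.one_lt_s
  refine ⟨fun hg => ⟨hg.1, ?_⟩, fun ⟨hg, L, hL⟩ => ?_⟩
  · have hlt := (H n Ω a V u h g hg.1).1.1 hg
    exact ⟨_, h.capBound_of_uNorm_le (ENNReal.coe_toNNReal hlt.ne).ge⟩
  · exact (H n Ω a V u h g hg).1.2 (hL.uNorm_le.trans_lt ENNReal.coe_lt_top)

theorem IsPosSol.isHardyWeight_congr (h : IsPosSol p s Ω a V u) (hg : IsHardyWeight p s Ω a V g)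
    (e : g =ᵐ[volume.restrict Ω] g') : IsHardyWeight p s Ω a V g' := by
  obtain ⟨hi, L, hL⟩ := h.isHardyWeight_iff.1 hg
  exact h.isHardyWeight_iff.2 ⟨locallyIntegrableOn_of_ae_eq h.isOpen hi e, L, hL.congr e⟩

theorem uNorm_congr (e : g =ᵐ[volume.restrict Ω] g') :
    uNorm p s Ω a V u g = uNorm p s Ω a V u g' :=
  le_antisymm (le_iInf₂ fun _ hL => CapBound.uNorm_le (CapBound.congr (g := g') hL e.symm))
    (le_iInf₂ fun _ hL => CapBound.uNorm_le (CapBound.congr (g := g) hL e))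

theorem IsPosSol.uNorm_lt_top (h : IsPosSol p s Ω a V u) (hg : IsHardyWeight p s Ω a V g) :
    uNorm p s Ω a V u g < ∞ := by
  obtain ⟨_, L, hL⟩ := h.isHardyWeight_iff.1 hg
  exact hL.uNorm_le.trans_lt ENNReal.coe_lt_top

theorem IsPosSol.uNorm_add_le (h : IsPosSol p s Ω a V u) (hg : IsHardyWeight p s Ω a V g)
    (hg' : IsHardyWeight p s Ω a V g') :
    uNorm p s Ω a V u (g + g') ≤ uNorm p s Ω a V u g + uNorm p s Ω a V u g' := by
  rw [← ENNReal.coe_toNNReal (h.uNorm_lt_top hg).ne,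
    ← ENNReal.coe_toNNReal (h.uNorm_lt_top hg').ne, ← ENNReal.coe_add, h.uNorm_le_iff]
  exact h.capBound_add hg.1 hg'.1
    (h.capBound_of_uNorm_le (ENNReal.coe_toNNReal (h.uNorm_lt_top hg).ne).ge)
    (h.capBound_of_uNorm_le (ENNReal.coe_toNNReal (h.uNorm_lt_top hg').ne).ge)

theorem IsPosSol.uNorm_smul_le (h : IsPosSol p s Ω a V u) (hg : IsHardyWeight p s Ω a V g)
    (c : ℝ) : uNorm p s Ω a V u (c • g) ≤ ‖c‖₊ * uNorm p s Ω a V u g := by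
  rw [← ENNReal.coe_toNNReal (h.uNorm_lt_top hg).ne, ← ENNReal.coe_mul, h.uNorm_le_iff]
  exact (h.capBound_of_uNorm_le (ENNReal.coe_toNNReal (h.uNorm_lt_top hg).ne).ge).smul c

/-- The space of Hardy-weights modulo equality a.e. in `Ω`. -/
def IsPosSol.hardySpace (h : IsPosSol p s Ω a V u) :
    Submodule ℝ (Eu n →ₘ[volume.restrict Ω] ℝ) where
  carrier := {g | IsHardyWeight p s Ω a V g}
  zero_mem' := by
    refine h.isHardyWeight_congr (g := 0) ?_ (AEEqFun.coeFn_zero).symm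
    exact h.isHardyWeight_iff.2 ⟨locallyIntegrableOn_zero, 0, h.capBound_zero⟩
  add_mem' := by
    intro g g' hg hg'
    refine h.isHardyWeight_congr ?_ (AEEqFun.coeFn_add g g').symm
    obtain ⟨hi, L, hL⟩ := h.isHardyWeight_iff.1 hg
    obtain ⟨hi', L', hL'⟩ := h.isHardyWeight_iff.1 hg'
    exact h.isHardyWeight_iff.2 ⟨hi.add hi', _, h.capBound_add hi hi' hL hL'⟩
  smul_mem' := by
    intro c g hg
    refine h.isHardyWeight_congr ?_ (AEEqFun.coeFn_smul c g).symm
    obtain ⟨hi, L, hL⟩ := h.isHardyWeight_iff.1 hg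
    exact h.isHardyWeight_iff.2 ⟨hi.smul c, _, hL.smul c⟩

theorem IsPosSol.mem_hardySpace (h : IsPosSol p s Ω a V u) {g : Eu n →ₘ[volume.restrict Ω] ℝ} :
    g ∈ h.hardySpace ↔ IsHardyWeight p s Ω a V g :=
  Iff.rfl

theorem IsPosSol.toReal_uNorm_smul_le (h : IsPosSol p s Ω a V u) (c : ℝ) (g : h.hardySpace) :
    (uNorm p s Ω a V u ((c • g : h.hardySpace) : Eu n →ₘ[volume.restrict Ω] ℝ)).toReal ≤
      ‖c‖ * (uNorm p s Ω a V u (g : Eu n →ₘ[volume.restrict Ω] ℝ)).toReal := by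
  have hfin := h.uNorm_lt_top (h.mem_hardySpace.1 g.2)
  have h1 := h.uNorm_smul_le (h.mem_hardySpace.1 g.2) c
  rw [← uNorm_congr (AEEqFun.coeFn_smul c (g : Eu n →ₘ[volume.restrict Ω] ℝ))] at h1
  have h2 := ENNReal.toReal_mono (ENNReal.mul_ne_top ENNReal.coe_ne_top hfin.ne) h1
  rwa [ENNReal.toReal_mul, ENNReal.coe_toReal, coe_nnnorm] at h2

theorem IsPosSol.core (h : IsPosSol p s Ω a V u) :
    @NormedSpace.Core ℝ h.hardySpace _ _ _
      ⟨fun g => (uNorm p s Ω a V u (g : Eu n →ₘ[volume.restrict Ω] ℝ)).toReal⟩ := by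
  let _ : Norm h.hardySpace :=
    ⟨fun g => (uNorm p s Ω a V u (g : Eu n →ₘ[volume.restrict Ω] ℝ)).toReal⟩
  have hle : ∀ (c : ℝ) (g : h.hardySpace), ‖c • g‖ ≤ ‖c‖ * ‖g‖ := h.toReal_uNorm_smul_le
  have hzero : ‖(0 : h.hardySpace)‖ = 0 := by
    refine le_antisymm ?_ ENNReal.toReal_nonneg
    simpa using hle 0 0
  refine { norm_nonneg := fun g => ENNReal.toReal_nonneg, norm_smul := fun c g => ?_,
           norm_triangle := fun g g' => ?_, norm_eq_zero_iff := fun g => ⟨fun hg => ?_, ?_⟩ }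
  -- Equality follows from the inequality for c by applying it to c⁻¹ and c g.
  · refine le_antisymm (hle c g) ?_
    rcases eq_or_ne c 0 with rfl | hc
    · rw [zero_smul, hzero, norm_zero, zero_mul]
    · have := hle c⁻¹ (c • g)
      rw [smul_smul, inv_mul_cancel₀ hc, one_smul, norm_inv] at this
      rwa [← le_inv_mul_iff₀ (norm_pos_iff.2 hc)]
  · have hg := h.mem_hardySpace.1 g.2
    have hg' := h.mem_hardySpace.1 g'.2
    have h1 := h.uNorm_add_le hg hg'
    rw [← uNorm_congr (AEEqFun.coeFn_add (g : Eu n →ₘ[volume.restrict Ω] ℝ) g')] at h1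
    have h2 := ENNReal.toReal_mono
      (ENNReal.add_ne_top.2 ⟨(h.uNorm_lt_top hg).ne, (h.uNorm_lt_top hg').ne⟩) h1
    rwa [ENNReal.toReal_add (h.uNorm_lt_top hg).ne (h.uNorm_lt_top hg').ne] at h2
  · have hw := h.mem_hardySpace.1 g.2
    have h0 : uNorm p s Ω a V u (g : Eu n →ₘ[volume.restrict Ω] ℝ) = 0 :=
      ((ENNReal.toReal_eq_zero_iff _).1 hg).resolve_right (h.uNorm_lt_top hw).ne
    have h1 := h.ae_eq_zero_of_capBound_zero hw.1 (h.capBound_of_uNorm_le (L := 0) h0.le)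
    exact Subtype.ext (AEEqFun.ext (h1.trans AEEqFun.coeFn_zero.symm))
  · rintro rfl
    exact hzero

theorem IsPosSol.isBanachNorm (h : IsPosSol p s Ω a V u) :
    IsBanachNorm h.hardySpace
      (fun g => (uNorm p s Ω a V u (g : Eu n →ₘ[volume.restrict Ω] ℝ)).toReal) := by
  refine isBanachNorm_of_core h.core fun f hf => ?_
  have hw : ∀ k, IsHardyWeight p s Ω a V (f k : Eu n →ₘ[volume.restrict Ω] ℝ) := fun k =>
    h.mem_hardySpace.1 (f k).2
  have hc : ∀ k l m, k ≤ l → k ≤ m →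
      CapBound p s Ω a V u ((f l : Eu n →ₘ[volume.restrict Ω] ℝ) -
        (f m : Eu n →ₘ[volume.restrict Ω] ℝ) : Eu n → ℝ) ((1 / 2) ^ k) := by
    intro k l m hl hm
    have hlt := h.uNorm_lt_top (h.mem_hardySpace.1 (f l - f m).2)
    refine CapBound.congr (h.capBound_of_uNorm_le ?_) (AEEqFun.coeFn_sub _ _)
    refine (ENNReal.toReal_le_toReal hlt.ne ENNReal.coe_ne_top).1 ((hf k l m hl hm).trans ?_)
    simp
  obtain ⟨g, hgm, hgi, hg⟩ := h.exists_limit (fun k => (hw k).1) hc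
  have e := AEEqFun.coeFn_mk g hgm
  have hgw : IsHardyWeight p s Ω a V (AEEqFun.mk g hgm) := by
    refine h.isHardyWeight_congr (h.isHardyWeight_iff.2 ⟨hgi, ?_⟩) e.symm
    obtain ⟨_, L, hL⟩ := h.isHardyWeight_iff.1 (hw 0)
    -- The limit is f₀ - (f₀ - g), a difference of two functions satisfying capacitary bounds, hence
    -- itself a Hardy-weight.
    have h1 := h.capBound_add (hw 0).1 (((hw 0).1.sub hgi).smul (-1 : ℝ)) hL
      ((hg 0).smul (-1))
    refine ⟨_, h1.congr (ae_of_all _ fun x => ?_)⟩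
    simp
  refine ⟨⟨AEEqFun.mk g hgm, hgw⟩, fun k => ?_⟩
  have h1 : CapBound p s Ω a V u ((f k : Eu n →ₘ[volume.restrict Ω] ℝ) -
      AEEqFun.mk g hgm : Eu n →ₘ[volume.restrict Ω] ℝ) ((1 / 2) ^ k) := by
    refine (hg k).congr ?_
    filter_upwards [e, AEEqFun.coeFn_sub (f k : Eu n →ₘ[volume.restrict Ω] ℝ)
      (AEEqFun.mk g hgm)] with x hx hx'
    rw [hx', Pi.sub_apply, Pi.sub_apply, hx]
  have h2 := ENNReal.toReal_mono ENNReal.coe_ne_top h1.uNorm_le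
  simpa using h2

end Banach

end HardyMazya

/-! ### The main theorem -/

theorem theorem3p13 (p s : ℝ) (hp : 1 < p) (hs : 1 < s) :
    -- the constant depends on `p`, `s`, `n` only, and not on `n` if `p ≤ s`
    ∃ C : ℕ → ℝ, (∀ n, 0 < C n) ∧ (p ≤ s → ∀ m n, C m = C n) ∧
      ∀ (n : ℕ), 2 ≤ n → ∀ (Ω : Set (Eu n)), IsDom Ω →
      ∀ (a : Eu n → Fin n → ℝ), IsCoeff Ω a →
      ∀ (q : ℝ) (V : Eu n → ℝ), MemMorreyLoc p q Ω V →
      ∀ (u : Eu n → ℝ), ContinuousOn u Ω → (∀ x ∈ Ω, 0 < u x) → IsWeakSol p s Ω a V u →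
        (∀ g : Eu n → ℝ, LocallyIntegrableOn g Ω →
          (IsHardyWeight p s Ω a V g ↔ uNorm p s Ω a V u g < ∞)) ∧
        (∀ g : Eu n → ℝ, IsHardyWeight p s Ω a V g →
          uNorm p s Ω a V u g ≤ hNorm p s Ω a V g ∧
          hNorm p s Ω a V g ≤ ENNReal.ofReal (C n) * uNorm p s Ω a V u g) ∧
        -- the Hardy-weights, modulo equality a.e. in `Ω`, form a Banach space under `‖·‖_u`
        ∃ W : Submodule ℝ (Eu n →ₘ[volume.restrict Ω] ℝ),
          (∀ g : Eu n →ₘ[volume.restrict Ω] ℝ, g ∈ W ↔ IsHardyWeight p s Ω a V g) ∧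
          IsBanachNorm W
            (fun g => (uNorm p s Ω a V u (g : Eu n →ₘ[volume.restrict Ω] ℝ)).toReal) := by
  obtain ⟨C, hC, H⟩ := exists_hNorm_le_uNorm hp hs
  -- The doubling constant of the Bregman distance is free of the dimension for all p and s, so a
  -- function constant in n serves both s < p and p ≤ s.
  refine ⟨fun _ => C, fun _ => hC, fun _ _ _ => rfl, ?_⟩
  intro n _ Ω hΩ a ha q V hV u huc hupos husol
  have h : IsPosSol p s Ω a V u :=
    ⟨hp, hs, hΩ.1, ha, hV.locallyIntegrableOn hΩ.1, huc, hupos, husol⟩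
  exact ⟨fun g hg => (H n Ω a V u h g hg).1,
    fun g hg => ⟨h.uNorm_le_hNorm hg, (H n Ω a V u h g hg.1).2 (h.uNorm_lt_top hg)⟩,
    h.hardySpace, fun g => h.mem_hardySpace, h.isBanachNorm⟩
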